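/- Let $n\in\{2,3\}$, $\mathbf Y=[0,1]^n$ (so $|\mathbf Y|=1$), and use the summation convention. Fix positive constants $\kappa_0,\kappa_1,\rho_*,\rho^*,c_*,c^*,\sigma,\bar\kappa$ and temperatures $0\le T_{\min}\le T_{\max}$. Consider measurable material parameters $\rho,c,k_{ij},\lambda_{ij},\beta_{ij},c_{ijkl}$, depending on $\mathbf y\in\mathbf Y$ and on the temperature $T_0\in[T_{\min},T_{\max}]$, such that for every such $T_0$ and almost every $\mathbf y$: $\rho_*\le\rho\le\rho^*$, $c_*\le c\le c^*$; the matrices $a=k,\lambda,\beta$ satisfy $a_{ij}=a_{ji}$ and $\kappa_0|\xi|^2\le a_{ij}\xi_i\xi_j\le\kappa_1|\xi|^2$ for all $\xi\in\mathbb R^n$; and $c_{ijkl}=c_{jikl}=c_{klij}$, $\kappa_0|\zeta|^2\le c_{ijkl}\zeta_{ij}\zeta_{kl}\le\kappa_1|\zeta|^2$ for all symmetric $\zeta\in\mathbb R^{n\times n}$. For fixed $T_0\in[T_{\min},T_{\max}]$ the first-order cell functions $\mathcal M_\alpha,\mathcal H_\alpha\in H^1_0(\mathbf Y)$ and $\mathcal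 N_m^\alpha=(\mathcal N_{km}^\alpha)_k,\ \mathcal P=(\mathcal P_k)_k\in H^1_0(\mathbf Y)^n$ are the weak solutions, with homogeneous Dirichlet conditions on $\partial\mathbf Y$, of $$\partial_i(k_{ij}\partial_j\mathcal M_\alpha)=-\partial_ik_{i\alpha},\quad \partial_i(\lambda_{ij}\partial_j\mathcal H_\alpha)=-\partial_i\lambda_{i\alpha},\quad \partial_j(c_{ijkl}\partial_l\mathcal N_{km}^{\alpha})=-\partial_jc_{ijm\alpha},\quad \partial_j(c_{ijkl}\partial_l\mathcal P_k)=\partial_j\beta_{ij}.$$ Assume that they all belong to $H^2(\mathbf Y)$. The homogenized coefficients are $$\widehat S=\int_{\mathbf Y}\big(\rho c+T_0\beta_{ij}\partial_j\mathcal P_i\big),\quad \widehat k_{ij}=\int_{\mathbf Y}\big(k_{ij}+k_{i\alpha}\partial_\alpha\mathcal M_j\big),\quad \widehat\lambda_{ij}=\int_{\mathbf Y}\big(\lambda_{ij}+\lambda_{i\alpha}\partial_\alpha\mathcal H_j\big),$$ $$\widehat c_{ijkl}=\int_{\mathbf Y}\big(c_{ijkl}+c_{ij\alpha\gamma}\partial_\gamma\mathcal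 N_{\alpha k}^{l}\big),\quad \widehat\beta_{ij}=\int_{\mathbf Y}\big(\beta_{ij}-c_{ijkl}\partial_l\mathcal P_k\big).$$ Let $\mathcal T_{h_1}$ be a conforming triangular or tetrahedral mesh of $\mathbf Y$ with mesh size $h_1=\max_K\operatorname{diam}K$ which is shape regular: each $K$ contains a ball of diameter at least $\sigma^{-1}\operatorname{diam}K$. Let $\mathcal V_{h_1}$ be the space of continuous functions on $\mathbf Y$ that vanish on $\partial\mathbf Y$ and are affine on each $K$. Let $\widehat S^{h_1},\widehat k^{h_1}_{ij},\widehat\lambda^{h_1}_{ij},\widehat c^{h_1}_{ijkl},\widehat\beta^{h_1}_{ij}$ be given by the same formulas with the cell functions replaced by the Galerkin solutions of the same cell problems in $\mathcal V_{h_1}$. Then there are constants $C,\widetilde S_0,\widetilde S_1,\widetilde\kappa_0,\widetilde\kappa_1>0$, depending only on $n,\kappa_0,\kappa_1,\rho_*,\rho^*,c_*,c^*,T_{\min},T_{\max},\sigma,\bar\kappa$ (and so neither on $h_1$ nor on $T_0$), such that $$|\widehat S^{h_1}-\widehat S|\le Ch_1^2\|\mathcal P\|_{(H^2(\mathbf Y))^n}^2,\qquad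 \widetilde S_0\le\widehat S^{h_1}\le\widetilde S_1,$$ $$|\widehat k^{h_1}_{ij}-\widehat k_{ij}|\le Ch_1^2\|\mathcal M_i\|_{H^2(\mathbf Y)}\|\mathcal M_j\|_{H^2(\mathbf Y)},\qquad \widetilde\kappa_0|\xi|^2\le\widehat k^{h_1}_{ij}\xi_i\xi_j\le\widetilde\kappa_1|\xi|^2,$$ $$|\widehat\lambda^{h_1}_{ij}-\widehat\lambda_{ij}|\le Ch_1^2\|\mathcal H_i\|_{H^2(\mathbf Y)}\|\mathcal H_j\|_{H^2(\mathbf Y)},\qquad \widetilde\kappa_0|\xi|^2\le\widehat\lambda^{h_1}_{ij}\xi_i\xi_j\le\widetilde\kappa_1|\xi|^2,$$ $$|\widehat c^{h_1}_{ijkl}-\widehat c_{ijkl}|\le Ch_1^2\|\mathcal N_i^j\|_{(H^2(\mathbf Y))^n}\|\mathcal N_k^l\|_{(H^2(\mathbf Y))^n},\qquad \widetilde\kappa_0|\zeta|^2\le\widehat c^{h_1}_{ijkl}\zeta_{ij}\zeta_{kl}\le\widetilde\kappa_1|\zeta|^2,$$ $$|\widehat\beta^{h_1}_{ij}-\widehat\beta_{ij}|\le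 Ch_1^2\|\mathcal N_i^j\|_{(H^2(\mathbf Y))^n}\|\mathcal P\|_{(H^2(\mathbf Y))^n},\qquad \widehat\beta^{h_1}_{ij}\xi_i\xi_j\le\widetilde\kappa_1|\xi|^2$$ for all $\xi\in\mathbb R^n$ and all symmetric $\zeta\in\mathbb R^{n\times n}$. Moreover, for each $R>0$ there is $h_*>0$, depending only on $R$ and the constants listed above, such that whenever the exact coefficient satisfies $\bar\kappa|\xi|^2\le\widehat\beta_{ij}\xi_i\xi_j$ for all $\xi$, the norms $\|\mathcal N_i^j\|_{(H^2(\mathbf Y))^n}$ (all $i,j$) and $\|\mathcal P\|_{(H^2(\mathbf Y))^n}$ are at most $R$, and $h_1\le h_*$, also $\widetilde\kappa_0|\xi|^2\le\widehat\beta^{h_1}_{ij}\xi_i\xi_j$ for all $\xi$. -/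

import Mathlib

open MeasureTheory Filter Topology
open scoped ContDiff

noncomputable section

namespace CellFE

/-- Points of `ℝⁿ` with the Euclidean norm. -/
abbrev Pt (n : ℕ) : Type := EuclideanSpace ℝ (Fin n)

/-- The unit cell `Y = [0,1]ⁿ`. -/
def cell (n : ℕ) : Set (Pt n) := {y | ∀ i, y i ∈ Set.Icc (0 : ℝ) 1}

/-- Lebesgue measure on the unit cell. -/
def μY (n : ℕ) : Measure (Pt n) := volume.restrict (cell n)

/-- The classical partial derivative `∂φ/∂yᵢ`. -/
def partialD {n : ℕ} (i : Fin n) (φ : Pt n → ℝ) (y : Pt n) : ℝ :=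
  fderiv ℝ φ y (EuclideanSpace.single i 1)

/-- Test functions: `φ ∈ C_c^∞` with support in the open unit cube. -/
def IsTest {n : ℕ} (φ : Pt n → ℝ) : Prop :=
  ContDiff ℝ ∞ φ ∧ HasCompactSupport φ ∧ tsupport φ ⊆ interior (cell n)

/-- `g ∈ L²(Y)` is the weak derivative of `u` in direction `i` on the open cell. -/
def IsWeakPartial {n : ℕ} (i : Fin n) (u g : Pt n → ℝ) : Prop :=
  MemLp g 2 (μY n) ∧
    ∀ φ : Pt n → ℝ, IsTest φ → ∫ y, u y * partialD i φ y ∂(μY n) = -∫ y, g y * φ y ∂(μY n)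

open Classical in
/-- The weak derivative `∂u/∂yᵢ ∈ L²(Y)` (unique up to null sets); `0` if there is none. -/
def weakD {n : ℕ} (i : Fin n) (u : Pt n → ℝ) : Pt n → ℝ :=
  if h : ∃ g, IsWeakPartial i u g then h.choose else 0

/-- `u ∈ H¹(Y)`. -/
def MemH1 {n : ℕ} (u : Pt n → ℝ) : Prop :=
  MemLp u 2 (μY n) ∧ ∀ i, ∃ g, IsWeakPartial i u g

/-- `u ∈ H²(Y)`. -/
def MemH2 {n : ℕ} (u : Pt n → ℝ) : Prop :=
  MemH1 u ∧ ∀ i, MemH1 (weakD i u)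

/-- The square of the `H¹(Y)` norm. -/
def H1sq {n : ℕ} (u : Pt n → ℝ) : ℝ :=
  ∫ y, u y ^ 2 ∂(μY n) + ∑ i, ∫ y, weakD i u y ^ 2 ∂(μY n)

/-- The square of the `H²(Y)` norm. -/
def H2sq {n : ℕ} (u : Pt n → ℝ) : ℝ :=
  H1sq u + ∑ i, ∑ j, ∫ y, weakD j (weakD i u) y ^ 2 ∂(μY n)

/-- The `H²(Y)` norm. -/
def H2norm {n : ℕ} (u : Pt n → ℝ) : ℝ := √(H2sq u)

/-- The norm of `(H²(Y))ⁿ`. -/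
def H2normVec {n : ℕ} (u : Fin n → Pt n → ℝ) : ℝ := √(∑ k, H2sq (u k))

/-- `H¹₀(Y)`: the closure of the test functions in `H¹(Y)`. -/
def H10 (n : ℕ) : Set (Pt n → ℝ) :=
  {u | MemH1 u ∧ ∃ φ : ℕ → Pt n → ℝ, (∀ m, IsTest (φ m)) ∧
    Tendsto (fun m => H1sq (fun y => u y - φ m y)) atTop (𝓝 0)}

/-- A conforming triangular / tetrahedral mesh of the unit cell: a finite simplicial complex whose
`n`-dimensional simplices cover exactly the cell. -/
structure Mesh (n : ℕ) where
  complex : Geometry.SimplicialComplex ℝ (Pt n)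
  finite_faces : complex.faces.Finite
  cover : (⋃ K ∈ {K ∈ complex.faces | K.card = n + 1}, convexHull ℝ (K : Set (Pt n))) = cell n

namespace Mesh

variable {n : ℕ} (𝒯 : Mesh n)

/-- The elements (vertex sets of the `n`-dimensional simplices) of the mesh. -/
def elements : Set (Finset (Pt n)) := {K ∈ 𝒯.complex.faces | K.card = n + 1}

/-- The mesh size, i.e. the maximum of the (finitely many) element diameters. -/
def size : ℝ :=
  sSup ((fun K : Finset (Pt n) => Metric.diam (convexHull ℝ (K : Set (Pt n)))) '' 𝒯.elements)

/-- Shape regularity: each element has diameter at most `σ` times the diameter of some ball that it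
contains. -/
def ShapeRegular (σ : ℝ) : Prop :=
  ∀ K ∈ 𝒯.elements, ∃ (x : Pt n) (r : ℝ), 0 < r ∧
    Metric.closedBall x r ⊆ convexHull ℝ (K : Set (Pt n)) ∧
    Metric.diam (convexHull ℝ (K : Set (Pt n))) ≤ σ * (2 * r)

/-- The linear conforming finite element space: continuous on the cell, zero on its boundary and
affine on each element. -/
def P1 : Set (Pt n → ℝ) :=
  {v | ContinuousOn v (cell n) ∧ (∀ y ∈ frontier (cell n), v y = 0) ∧
    ∀ K ∈ 𝒯.elements, ∃ f : Pt n →ᵃ[ℝ] ℝ, Set.EqOn v f (convexHull ℝ (K : Set (Pt n)))}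

end Mesh

/-- The material parameters, as functions of the temperature `T` and of the point `y` of the cell:
density, specific heat, thermal conductivity, electric conductivity, thermal modulus, elastic
modulus. -/
structure Material (n : ℕ) where
  rho : ℝ → Pt n → ℝ
  heat : ℝ → Pt n → ℝ
  k : Fin n → Fin n → ℝ → Pt n → ℝ
  lam : Fin n → Fin n → ℝ → Pt n → ℝ
  beta : Fin n → Fin n → ℝ → Pt n → ℝ
  c : Fin n → Fin n → Fin n → Fin n → ℝ → Pt n → ℝ

/-- `κ₀ |ξ|² ≤ a_{ij} ξ_i ξ_j`. -/
def LowerBound {n : ℕ} (κ₀ : ℝ) (a : Fin n → Fin n → ℝ) : Prop :=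
  ∀ ξ : Fin n → ℝ, κ₀ * ∑ i, ξ i ^ 2 ≤ ∑ i, ∑ j, a i j * ξ i * ξ j

/-- `a_{ij} ξ_i ξ_j ≤ κ₁ |ξ|²`. -/
def UpperBound {n : ℕ} (κ₁ : ℝ) (a : Fin n → Fin n → ℝ) : Prop :=
  ∀ ξ : Fin n → ℝ, ∑ i, ∑ j, a i j * ξ i * ξ j ≤ κ₁ * ∑ i, ξ i ^ 2

/-- `κ₀ |ζ|² ≤ a_{ijkl} ζ_{ij} ζ_{kl} ≤ κ₁ |ζ|²` for all symmetric `ζ`. -/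
def TensorBounds {n : ℕ} (κ₀ κ₁ : ℝ) (a : Fin n → Fin n → Fin n → Fin n → ℝ) : Prop :=
  ∀ ζ : Fin n → Fin n → ℝ, (∀ i j, ζ i j = ζ j i) →
    κ₀ * ∑ i, ∑ j, ζ i j ^ 2 ≤ ∑ i, ∑ j, ∑ k, ∑ l, a i j k l * ζ i j * ζ k l ∧
    ∑ i, ∑ j, ∑ k, ∑ l, a i j k l * ζ i j * ζ k l ≤ κ₁ * ∑ i, ∑ j, ζ i j ^ 2

/-- A symmetric matrix that is elliptic and bounded with constants `κ₀`, `κ₁`. -/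
def EllipticMatrix {n : ℕ} (κ₀ κ₁ : ℝ) (a : Fin n → Fin n → ℝ) : Prop :=
  (∀ i j, a i j = a j i) ∧ LowerBound κ₀ a ∧ UpperBound κ₁ a

/-- An elasticity tensor with its symmetries that is elliptic and bounded with constants `κ₀`,
`κ₁`. -/
def EllipticTensor {n : ℕ} (κ₀ κ₁ : ℝ) (a : Fin n → Fin n → Fin n → Fin n → ℝ) : Prop :=
  (∀ i j k l, a i j k l = a j i k l) ∧ (∀ i j k l, a i j k l = a k l i j) ∧ TensorBounds κ₀ κ₁ a

/-- The standing assumptions on the material parameters for temperatures in `[Tmin, Tmax]`: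
measurability, symmetry, uniform ellipticity and boundedness. -/
structure Material.Admissible {n : ℕ} (D : Material n)
    (κ₀ κ₁ ρ₀ ρ₁ c₀ c₁ Tmin Tmax : ℝ) : Prop where
  meas_rho : ∀ T ∈ Set.Icc Tmin Tmax, AEStronglyMeasurable (D.rho T) (μY n)
  meas_heat : ∀ T ∈ Set.Icc Tmin Tmax, AEStronglyMeasurable (D.heat T) (μY n)
  meas_k : ∀ T ∈ Set.Icc Tmin Tmax, ∀ i j, AEStronglyMeasurable (D.k i j T) (μY n)
  meas_lam : ∀ T ∈ Set.Icc Tmin Tmax, ∀ i j, AEStronglyMeasurable (D.lam i j T) (μY n)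
  meas_beta : ∀ T ∈ Set.Icc Tmin Tmax, ∀ i j, AEStronglyMeasurable (D.beta i j T) (μY n)
  meas_c : ∀ T ∈ Set.Icc Tmin Tmax, ∀ i j k l, AEStronglyMeasurable (D.c i j k l T) (μY n)
  rho_bounds : ∀ T ∈ Set.Icc Tmin Tmax, ∀ᵐ y ∂(μY n), ρ₀ ≤ D.rho T y ∧ D.rho T y ≤ ρ₁
  heat_bounds : ∀ T ∈ Set.Icc Tmin Tmax, ∀ᵐ y ∂(μY n), c₀ ≤ D.heat T y ∧ D.heat T y ≤ c₁
  k_elliptic : ∀ T ∈ Set.Icc Tmin Tmax, ∀ᵐ y ∂(μY n),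
    EllipticMatrix κ₀ κ₁ (fun i j => D.k i j T y)
  lam_elliptic : ∀ T ∈ Set.Icc Tmin Tmax, ∀ᵐ y ∂(μY n),
    EllipticMatrix κ₀ κ₁ (fun i j => D.lam i j T y)
  beta_elliptic : ∀ T ∈ Set.Icc Tmin Tmax, ∀ᵐ y ∂(μY n),
    EllipticMatrix κ₀ κ₁ (fun i j => D.beta i j T y)
  c_elliptic : ∀ T ∈ Set.Icc Tmin Tmax, ∀ᵐ y ∂(μY n),
    EllipticTensor κ₀ κ₁ (fun i j k l => D.c i j k l T y)

/-- A family of first-order cell functions at a fixed temperature. `N m α k` is the `k`-th component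
of the vector cell function with indices `m`, `α` (`N_{km}^α` in index notation). -/
structure CellFunctions (n : ℕ) where
  M : Fin n → Pt n → ℝ
  H : Fin n → Pt n → ℝ
  N : Fin n → Fin n → Fin n → Pt n → ℝ
  P : Fin n → Pt n → ℝ

/-- The first-order cell problems at temperature `T` in variational form, with trial and test
space `W` (vector fields have all components in `W`). With `W = H10 n` these are the weak forms of
`∂_i(k_{ij} ∂_j M_α) = -∂_i k_{iα}`, `∂_i(λ_{ij} ∂_j H_α) = -∂_i λ_{iα}`,
`∂_j(c_{ijkl} ∂_l N_{km}^α) = -∂_j c_{ijmα}`, `∂_j(c_{ijkl} ∂_l P_k) = ∂_j β_{ij}`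
with homogeneous Dirichlet conditions; with a finite element space they are the Galerkin scheme. -/
structure SolvesCellProblems {n : ℕ} (D : Material n) (T : ℝ) (W : Set (Pt n → ℝ))
    (X : CellFunctions n) : Prop where
  memM : ∀ α, X.M α ∈ W
  memH : ∀ α, X.H α ∈ W
  memN : ∀ m α k, X.N m α k ∈ W
  memP : ∀ k, X.P k ∈ W
  eqM : ∀ α, ∀ v ∈ W,
    ∫ y, ∑ i, ∑ j, D.k i j T y * weakD j (X.M α) y * weakD i v y ∂(μY n) =
      -∫ y, ∑ i, D.k i α T y * weakD i v y ∂(μY n)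
  eqH : ∀ α, ∀ v ∈ W,
    ∫ y, ∑ i, ∑ j, D.lam i j T y * weakD j (X.H α) y * weakD i v y ∂(μY n) =
      -∫ y, ∑ i, D.lam i α T y * weakD i v y ∂(μY n)
  eqN : ∀ m α, ∀ v : Fin n → Pt n → ℝ, (∀ i, v i ∈ W) →
    ∫ y, ∑ i, ∑ j, ∑ k, ∑ l,
        D.c i j k l T y * weakD l (X.N m α k) y * weakD j (v i) y ∂(μY n) =
      -∫ y, ∑ i, ∑ j, D.c i j m α T y * weakD j (v i) y ∂(μY n)
  eqP : ∀ v : Fin n → Pt n → ℝ, (∀ i, v i ∈ W) →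
    ∫ y, ∑ i, ∑ j, ∑ k, ∑ l,
        D.c i j k l T y * weakD l (X.P k) y * weakD j (v i) y ∂(μY n) =
      ∫ y, ∑ i, ∑ j, D.beta i j T y * weakD j (v i) y ∂(μY n)

/-- All cell functions belong to `H²(Y)`. -/
structure CellFunctions.InH2 {n : ℕ} (X : CellFunctions n) : Prop where
  M : ∀ α, MemH2 (X.M α)
  H : ∀ α, MemH2 (X.H α)
  N : ∀ m α k, MemH2 (X.N m α k)
  P : ∀ k, MemH2 (X.P k)

/-! The homogenization formulas, evaluated on an arbitrary family of cell functions (`⨍` is the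
mean `|Y|⁻¹ ∫_Y`). On the exact cell functions they give the homogenized coefficients, on the
finite element cell functions their finite element approximations. -/

variable {n : ℕ} (D : Material n) (T : ℝ) (X : CellFunctions n)

def homS : ℝ :=
  ⨍ y in cell n, (D.rho T y * D.heat T y + T * ∑ i, ∑ j, D.beta i j T y * weakD j (X.P i) y)

def homK (i j : Fin n) : ℝ :=
  ⨍ y in cell n, (D.k i j T y + ∑ a, D.k i a T y * weakD a (X.M j) y)

def homLam (i j : Fin n) : ℝ :=
  ⨍ y in cell n, (D.lam i j T y + ∑ a, D.lam i a T y * weakD a (X.H j) y)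

def homC (i j k l : Fin n) : ℝ :=
  ⨍ y in cell n, (D.c i j k l T y + ∑ a, ∑ b, D.c i j a b T y * weakD b (X.N k l a) y)

def homBeta (i j : Fin n) : ℝ :=
  ⨍ y in cell n, (D.beta i j T y - ∑ k, ∑ l, D.c i j k l T y * weakD l (X.P k) y)

end CellFE

end

/-!
Error estimates and ellipticity for finite element approximations of homogenized coefficients.

**The error is quadratic.** Each cell problem has the form `B(m, f) = F(f)` with a symmetric
positive semidefinite energy form `B` on square integrable fields, restricted to gradients of `H¹₀`
functions, and up to terms that do not involve the cell functions the homogenized coefficients are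
values of such loads on the solutions. If `m, m'` solve the problems with loads `F, F'` and
`mₕ, mₕ'` are the Galerkin solutions, then Galerkin orthogonality gives
`F(m') - F(mₕ') = B(m - mₕ, m' - mₕ')` (`IsGalerkin.functional_error`). By the
Cauchy–Schwarz inequality and Céa's lemma the error of every coefficient is thus at most the product
of the best approximation errors of two cell functions in the energy norm, each of which is of
order `h₁` times an `H²` norm. The scalar and elastic cell problems are both treated as
`IsEnergy`, with index sets `Fin n` and `Fin n × Fin n`.

**The bounds.** Upper bounds for `k̂, λ̂, ĉ` follow because correctors lower the energy of constant
fields. Lower bounds follow from Jensen's inequality, as gradients of `H¹₀` functions have mean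
zero; this argument applies to the Galerkin solutions as well, so the constants `κ₀, κ₁` persist.
The energy of `𝒫ₕ` is bounded by Young's inequality (`IsEnergy.form_le_of_eq_pairing`), which bounds
`Ŝ` and `β̂` from above; `β̂ₕ` is bounded from below by perturbation from `β̂`.

**Approximation.** The finite element space is conforming (`P1_subset_H10`): its elements extend by
zero to Lipschitz functions, and mollifying after a slight contraction towards the centre of the
cube produces test functions. Mollifying after a slight expansion instead shows that `H²` functions
are limits of smooth functions (`exists_smooth_approx`). The best approximation estimate
(`exists_interpolant`) comes from nodal interpolation. For smooth functions the gradient of the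
interpolation error on a simplex is a combination of the Taylor remainders at the vertices,
weighted by the gradients of the barycentric coordinates, which the inscribed ball controls. The
mean square of a Taylor remainder is at most a multiple of the Hessian for `n ≤ 3`
(`integral_sq_taylorRem_le`); the same inequality averaged over the cell gives the
embedding of `H²` in the bounded functions (`sq_apply_le`), hence nodal values for `H²` functions.
These vanish on the boundary of the cell for functions in `H¹₀` (`exists_nodal_values`): otherwise
the function would be bounded below near a boundary point, contradicting that its square
integral over a boundary strip of width `η` is of order `η²`.
-/

noncomputable section

namespace CellFE

/-! ### The unit cell -/

section Cell

variable {n : ℕ}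

lemma cell_eq_preimage (n : ℕ) :
    cell n = (EuclideanSpace.equiv (Fin n) ℝ).toHomeomorph ⁻¹'
      Set.pi Set.univ (fun _ => Set.Icc (0 : ℝ) 1) := by
  ext y; simp [cell, Pi.le_def, forall_and]

lemma isCompact_cell (n : ℕ) : IsCompact (cell n) := by
  rw [cell_eq_preimage, Homeomorph.isCompact_preimage]
  exact isCompact_univ_pi fun _ => isCompact_Icc

lemma isClosed_cell (n : ℕ) : IsClosed (cell n) := (isCompact_cell n).isClosed

lemma measurableSet_cell (n : ℕ) : MeasurableSet (cell n) := (isClosed_cell n).measurableSet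

lemma convex_cell (n : ℕ) : Convex ℝ (cell n) := by
  intro x hx y hy a b ha hb hab i
  exact (convex_Icc (0 : ℝ) 1) (hx i) (hy i) ha hb hab

lemma interior_cell (n : ℕ) : interior (cell n) = {y | ∀ i, y i ∈ Set.Ioo (0 : ℝ) 1} := by
  rw [cell_eq_preimage, ← Homeomorph.preimage_interior, interior_pi_set Set.finite_univ]
  ext y; simp [interior_Icc]

lemma mem_frontier_cell {y : Pt n} :
    y ∈ frontier (cell n) ↔ y ∈ cell n ∧ ∃ i, y i = 0 ∨ y i = 1 := by
  rw [(isClosed_cell n).frontier_eq, interior_cell]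
  constructor
  · rintro ⟨hy, h⟩
    refine ⟨hy, ?_⟩
    by_contra! hc
    exact h fun i => ⟨lt_of_le_of_ne (hy i).1 (hc i).1.symm, lt_of_le_of_ne (hy i).2 (hc i).2⟩
  · rintro ⟨hy, i, hi⟩
    refine ⟨hy, fun h => ?_⟩
    have := h i
    rcases hi with hi | hi <;> simp [hi] at this

lemma volume_box (α β : Fin n → ℝ) :
    volume {y : Pt n | ∀ i, y i ∈ Set.Icc (α i) (β i)} = ∏ i, ENNReal.ofReal (β i - α i) := by
  rw [← Real.volume_Icc_pi,
    ← (PiLp.volume_preserving_ofLp (Fin n)).measure_preimage measurableSet_Icc.nullMeasurableSet]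
  congr 1
  ext y
  simp [Set.mem_Icc, Pi.le_def, forall_and]

lemma volume_cell (n : ℕ) : volume (cell n) = 1 := by
  have := volume_box (n := n) (fun _ => 0) (fun _ => 1)
  simpa [cell] using this

instance : IsProbabilityMeasure (μY n) := ⟨by simp [μY, volume_cell]⟩

lemma volume_frontier_cell (n : ℕ) : volume (frontier (cell n)) = 0 :=
  (convex_cell n).addHaar_frontier volume

lemma ae_mem_interior_cell (n : ℕ) : ∀ᵐ y ∂(μY n), y ∈ interior (cell n) := by
  rw [μY, ae_restrict_iff' (measurableSet_cell n)]
  have : ∀ᵐ y ∂(volume : Measure (Pt n)), y ∉ frontier (cell n) :=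
    measure_eq_zero_iff_ae_notMem.1 (volume_frontier_cell n)
  filter_upwards [this] with y hy hc
  by_contra h
  exact hy ((isClosed_cell n).frontier_eq ▸ ⟨hc, h⟩)

lemma norm_sub_le_of_mem_cell {x y : Pt n} (hx : x ∈ cell n) (hy : y ∈ cell n) :
    ‖x - y‖ ≤ n := by
  have h1 : ‖x - y‖ ^ 2 ≤ n := by
    rw [EuclideanSpace.norm_sq_eq]
    calc ∑ i, ‖(x - y) i‖ ^ 2 ≤ ∑ _i : Fin n, (1 : ℝ) := by
          refine Finset.sum_le_sum fun i _ => ?_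
          have := hx i; have := hy i
          simp only [Set.mem_Icc] at *
          rw [Real.norm_eq_abs, sq_abs, PiLp.sub_apply]
          nlinarith
      _ = n := by simp
  rcases Nat.eq_zero_or_pos n with rfl | hn
  · have : x = y := Subsingleton.elim _ _
    simp [this]
  · have : (1 : ℝ) ≤ n := by exact_mod_cast hn
    nlinarith [norm_nonneg (x - y)]

end Cell

/-! ### Weak derivatives -/

section Weak

variable {n : ℕ}

lemma setIntegral_cell_eq {f g : Pt n → ℝ} (hf : ∀ y, y ∉ interior (cell n) → f y = 0) :
    ∫ y, g y * f y ∂(μY n) = ∫ y, g y * f y := by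
  rw [μY]
  refine setIntegral_eq_integral_of_forall_compl_eq_zero fun y hy => ?_
  rw [hf y fun h => hy (interior_subset h), mul_zero]

lemma IsTest.eq_zero {φ : Pt n → ℝ} (h : IsTest φ) {y : Pt n} (hy : y ∉ interior (cell n)) :
    φ y = 0 := by
  by_contra hc
  exact hy (h.2.2 (subset_tsupport _ hc))

lemma tsupport_partialD_subset (i : Fin n) (φ : Pt n → ℝ) :
    tsupport (partialD i φ) ⊆ tsupport φ :=
  closure_minimal (fun y hy => by
    have : fderiv ℝ φ y ≠ 0 := fun h => hy (by simp [partialD, h])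
    exact support_fderiv_subset ℝ this) (isClosed_tsupport _)

lemma contDiff_partialD {φ : Pt n → ℝ} (h : ContDiff ℝ ∞ φ) (i : Fin n) :
    ContDiff ℝ ∞ (partialD i φ) :=
  (h.fderiv_right (m := ∞) (by simp)).clm_apply contDiff_const

lemma IsTest.partialD {φ : Pt n → ℝ} (h : IsTest φ) (i : Fin n) : IsTest (partialD i φ) :=
  ⟨contDiff_partialD h.1 i,
    h.2.1.of_isClosed_subset (isClosed_tsupport _) (tsupport_partialD_subset i φ),
    (tsupport_partialD_subset i φ).trans h.2.2⟩

lemma memLp_of_continuous {f : Pt n → ℝ} (hf : Continuous f) : MemLp f 2 (μY n) := by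
  obtain ⟨C, hC⟩ := (isCompact_cell n).exists_bound_of_continuousOn hf.continuousOn
  refine MemLp.of_bound hf.aestronglyMeasurable C ?_
  rw [μY, ae_restrict_iff' (measurableSet_cell n)]
  exact Eventually.of_forall hC

lemma IsTest.memLp {φ : Pt n → ℝ} (h : IsTest φ) : MemLp φ 2 (μY n) :=
  memLp_of_continuous h.1.continuous

lemma integrable_mul_of_memLp {f g : Pt n → ℝ} (hf : MemLp f 2 (μY n)) (hg : MemLp g 2 (μY n)) :
    Integrable (fun y => f y * g y) (μY n) := hf.integrable_mul hg

lemma IsWeakPartial.ae_eq {i : Fin n} {u g g' : Pt n → ℝ} (h : IsWeakPartial i u g)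
    (h' : IsWeakPartial i u g') : g =ᵐ[μY n] g' := by
  have hint : Integrable (g - g') (μY n) := (h.1.sub h'.1).integrable (by norm_num)
  have key : ∀ᵐ x ∂(volume : Measure (Pt n)), x ∈ interior (cell n) → (g - g') x = 0 := by
    refine isOpen_interior.ae_eq_zero_of_integral_contDiff_smul_eq_zero ?_ ?_
    · have h1 : IntegrableOn (g - g') (cell n) volume := hint
      exact (h1.mono_set interior_subset).locallyIntegrableOn
    · intro φ hφ hc hs
      have hφ : IsTest φ := ⟨hφ, hc, hs⟩
      have e1 := (h.2 φ hφ).symm.trans (h'.2 φ hφ)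
      have e2 : ∫ y, (g - g') y * φ y ∂(μY n) = 0 := by
        simp only [Pi.sub_apply, sub_mul]
        rw [integral_sub (integrable_mul_of_memLp h.1 hφ.memLp)
          (integrable_mul_of_memLp h'.1 hφ.memLp)]
        linarith
      rw [setIntegral_cell_eq fun y hy => hφ.eq_zero hy] at e2
      simpa [mul_comm] using e2
  have k2 := ae_restrict_of_ae (s := cell n) key
  filter_upwards [k2, ae_mem_interior_cell n] with y hy hi
  have := hy hi
  simpa [sub_eq_zero] using this

lemma weakD_spec {i : Fin n} {u : Pt n → ℝ} (h : ∃ g, IsWeakPartial i u g) :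
    IsWeakPartial i u (weakD i u) := by
  rw [weakD, dif_pos h]; exact h.choose_spec

lemma IsWeakPartial.weakD_ae {i : Fin n} {u g : Pt n → ℝ} (h : IsWeakPartial i u g) :
    weakD i u =ᵐ[μY n] g := (weakD_spec ⟨g, h⟩).ae_eq h

lemma MemH1.isWeakPartial {u : Pt n → ℝ} (h : MemH1 u) (i : Fin n) :
    IsWeakPartial i u (weakD i u) := weakD_spec (h.2 i)

lemma MemH1.memLp_weakD {u : Pt n → ℝ} (h : MemH1 u) (i : Fin n) : MemLp (weakD i u) 2 (μY n) :=
  (h.isWeakPartial i).1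

lemma IsWeakPartial.sub {i : Fin n} {u v g f : Pt n → ℝ} (hu : MemLp u 2 (μY n))
    (hv : MemLp v 2 (μY n)) (h : IsWeakPartial i u g) (h' : IsWeakPartial i v f) :
    IsWeakPartial i (fun y => u y - v y) (fun y => g y - f y) := by
  refine ⟨h.1.sub h'.1, fun φ hφ => ?_⟩
  simp only [sub_mul]
  rw [integral_sub (integrable_mul_of_memLp hu (hφ.partialD i).memLp)
      (integrable_mul_of_memLp hv (hφ.partialD i).memLp),
    integral_sub (integrable_mul_of_memLp h.1 hφ.memLp)
      (integrable_mul_of_memLp h'.1 hφ.memLp), h.2 φ hφ, h'.2 φ hφ]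
  ring

lemma integral_mul_partialD {u φ : Pt n → ℝ} (hu : ContDiff ℝ 1 u) (hφ : ContDiff ℝ 1 φ)
    (hc : HasCompactSupport φ) (i : Fin n) :
    ∫ y, u y * partialD i φ y = -∫ y, partialD i u y * φ y := by
  have hcu : Continuous (fun x => fderiv ℝ u x (EuclideanSpace.single i 1)) :=
    (hu.continuous_fderiv (by norm_num)).clm_apply continuous_const
  have hcφ : Continuous (fun x => fderiv ℝ φ x (EuclideanSpace.single i 1)) :=
    (hφ.continuous_fderiv (by norm_num)).clm_apply continuous_const
  have hc' : HasCompactSupport (fun x => fderiv ℝ φ x (EuclideanSpace.single i 1)) :=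
    hc.of_isClosed_subset (isClosed_tsupport _) (tsupport_partialD_subset i φ)
  exact integral_mul_fderiv_eq_neg_fderiv_mul_of_integrable
    ((hcu.mul hφ.continuous).integrable_of_hasCompactSupport hc.mul_left)
    ((hu.continuous.mul hcφ).integrable_of_hasCompactSupport hc'.mul_left)
    ((hu.continuous.mul hφ.continuous).integrable_of_hasCompactSupport hc.mul_left)
    (fun x _ => hu.differentiable (by norm_num) x) (fun x _ => hφ.differentiable (by norm_num) x)

lemma isWeakPartial_of_contDiff {u : Pt n → ℝ} (hu : ContDiff ℝ ∞ u) (i : Fin n) :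
    IsWeakPartial i u (partialD i u) := by
  refine ⟨memLp_of_continuous (contDiff_partialD hu i).continuous, fun φ hφ => ?_⟩
  rw [setIntegral_cell_eq fun y hy => (hφ.partialD i).eq_zero hy,
    setIntegral_cell_eq fun y hy => hφ.eq_zero hy]
  exact integral_mul_partialD (hu.of_le (by exact_mod_cast le_top))
    (hφ.1.of_le (by exact_mod_cast le_top)) hφ.2.1 i

lemma H1sq_sub_eq {u φ : Pt n → ℝ} {G : Fin n → Pt n → ℝ} (hu : MemLp u 2 (μY n))
    (hG : ∀ i, IsWeakPartial i u (G i)) (hφ : ContDiff ℝ ∞ φ) :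
    H1sq (fun y => u y - φ y) = ∫ y, (u y - φ y) ^ 2 ∂(μY n)
      + ∑ i, ∫ y, (G i y - partialD i φ y) ^ 2 ∂(μY n) := by
  rw [H1sq]
  congr 1
  refine Finset.sum_congr rfl fun i _ => integral_congr_ae ?_
  have := ((hG i).sub hu (memLp_of_continuous hφ.continuous)
    (isWeakPartial_of_contDiff hφ i)).weakD_ae
  filter_upwards [this] with y hy
  rw [hy]

lemma H1sq_nonneg (u : Pt n → ℝ) : 0 ≤ H1sq u :=
  add_nonneg (integral_nonneg fun _ => sq_nonneg _)
    (Finset.sum_nonneg fun _ _ => integral_nonneg fun _ => sq_nonneg _)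

lemma H2sq_nonneg (u : Pt n → ℝ) : 0 ≤ H2sq u :=
  add_nonneg (H1sq_nonneg u)
    (Finset.sum_nonneg fun _ _ => Finset.sum_nonneg fun _ _ => integral_nonneg fun _ => sq_nonneg _)

end Weak

/-! ### Finite element functions are Lipschitz -/

section Lip

variable {n : ℕ}

/-- A function that is `L`-Lipschitz on each set of a finite closed cover is `L`-Lipschitz: along
every segment the right slopes are frequently computed inside a single set of the cover. -/
lemma lipschitzWith_of_finite_closed_cover {ι : Type*} [Finite ι] {L : NNReal} {f : Pt n → ℝ}
    {F : ι → Set (Pt n)} (hF : ∀ i, IsClosed (F i)) (hcov : ⋃ i, F i = Set.univ)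
    (hL : ∀ i, LipschitzOnWith L f (F i)) : LipschitzWith L f := by
  have hcont : Continuous f :=
    (locallyFinite_of_finite F).continuous hcov hF fun i => (hL i).continuousOn
  have key : ∀ x y, f y - f x ≤ L * ‖y - x‖ := by
    intro x y
    set p : ℝ → Pt n := fun t => x + t • (y - x) with hp
    have hpc : Continuous p := by fun_prop
    have hdist : ∀ s t, dist (p s) (p t) = |s - t| * ‖y - x‖ := by
      intro s t
      rw [dist_eq_norm, hp]
      simp only [add_sub_add_left_eq_sub, ← sub_smul, norm_smul, Real.norm_eq_abs]
    have := image_le_of_liminf_slope_right_le_deriv_boundary (f := fun t => f (p t)) (a := 0)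
      (b := 1) (B := fun t => f x + t * (L * ‖y - x‖)) (B' := fun _ => L * ‖y - x‖)
      (hcont.comp hpc).continuousOn (by simp [hp]) (by fun_prop)
      (fun t _ => by
        simpa using (((hasDerivAt_id t).mul_const (L * ‖y - x‖)).const_add (f x)).hasDerivWithinAt)
      (fun t _ r hr => by
        have h1 : ∃ i, ∃ᶠ z in 𝓝[>] t, p z ∈ F i := by
          by_contra! hc
          have h2 : ∀ᶠ z in 𝓝[>] t, ∀ i, p z ∉ F i := by
            rw [eventually_all]; intro i; simpa using hc i
          obtain ⟨z, hz⟩ := h2.exists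
          have : p z ∈ ⋃ i, F i := hcov ▸ Set.mem_univ _
          obtain ⟨i, hi⟩ := Set.mem_iUnion.1 this
          exact hz i hi
        obtain ⟨i, hi⟩ := h1
        have ht : p t ∈ F i := (hF i).mem_of_frequently_of_tendsto hi
          (hpc.continuousAt.tendsto.mono_left nhdsWithin_le_nhds)
        refine (hi.and_eventually self_mem_nhdsWithin).mono ?_
        rintro z ⟨hz, hzt⟩
        refine lt_of_le_of_lt ?_ hr
        have hzt : 0 < z - t := sub_pos.2 hzt
        rw [slope_def_field, div_le_iff₀ hzt]
        have := (hL i).dist_le_mul _ hz _ ht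
        rw [hdist, Real.dist_eq, abs_of_pos hzt] at this
        calc f (p z) - f (p t) ≤ |f (p z) - f (p t)| := le_abs_self _
          _ ≤ _ := by linarith)
      (x := 1) (by simp)
    simp only [hp, one_smul, add_sub_cancel, one_mul] at this
    linarith
  refine LipschitzWith.of_dist_le_mul fun x y => ?_
  rw [Real.dist_eq, abs_le, dist_eq_norm]
  constructor
  · have := key x y; rw [norm_sub_rev] at this; linarith
  · exact key y x

/-- Extension by zero outside the cell. -/
def zeroExt (v : Pt n → ℝ) : Pt n → ℝ := (cell n).indicator v

lemma Mesh.finite_elements (𝒯 : Mesh n) : 𝒯.elements.Finite :=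
  𝒯.finite_faces.subset fun _ h => h.1

lemma Mesh.convexHull_subset_cell (𝒯 : Mesh n) {K : Finset (Pt n)} (hK : K ∈ 𝒯.elements) :
    convexHull ℝ (K : Set (Pt n)) ⊆ cell n := by
  rw [← 𝒯.cover]
  exact Set.subset_biUnion_of_mem
    (u := fun K : Finset (Pt n) => convexHull ℝ (K : Set (Pt n))) hK

lemma Mesh.exists_mem (𝒯 : Mesh n) {y : Pt n} (hy : y ∈ cell n) :
    ∃ K ∈ 𝒯.elements, y ∈ convexHull ℝ (K : Set (Pt n)) := by
  rw [← 𝒯.cover] at hy; simpa using! hy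

lemma isCompact_convexHull_finset (K : Finset (Pt n)) : IsCompact (convexHull ℝ (K : Set (Pt n))) :=
  K.finite_toSet.isCompact_convexHull ℝ

lemma lipschitz_zeroExt {𝒯 : Mesh n} {v : Pt n → ℝ} (hv : v ∈ 𝒯.P1) :
    ∃ L, LipschitzWith L (zeroExt v) := by
  classical
  choose! f hf using hv.2.2
  have hfin : Finite 𝒯.elements := 𝒯.finite_elements
  have : Fintype 𝒯.elements := Fintype.ofFinite _
  set L : NNReal := ∑ K : 𝒯.elements, ‖(f K).linear.toContinuousLinearMap‖₊ with hLdef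
  refine ⟨L, lipschitzWith_of_finite_closed_cover
    (F := fun o : Option 𝒯.elements => o.elim (closure (cell n)ᶜ)
      fun K => convexHull ℝ (K.1 : Set (Pt n))) ?_ ?_ ?_⟩
  · rintro (_ | K)
    · exact isClosed_closure
    · exact (isCompact_convexHull_finset K.1).isClosed
  · refine Set.eq_univ_of_forall fun y => ?_
    rw [Set.mem_iUnion]
    by_cases hy : y ∈ cell n
    · obtain ⟨K, hK, h⟩ := 𝒯.exists_mem hy
      exact ⟨some ⟨K, hK⟩, h⟩
    · exact ⟨none, subset_closure hy⟩
  · rintro (_ | K)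
    · have h0 : ∀ y ∈ closure (cell n)ᶜ, zeroExt v y = 0 := by
        intro y hy
        by_cases hc : y ∈ cell n
        · rw [zeroExt, Set.indicator_of_mem hc]
          exact hv.2.1 y (by
            rw [frontier_eq_closure_inter_closure]; exact ⟨subset_closure hc, hy⟩)
        · exact Set.indicator_of_notMem hc _
      refine LipschitzOnWith.of_dist_le_mul fun x hx y hy => ?_
      rw [h0 x hx, h0 y hy, dist_self]; positivity
    · refine LipschitzOnWith.of_dist_le_mul fun x hx y hy => ?_
      have e : ∀ z ∈ convexHull ℝ (K.1 : Set (Pt n)), zeroExt v z = f K z := fun z hz => by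
        rw [zeroExt, Set.indicator_of_mem (𝒯.convexHull_subset_cell K.2 hz)]
        exact hf K.1 K.2 hz
      rw [e x hx, e y hy, dist_eq_norm, dist_eq_norm, ← vsub_eq_sub (f K x),
        ← AffineMap.linearMap_vsub, vsub_eq_sub]
      refine ((f K).linear.toContinuousLinearMap.le_opNorm _).trans ?_
      gcongr
      have : ‖(f K).linear.toContinuousLinearMap‖₊ ≤ L :=
        Finset.single_le_sum (f := fun K : 𝒯.elements => ‖(f K).linear.toContinuousLinearMap‖₊)
          (fun _ _ => zero_le) (Finset.mem_univ K)
      exact_mod_cast this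

/-- Integration by parts over `ℝⁿ` for Lipschitz functions. -/
lemma integral_lipschitz_mul_partialD {w ψ : Pt n → ℝ} {L : NNReal} (hw : LipschitzWith L w)
    (hψ : ContDiff ℝ ∞ ψ) (hc : HasCompactSupport ψ) (i : Fin n) :
    ∫ y, w y * partialD i ψ y =
      -∫ y, lineDeriv ℝ w y (EuclideanSpace.single i 1) * ψ y := by
  obtain ⟨D, hD⟩ := (hψ.of_le (m := 1)
    (by exact_mod_cast le_top)).lipschitzWith_of_hasCompactSupport hc (by norm_num)
  rw [hw.integral_lineDeriv_mul_eq hD hc, ← integral_neg]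
  refine integral_congr_ae (Eventually.of_forall fun y => ?_)
  have hd : DifferentiableAt ℝ ψ y := hψ.differentiable (by simp) y
  simp only [hd.lineDeriv_eq_fderiv, partialD, map_neg]
  ring

/-- The classical gradient, almost everywhere, of the zero extension of a function. -/
def gradExt (v : Pt n → ℝ) (i : Fin n) (y : Pt n) : ℝ :=
  lineDeriv ℝ (zeroExt v) y (EuclideanSpace.single i 1)

lemma gradExt_eq_zero {v : Pt n → ℝ} {i : Fin n} {y : Pt n} (hy : y ∉ cell n) :
    gradExt v i y = 0 := by
  have : zeroExt v =ᶠ[𝓝 y] fun _ => 0 := by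
    filter_upwards [(isClosed_cell n).isOpen_compl.mem_nhds hy] with z hz
    exact Set.indicator_of_notMem hz _
  rw [gradExt, this.lineDeriv_eq]
  simp [lineDeriv]

lemma gradExt_eq_of_eqOn {v : Pt n → ℝ} {K : Set (Pt n)} (hK : K ⊆ cell n) {f : Pt n →ᵃ[ℝ] ℝ}
    (h : Set.EqOn v f K) {i : Fin n} {y : Pt n} (hy : y ∈ interior K) :
    gradExt v i y = f.linear (EuclideanSpace.single i 1) := by
  have : zeroExt v =ᶠ[𝓝 y] f := by
    filter_upwards [isOpen_interior.mem_nhds hy] with z hz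
    rw [zeroExt, Set.indicator_of_mem (hK (interior_subset hz)), h (interior_subset hz)]
  rw [gradExt, this.lineDeriv_eq]
  refine HasLineDerivAt.lineDeriv ?_
  have e : ∀ t : ℝ, f (y + t • EuclideanSpace.single i (1 : ℝ)) =
      t * f.linear (EuclideanSpace.single i 1) + f y := by
    intro t
    rw [add_comm, ← vadd_eq_add, f.map_vadd, map_smul, vadd_eq_add, smul_eq_mul]
  rw [HasLineDerivAt]
  simp only [e]
  simpa using ((hasDerivAt_id (0 : ℝ)).mul_const
    (f.linear (EuclideanSpace.single i 1))).add_const (f y)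

lemma memLp_zeroExt {v : Pt n → ℝ} (hv : MemLp v 2 (μY n)) : MemLp (zeroExt v) 2 volume :=
  (memLp_indicator_iff_restrict (measurableSet_cell n)).2 hv

lemma memLp_gradExt {v : Pt n → ℝ} {L : NNReal} (hL : LipschitzWith L (zeroExt v)) (i : Fin n) :
    MemLp (gradExt v i) 2 volume := by
  have h1 : gradExt v i = (cell n).indicator (gradExt v i) := by
    ext y
    by_cases hy : y ∈ cell n
    · rw [Set.indicator_of_mem hy]
    · rw [Set.indicator_of_notMem hy, gradExt_eq_zero hy]
  rw [h1, memLp_indicator_iff_restrict (measurableSet_cell n)]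
  exact ((hL.memLp_lineDeriv (μ := μY n) (EuclideanSpace.single i (1 : ℝ))).mono_exponent le_top)

variable {𝒯 : Mesh n} {v : Pt n → ℝ}

lemma isWeakPartial_gradExt (hv : v ∈ 𝒯.P1) (i : Fin n) : IsWeakPartial i v (gradExt v i) := by
  obtain ⟨L, hL⟩ := lipschitz_zeroExt hv
  refine ⟨(memLp_gradExt hL i).restrict _, fun φ hφ => ?_⟩
  rw [setIntegral_cell_eq fun y hy => hφ.eq_zero hy]
  simp only [gradExt]
  rw [← integral_lipschitz_mul_partialD hL hφ.1 hφ.2.1 i, μY,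
    ← integral_indicator (measurableSet_cell n)]
  congr 1
  ext y
  by_cases hy : y ∈ cell n
  · rw [Set.indicator_of_mem hy, zeroExt, Set.indicator_of_mem hy]
  · rw [Set.indicator_of_notMem hy, zeroExt, Set.indicator_of_notMem hy, zero_mul]

lemma memLp_of_P1 (hv : v ∈ 𝒯.P1) : MemLp v 2 (μY n) := by
  obtain ⟨L, hL⟩ := lipschitz_zeroExt hv
  refine (memLp_congr_ae ?_).1 (memLp_of_continuous hL.continuous)
  rw [μY, Filter.EventuallyEq, ae_restrict_iff' (measurableSet_cell n)]
  exact Eventually.of_forall fun y hy => Set.indicator_of_mem hy _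

lemma memH1_of_P1 (hv : v ∈ 𝒯.P1) : MemH1 v :=
  ⟨memLp_of_P1 hv, fun i => ⟨_, isWeakPartial_gradExt hv i⟩⟩

end Lip

/-! ### Mollification combined with a dilation about the centre of the cell -/

section Moll

variable {n : ℕ}

/-- The dilation `x ↦ c + r (x - c)` about the centre `c = (1/2, …, 1/2)` of the cell. -/
def dil (r : ℝ) (x : Pt n) : Pt n :=
  r • x + (1 - r) • WithLp.toLp 2 (fun _ : Fin n => (1 / 2 : ℝ))

lemma dil_apply (r : ℝ) (x : Pt n) (i : Fin n) : dil r x i = 1 / 2 + r * (x i - 1 / 2) := by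
  simp [dil]; ring

/-- The mollification of `g` by the bump `φ`, read off at the dilated point. Dilating with `r < 1`
keeps the mollification of a function on the cell inside the cell, dilating with `r > 1` pushes the
support of a function on the cell into the interior. -/
def moll (φ : ContDiffBump (0 : Pt n)) (r : ℝ) (g : Pt n → ℝ) (x : Pt n) : ℝ :=
  ∫ y, g y * φ.normed volume (dil r x - y)

lemma moll_eq_convolution (φ : ContDiffBump (0 : Pt n)) (r : ℝ) (g : Pt n → ℝ) :
    moll φ r g = fun x =>
      (convolution g (φ.normed volume) (ContinuousLinearMap.mul ℝ ℝ) volume) (dil r x) := rfl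

lemma moll_eq_convolution' (φ : ContDiffBump (0 : Pt n)) (r : ℝ) (g : Pt n → ℝ) (x : Pt n) :
    moll φ r g x =
      (convolution (φ.normed volume) g (ContinuousLinearMap.lsmul ℝ ℝ) volume) (dil r x) := by
  rw [convolution_eq_swap]
  simp only [moll, ContinuousLinearMap.lsmul_apply, smul_eq_mul, mul_comm]

lemma contDiff_dil (r : ℝ) : ContDiff ℝ ∞ (dil r : Pt n → Pt n) := by
  unfold dil; fun_prop

lemma contDiff_moll {g : Pt n → ℝ} (hg : LocallyIntegrable g volume)
    (φ : ContDiffBump (0 : Pt n)) (r : ℝ) : ContDiff ℝ ∞ (moll φ r g) := by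
  rw [moll_eq_convolution]
  exact (φ.hasCompactSupport_normed.contDiff_convolution_right (n := ⊤) _ hg
    φ.contDiff_normed).comp (contDiff_dil r)

lemma hasFDerivAt_dil (r : ℝ) (x : Pt n) :
    HasFDerivAt (dil r : Pt n → Pt n) (r • ContinuousLinearMap.id ℝ (Pt n)) x := by
  unfold dil
  exact ((hasFDerivAt_id x).const_smul r).add_const _

/-- Mollification turns weak derivatives into classical ones; only the weak identity for the
translated kernel is used. -/
lemma partialD_moll {u g : Pt n → ℝ} (hu : LocallyIntegrable u volume)
    (φ : ContDiffBump (0 : Pt n)) (r : ℝ) (i : Fin n) (x : Pt n)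
    (h : ∫ y, u y * partialD i (fun y => φ.normed volume (dil r x - y)) y =
      -∫ y, g y * φ.normed volume (dil r x - y)) :
    partialD i (moll φ r u) x = r * moll φ r g x := by
  have hφ1 : ContDiff ℝ 1 (φ.normed (volume : Measure (Pt n))) := φ.contDiff_normed
  have h1 := (φ.hasCompactSupport_normed (μ := volume)).hasFDerivAt_convolution_right
    (ContinuousLinearMap.mul ℝ ℝ) hu hφ1 (dil r x)
  have h2 := h1.comp x (hasFDerivAt_dil r x)
  have h3 : HasFDerivAt (moll φ r u) _ x := h2
  rw [partialD, h3.fderiv]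
  simp only [ContinuousLinearMap.comp_apply, _root_.smul_apply,
    ContinuousLinearMap.id_apply, map_smul, smul_eq_mul]
  rw [convolution_precompR_apply _ hu (φ.hasCompactSupport_normed.fderiv ℝ)
    (hφ1.continuous_fderiv one_ne_zero)]
  congr 1
  have e : ∀ y, partialD i (fun y => φ.normed volume (dil r x - y)) y =
      -fderiv ℝ (φ.normed volume) (dil r x - y) (EuclideanSpace.single i 1) := by
    intro y
    have hd : HasFDerivAt (fun y => φ.normed volume (dil r x - y)) _ y :=
      ((hφ1.differentiable one_ne_zero (dil r x - y)).hasFDerivAt).comp y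
        ((hasFDerivAt_id y).const_sub (dil r x))
    rw [partialD, hd.fderiv]
    simp
  simp only [e, mul_neg, integral_neg, neg_inj] at h
  exact h

lemma integral_comp_dil (F : Pt n → ℝ) {r : ℝ} (hr : 0 ≤ r) :
    ∫ x, F (dil r x) = (r ^ n)⁻¹ * ∫ x, F x := by
  unfold dil
  rw [Measure.integral_comp_smul_of_nonneg volume
    (fun x => F (x + (1 - r) • WithLp.toLp 2 (fun _ : Fin n => (1 / 2 : ℝ)))) r (hR := hr),
    integral_add_right_eq_self F]
  simp

lemma integrable_comp_dil {F : Pt n → ℝ} (hF : Integrable F) {r : ℝ} (hr : r ≠ 0) :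
    Integrable fun x => F (dil r x) := by
  unfold dil
  exact (hF.comp_add_right ((1 - r) • WithLp.toLp 2 (fun _ : Fin n => (1 / 2 : ℝ)))).comp_smul hr

lemma memLp_normed (φ : ContDiffBump (0 : Pt n)) (z : Pt n) :
    MemLp (fun y => φ.normed volume (z - y)) 2 volume := by
  refine Continuous.memLp_of_hasCompactSupport ?_ ?_
  · exact (φ.contDiff_normed (n := 0)).continuous.comp (by fun_prop)
  · exact φ.hasCompactSupport_normed.comp_homeomorph (Homeomorph.subLeft z)

/-- Jensen's inequality for the averages that define the mollification. -/
lemma sq_moll_le {g : Pt n → ℝ} (hg : MemLp g 2 volume) (φ : ContDiffBump (0 : Pt n)) (r : ℝ)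
    (x : Pt n) : moll φ r g x ^ 2 ≤ moll φ r (fun y => g y ^ 2) x := by
  set k : Pt n → ℝ := fun y => φ.normed volume (dil r x - y) with hk
  set m := moll φ r g x with hm
  have hm' : m = ∫ y, g y * k y := rfl
  have hkc : Continuous k := (φ.contDiff_normed (n := 0)).continuous.comp (by fun_prop)
  have hkc' : HasCompactSupport k :=
    φ.hasCompactSupport_normed.comp_homeomorph (Homeomorph.subLeft (dil r x))
  have hk1 : ∫ y, k y = 1 := by
    rw [hk, integral_sub_left_eq_self (φ.normed volume) volume (dil r x)]
    exact φ.integral_normed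
  have hki : Integrable k := hkc.integrable_of_hasCompactSupport hkc'
  have hgk : Integrable fun y => g y * k y := hg.integrable_mul (memLp_normed φ _)
  obtain ⟨C, hC⟩ := hkc.bounded_above_of_compact_support hkc'
  have hg2k : Integrable fun y => g y ^ 2 * k y :=
    hg.integrable_sq.mul_bdd (c := C) hkc.aestronglyMeasurable (Eventually.of_forall hC)
  have h0 : 0 ≤ ∫ y, (g y - m) ^ 2 * k y :=
    integral_nonneg fun y => mul_nonneg (sq_nonneg _) (φ.nonneg_normed _)
  have e : ∀ y, (g y - m) ^ 2 * k y = (g y ^ 2 * k y - 2 * m * (g y * k y)) + m ^ 2 * k y :=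
    fun y => by ring
  simp only [e] at h0
  have e1 : Integrable fun y => g y ^ 2 * k y - 2 * m * (g y * k y) := hg2k.sub (hgk.const_mul _)
  rw [integral_add e1 (hki.const_mul _), integral_sub hg2k (hgk.const_mul _), integral_const_mul,
    integral_const_mul, hk1, ← hm'] at h0
  have : ∫ y, g y ^ 2 * k y = moll φ r (fun y => g y ^ 2) x := rfl
  linarith

lemma locallyIntegrable_of_memLp {g : Pt n → ℝ} (hg : MemLp g 2 volume) :
    LocallyIntegrable g volume := hg.locallyIntegrable (by norm_num)

lemma integrable_moll {g : Pt n → ℝ} (hg : Integrable g) (φ : ContDiffBump (0 : Pt n)) {r : ℝ}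
    (hr : r ≠ 0) : Integrable (moll φ r g) :=
  integrable_comp_dil (hg.integrable_convolution (ContinuousLinearMap.mul ℝ ℝ)
    ((φ.contDiff_normed (n := 0)).continuous.integrable_of_hasCompactSupport
      φ.hasCompactSupport_normed)) hr

lemma integral_moll {g : Pt n → ℝ} (hg : Integrable g) (φ : ContDiffBump (0 : Pt n)) {r : ℝ}
    (hr : 0 ≤ r) : ∫ x, moll φ r g x = (r ^ n)⁻¹ * ∫ x, g x := by
  rw [moll_eq_convolution, integral_comp_dil (convolution g (φ.normed volume)
    (ContinuousLinearMap.mul ℝ ℝ) volume) hr, integral_convolution _ hg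
    ((φ.contDiff_normed (n := 0)).continuous.integrable_of_hasCompactSupport
      φ.hasCompactSupport_normed)]
  simp [φ.integral_normed]

lemma memLp_moll {g : Pt n → ℝ} (hg : MemLp g 2 volume) (φ : ContDiffBump (0 : Pt n)) {r : ℝ}
    (hr : r ≠ 0) : MemLp (moll φ r g) 2 volume := by
  have hm := (contDiff_moll (locallyIntegrable_of_memLp hg) φ r).continuous.aestronglyMeasurable
    (μ := volume)
  rw [memLp_two_iff_integrable_sq hm]
  refine (integrable_moll hg.integrable_sq φ hr).mono' (hm.pow 2) (Eventually.of_forall fun x => ?_)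
  rw [Real.norm_of_nonneg (sq_nonneg _)]
  exact sq_moll_le hg φ r x

lemma integral_sq_moll_le {g : Pt n → ℝ} (hg : MemLp g 2 volume) (φ : ContDiffBump (0 : Pt n))
    {r : ℝ} (hr : 1 / 2 ≤ r) : ∫ x, moll φ r g x ^ 2 ≤ 2 ^ n * ∫ x, g x ^ 2 := by
  have hr0 : r ≠ 0 := by linarith
  calc ∫ x, moll φ r g x ^ 2 ≤ ∫ x, moll φ r (fun y => g y ^ 2) x :=
        integral_mono (memLp_moll hg φ hr0).integrable_sq (integrable_moll hg.integrable_sq φ hr0)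
          fun x => sq_moll_le hg φ r x
    _ = (r ^ n)⁻¹ * ∫ x, g x ^ 2 := integral_moll hg.integrable_sq φ (by linarith)
    _ ≤ 2 ^ n * ∫ x, g x ^ 2 := by
        refine mul_le_mul_of_nonneg_right ?_ (integral_nonneg fun _ => sq_nonneg _)
        rw [inv_le_comm₀ (by positivity) (by positivity), ← inv_pow]
        exact pow_le_pow_left₀ (by norm_num) (by linarith) n

lemma moll_sub {g h : Pt n → ℝ} (hg : MemLp g 2 volume) (hh : MemLp h 2 volume)
    (φ : ContDiffBump (0 : Pt n)) (r : ℝ) (x : Pt n) :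
    moll φ r (fun y => g y - h y) x = moll φ r g x - moll φ r h x := by
  simp only [moll, sub_mul]
  exact integral_sub (hg.integrable_mul (memLp_normed φ _)) (hh.integrable_mul (memLp_normed φ _))

lemma tendsto_dil {r : ℕ → ℝ} (hr : Tendsto r atTop (𝓝 1)) (x : Pt n) :
    Tendsto (fun m => dil (r m) x) atTop (𝓝 x) := by
  have : Continuous fun s : ℝ => dil s x := by unfold dil; fun_prop
  have h := (this.tendsto 1).comp hr
  simpa [dil, Function.comp_def] using h

/-- If the dilated ball does not meet the support of `g` then the mollification vanishes. -/
lemma moll_eq_zero {g : Pt n → ℝ} (φ : ContDiffBump (0 : Pt n)) (r : ℝ) (x : Pt n)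
    (h : ∀ y ∈ Metric.ball (dil r x) φ.rOut, g y = 0) : moll φ r g x = 0 := by
  rw [moll]
  have : ∀ y, g y * φ.normed volume (dil r x - y) = 0 := by
    intro y
    by_cases hy : y ∈ Metric.ball (dil r x) φ.rOut
    · rw [h y hy, zero_mul]
    · have : φ.normed volume (dil r x - y) = 0 := by
        by_contra hc
        have : dil r x - y ∈ Function.support (φ.normed volume) := hc
        rw [φ.support_normed_eq, mem_ball_zero_iff, ← dist_eq_norm, dist_comm] at this
        exact hy this
      rw [this, mul_zero]
  simp [this]

lemma tendsto_moll_of_continuous {h : Pt n → ℝ} (hc : Continuous h) (hs : HasCompactSupport h)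
    {φ : ℕ → ContDiffBump (0 : Pt n)} {r : ℕ → ℝ} (hφ : Tendsto (fun m => (φ m).rOut) atTop (𝓝 0))
    (hφ1 : ∀ m, (φ m).rOut ≤ 1) (hr : Tendsto r atTop (𝓝 1)) (hr1 : ∀ m, 1 / 2 ≤ r m)
    (hr2 : ∀ m, r m ≤ 2) :
    Tendsto (fun m => ∫ x, (moll (φ m) (r m) h x - h x) ^ 2) atTop (𝓝 0) := by
  obtain ⟨C, hC⟩ := hc.bounded_above_of_compact_support hs
  obtain ⟨ρ, hρ0, hρ⟩ : ∃ ρ, 0 < ρ ∧ tsupport h ⊆ Metric.closedBall 0 ρ :=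
    hs.isCompact.isBounded.subset_closedBall_lt 0 0
  have hC0 : 0 ≤ C := (norm_nonneg _).trans (hC 0)
  have hz : ∀ y, ρ < ‖y‖ → h y = 0 := fun y hy => by
    by_contra hne
    have := hρ (subset_tsupport _ hne)
    rw [mem_closedBall_zero_iff] at this
    linarith
  set c : Pt n := WithLp.toLp 2 (fun _ : Fin n => (1 / 2 : ℝ)) with hcdef
  set B : Set (Pt n) := Metric.closedBall 0 (2 * (ρ + 1 + ‖c‖)) with hB
  have hBm : MeasurableSet B := Metric.isClosed_closedBall.measurableSet
  have hB1 : IntegrableOn (fun _ => (2 * C) ^ 2) B (volume : Measure (Pt n)) :=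
    integrableOn_const (by
      have := (isCompact_closedBall (0 : Pt n) (2 * (ρ + 1 + ‖c‖))).measure_lt_top (μ := volume)
      exact this.ne)
  have hli : LocallyIntegrable h volume := hc.locallyIntegrable
  have hbound : ∀ m x, |moll (φ m) (r m) h x| ≤ C := by
    intro m x
    set k : Pt n → ℝ := fun y => (φ m).normed volume (dil (r m) x - y) with hk
    have hk1 : ∫ y, k y = 1 := by
      rw [hk, integral_sub_left_eq_self ((φ m).normed volume) volume (dil (r m) x)]
      exact (φ m).integral_normed
    have hki : Integrable k :=
      (((φ m).contDiff_normed (n := 0)).continuous.comp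
        (by fun_prop)).integrable_of_hasCompactSupport
        ((φ m).hasCompactSupport_normed.comp_homeomorph (Homeomorph.subLeft (dil (r m) x)))
    have : ‖moll (φ m) (r m) h x‖ ≤ ∫ y, C * k y := by
      refine norm_integral_le_of_norm_le (hki.const_mul C) (Eventually.of_forall fun y => ?_)
      rw [norm_mul, Real.norm_of_nonneg ((φ m).nonneg_normed _)]
      exact mul_le_mul_of_nonneg_right (hC y) ((φ m).nonneg_normed _)
    rwa [integral_const_mul, hk1, mul_one] at this
  have hout : ∀ m x, x ∉ B → moll (φ m) (r m) h x = 0 ∧ h x = 0 := by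
    intro m x hx
    rw [hB, mem_closedBall_zero_iff, not_le] at hx
    refine ⟨moll_eq_zero _ _ _ fun y hy => hz y ?_, hz x (by linarith [norm_nonneg c])⟩
    rw [Metric.mem_ball, dist_comm, dist_eq_norm] at hy
    have h1 : ‖dil (r m) x‖ ≤ ‖y‖ + 1 := by
      have := norm_sub_norm_le (dil (r m) x) y
      linarith [hφ1 m]
    have h2 : r m * ‖x‖ ≤ ‖dil (r m) x‖ + ‖c‖ := by
      have e : r m • x = dil (r m) x - (1 - r m) • c := by simp [dil, hcdef]
      have := norm_sub_le (dil (r m) x) ((1 - r m) • c)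
      rw [← e, norm_smul, norm_smul, Real.norm_of_nonneg (by linarith [hr1 m] : 0 ≤ r m),
        Real.norm_eq_abs] at this
      have h3 : |1 - r m| ≤ 1 := by rw [abs_le]; constructor <;> linarith [hr1 m, hr2 m]
      nlinarith [norm_nonneg c]
    nlinarith [hr1 m, norm_nonneg x]
  have hlim := tendsto_integral_of_dominated_convergence
    (F := fun m x => (moll (φ m) (r m) h x - h x) ^ 2) (f := fun _ : Pt n => (0 : ℝ))
    (μ := volume) (B.indicator fun _ => (2 * C) ^ 2) ?_ ?_ ?_ ?_
  · simpa using hlim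
  · intro m
    exact ((contDiff_moll hli (φ m) (r m)).continuous.sub hc).pow 2 |>.aestronglyMeasurable
  · exact (integrable_indicator_iff hBm).2 hB1
  · intro m
    refine Eventually.of_forall fun x => ?_
    by_cases hx : x ∈ B
    · rw [Set.indicator_of_mem hx, Real.norm_of_nonneg (sq_nonneg _)]
      have h1 := abs_le.1 (hbound m x)
      have h2 := abs_le.1 (show |h x| ≤ C from hC x)
      exact sq_le_sq' (by linarith [h1.1, h2.2]) (by linarith [h1.2, h2.1])
    · obtain ⟨e1, e2⟩ := hout m x hx
      simp [hx, e1, e2]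
  · refine Eventually.of_forall fun x => ?_
    have h1 : Tendsto (fun m => moll (φ m) (r m) h x) atTop (𝓝 (h x)) := by
      simp only [moll_eq_convolution']
      exact ContDiffBump.convolution_tendsto_right hφ
        (Eventually.of_forall fun _ => hc.aestronglyMeasurable)
        ((hc.tendsto x).comp tendsto_snd) (tendsto_dil hr x)
    have := (h1.sub_const (h x)).pow 2
    simpa using this

/-- `L²` convergence of the dilated mollifications. -/
lemma tendsto_moll {g : Pt n → ℝ} (hg : MemLp g 2 volume)
    {φ : ℕ → ContDiffBump (0 : Pt n)} {r : ℕ → ℝ} (hφ : Tendsto (fun m => (φ m).rOut) atTop (𝓝 0))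
    (hφ1 : ∀ m, (φ m).rOut ≤ 1) (hr : Tendsto r atTop (𝓝 1)) (hr1 : ∀ m, 1 / 2 ≤ r m)
    (hr2 : ∀ m, r m ≤ 2) :
    Tendsto (fun m => ∫ x, (moll (φ m) (r m) g x - g x) ^ 2) atTop (𝓝 0) := by
  rw [Metric.tendsto_atTop]
  intro ε hε
  set δ : ℝ := ε / (6 * (2 ^ n + 1)) with hδ
  have hδ0 : 0 < δ := by positivity
  have hg' : MemLp g (ENNReal.ofReal 2) volume := by simpa using hg
  obtain ⟨h, hs, hle, hc, hm'⟩ :=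
    hg'.exists_hasCompactSupport_integral_rpow_sub_le (by norm_num : (0 : ℝ) < 2) hδ0
  have hm : MemLp h 2 volume := by simpa using hm'
  have hle' : ∫ x, (g x - h x) ^ 2 ≤ δ := by simpa using hle
  have hd : MemLp (fun x => g x - h x) 2 volume := hg.sub hm
  have htend := tendsto_moll_of_continuous hc hs hφ hφ1 hr hr1 hr2
  rw [Metric.tendsto_atTop] at htend
  obtain ⟨N, hN⟩ := htend (ε / 6) (by positivity)
  refine ⟨N, fun m hmN => ?_⟩
  have hr0 : r m ≠ 0 := by linarith [hr1 m]
  have h1 := integral_sq_moll_le hd (φ m) (hr1 m)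
  have h2 := hN m hmN
  rw [Real.dist_eq, sub_zero, abs_of_nonneg (integral_nonneg fun _ => sq_nonneg _)] at h2 ⊢
  have i1 := (memLp_moll hd (φ m) hr0).integrable_sq
  have i2 : Integrable fun x => (moll (φ m) (r m) h x - h x) ^ 2 :=
    ((memLp_moll hm (φ m) hr0).sub hm).integrable_sq
  have i3 := hd.integrable_sq
  calc ∫ x, (moll (φ m) (r m) g x - g x) ^ 2
      ≤ ∫ x, 3 * (moll (φ m) (r m) (fun y => g y - h y) x ^ 2 +
          (moll (φ m) (r m) h x - h x) ^ 2 + (g x - h x) ^ 2) := by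
        refine integral_mono ((memLp_moll hg (φ m) hr0).sub hg).integrable_sq
          (((i1.add i2).add i3).const_mul 3) fun x => ?_
        simp only [moll_sub hg hm]
        nlinarith [sq_nonneg (moll (φ m) (r m) g x - moll (φ m) (r m) h x -
            (moll (φ m) (r m) h x - h x)),
          sq_nonneg (moll (φ m) (r m) g x - moll (φ m) (r m) h x + (g x - h x)),
          sq_nonneg (moll (φ m) (r m) h x - h x + (g x - h x))]
    _ = 3 * ((∫ x, moll (φ m) (r m) (fun y => g y - h y) x ^ 2) +
          (∫ x, (moll (φ m) (r m) h x - h x) ^ 2) + ∫ x, (g x - h x) ^ 2) := by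
        have i12 : Integrable fun x => moll (φ m) (r m) (fun y => g y - h y) x ^ 2 +
          (moll (φ m) (r m) h x - h x) ^ 2 := i1.add i2
        rw [integral_const_mul, integral_add i12 i3, integral_add i1 i2]
    _ < ε := by
        have h3 : (2 ^ n : ℝ) * ∫ x, (g x - h x) ^ 2 ≤ 2 ^ n * δ :=
          mul_le_mul_of_nonneg_left hle' (by positivity)
        have h4 : (2 ^ n + 1) * δ = ε / 6 := by rw [hδ]; field_simp
        nlinarith

end Moll

/-! ### Smooth approximation in `H²` and conformity of the finite element space -/

section Approx

variable {n : ℕ}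

/-- Radii of the mollifiers. -/
def molRad (m : ℕ) : ℝ := 1 / (8 * (m + 1))

lemma molRad_pos (m : ℕ) : 0 < molRad m := by unfold molRad; positivity

lemma molRad_le (m : ℕ) : molRad m ≤ 1 / 8 := by
  unfold molRad
  have : (0 : ℝ) ≤ m := Nat.cast_nonneg m
  exact one_div_le_one_div_of_le (by norm_num) (by linarith)

lemma tendsto_molRad : Tendsto molRad atTop (𝓝 0) := by
  have h := (tendsto_one_div_add_atTop_nhds_zero_nat (𝕜 := ℝ)).const_mul (1 / 8)
  rw [mul_zero] at h
  refine h.congr fun m => ?_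
  unfold molRad
  rw [one_div_mul_one_div]

/-- The mollifiers. -/
def bump (n m : ℕ) : ContDiffBump (0 : Pt n) where
  rIn := molRad m / 2
  rOut := molRad m
  rIn_pos := half_pos (molRad_pos m)
  rIn_lt_rOut := half_lt_self (molRad_pos m)

lemma integral_zeroExt_mul (u F : Pt n → ℝ) :
    ∫ y, zeroExt u y * F y = ∫ y, u y * F y ∂(μY n) := by
  rw [μY, ← integral_indicator (measurableSet_cell n)]
  congr 1
  ext y
  by_cases hy : y ∈ cell n
  · rw [Set.indicator_of_mem hy, zeroExt, Set.indicator_of_mem hy]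
  · rw [Set.indicator_of_notMem hy, zeroExt, Set.indicator_of_notMem hy, zero_mul]

lemma integral_sq_cell_le {f g : Pt n → ℝ} (hf : MemLp f 2 volume) (hg : ∀ y ∈ cell n, g y = f y) :
    ∫ y, g y ^ 2 ∂(μY n) ≤ ∫ y, f y ^ 2 := by
  calc ∫ y, g y ^ 2 ∂(μY n) = ∫ y in cell n, f y ^ 2 :=
        setIntegral_congr_fun (measurableSet_cell n) fun y hy => by simp only [hg y hy]
    _ ≤ ∫ y, f y ^ 2 := setIntegral_le_integral hf.integrable_sq
        (Eventually.of_forall fun y => sq_nonneg _)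

lemma tendsto_mul_moll {g : Pt n → ℝ} (hg : MemLp g 2 (μY n)) {r s : ℕ → ℝ}
    (hr : Tendsto r atTop (𝓝 1)) (hr1 : ∀ m, 1 / 2 ≤ r m) (hr2 : ∀ m, r m ≤ 2)
    (hs : Tendsto s atTop (𝓝 1)) :
    Tendsto (fun m => ∫ y, (s m * moll (bump n m) (r m) (zeroExt g) y - g y) ^ 2 ∂(μY n))
      atTop (𝓝 0) := by
  have hG := memLp_zeroExt hg
  have h1 := tendsto_moll hG (φ := bump n) tendsto_molRad
    (fun m => (molRad_le m).trans (by norm_num)) hr hr1 hr2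
  have h2 : Tendsto (fun m => 2 * s m ^ 2 *
      (∫ x, (moll (bump n m) (r m) (zeroExt g) x - zeroExt g x) ^ 2)
      + 2 * (s m - 1) ^ 2 * ∫ x, zeroExt g x ^ 2) atTop (𝓝 0) := by
    have := (((hs.pow 2).const_mul 2).mul h1).add
      ((((hs.sub_const 1).pow 2).const_mul 2).mul_const (∫ x, zeroExt g x ^ 2))
    simpa using this
  refine tendsto_of_tendsto_of_tendsto_of_le_of_le tendsto_const_nhds h2
    (fun m => integral_nonneg fun _ => sq_nonneg _) fun m => ?_
  have hM := memLp_moll hG (bump n m) (by linarith [hr1 m] : r m ≠ 0)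
  refine (integral_sq_cell_le
    (f := fun y => s m * moll (bump n m) (r m) (zeroExt g) y - zeroExt g y)
    ((hM.const_mul (s m)).sub hG) fun y hy => by rw [zeroExt, Set.indicator_of_mem hy]).trans ?_
  have i1 : Integrable fun y => (moll (bump n m) (r m) (zeroExt g) y - zeroExt g y) ^ 2 :=
    (hM.sub hG).integrable_sq
  rw [← integral_const_mul, ← integral_const_mul,
    ← integral_add (i1.const_mul _) (hG.integrable_sq.const_mul _)]
  refine integral_mono (((hM.const_mul (s m)).sub hG).integrable_sq)
    ((i1.const_mul _).add (hG.integrable_sq.const_mul _)) fun y => ?_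
  dsimp only [Pi.sub_apply]
  nlinarith [sq_nonneg (s m * (moll (bump n m) (r m) (zeroExt g) y - zeroExt g y)
    - (s m - 1) * zeroExt g y)]

lemma abs_apply_sub_le (x y : Pt n) (i : Fin n) : |x i - y i| ≤ dist x y := by
  rw [dist_eq_norm]
  exact PiLp.norm_apply_le (x - y) i

lemma abs_sub_half_le {y : Pt n} (hy : y ∈ cell n) (i : Fin n) : |y i - 1 / 2| ≤ 1 / 2 := by
  have := hy i
  rw [abs_le]; constructor <;> linarith [this.1, this.2]

/-- Mollifying after a slight contraction towards the centre maps functions on the cell to test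
functions. -/
lemma isTest_moll {v : Pt n → ℝ} (hv : MemLp v 2 (μY n)) (m : ℕ) :
    IsTest (moll (bump n m) (1 + 4 * molRad m) (zeroExt v)) := by
  set ε := molRad m with hε
  have hε0 : 0 < ε := molRad_pos m
  set K : Set (Pt n) := {y | ∀ i, (1 + 4 * ε) * |y i - 1 / 2| ≤ 1 / 2 + ε} with hK
  have hKc : IsClosed K := by
    rw [hK, Set.ofPred_forall]
    exact isClosed_iInter fun i => isClosed_le (by fun_prop) continuous_const
  have hKi : K ⊆ interior (cell n) := by
    intro y hy
    rw [interior_cell]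
    intro i
    have h1 := hy i
    have h2 : |y i - 1 / 2| < 1 / 2 := by nlinarith
    rw [abs_lt] at h2
    constructor <;> linarith [h2.1, h2.2]
  have hsub : tsupport (moll (bump n m) (1 + 4 * ε) (zeroExt v)) ⊆ K := by
    refine closure_minimal (fun x hx => ?_) hKc
    by_contra hxK
    refine hx (moll_eq_zero _ _ _ fun y hy => ?_)
    rw [zeroExt, Set.indicator_of_notMem]
    intro hyc
    refine hxK fun i => ?_
    have h1 := abs_sub_half_le hyc i
    have h2 := abs_apply_sub_le (dil (1 + 4 * ε) x) y i
    have h3 : dist (dil (1 + 4 * ε) x) y < ε := by rw [dist_comm]; exact hy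
    rw [dil_apply] at h2
    calc (1 + 4 * ε) * |x i - 1 / 2| = |(1 + 4 * ε) * (x i - 1 / 2)| := by
          rw [abs_mul, abs_of_pos (by positivity : (0 : ℝ) < 1 + 4 * ε)]
      _ = |(1 / 2 + (1 + 4 * ε) * (x i - 1 / 2) - y i) + (y i - 1 / 2)| := by ring_nf
      _ ≤ _ := by
          refine (abs_add_le _ _).trans ?_
          linarith
  exact ⟨contDiff_moll (locallyIntegrable_of_memLp (memLp_zeroExt hv)) _ _,
    (isCompact_cell n).of_isClosed_subset (isClosed_tsupport _)
      (hsub.trans (hKi.trans interior_subset)), hsub.trans hKi⟩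

/-- The linear finite element space is conforming. -/
lemma P1_subset_H10 (𝒯 : Mesh n) : 𝒯.P1 ⊆ H10 n := by
  intro v hv
  have hv2 := memLp_of_P1 hv
  obtain ⟨L, hL⟩ := lipschitz_zeroExt hv
  set r : ℕ → ℝ := fun m => 1 + 4 * molRad m with hrdef
  have hr : Tendsto r atTop (𝓝 1) := by
    simpa using (tendsto_molRad.const_mul 4).const_add 1
  have hr1 : ∀ m, 1 / 2 ≤ r m := fun m => by
    have := molRad_pos m; simp only [hrdef]; linarith
  have hr2 : ∀ m, r m ≤ 2 := fun m => by
    have := molRad_le m; simp only [hrdef]; linarith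
  refine ⟨memH1_of_P1 hv, fun m => moll (bump n m) (r m) (zeroExt v),
    fun m => isTest_moll hv2 m, ?_⟩
  have hwk := isWeakPartial_gradExt hv
  have key : ∀ m, H1sq (fun y => v y - moll (bump n m) (r m) (zeroExt v) y) =
      ∫ y, (1 * moll (bump n m) (r m) (zeroExt v) y - v y) ^ 2 ∂(μY n) + ∑ i,
        ∫ y, (r m * moll (bump n m) (r m) (zeroExt (gradExt v i)) y -
          gradExt v i y) ^ 2 ∂(μY n) := by
    intro m
    rw [H1sq_sub_eq hv2 hwk (isTest_moll hv2 m).1]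
    congr 1
    · refine integral_congr_ae (Eventually.of_forall fun y => ?_)
      dsimp only; ring
    · refine Finset.sum_congr rfl fun i _ => integral_congr_ae (Eventually.of_forall fun y => ?_)
      dsimp only
      rw [partialD_moll (g := zeroExt (gradExt v i))
        (locallyIntegrable_of_memLp (memLp_zeroExt hv2))]
      · simp only [hrdef]; ring
      · rw [integral_zeroExt_mul (gradExt v i), integral_lipschitz_mul_partialD hL]
        · congr 1
          rw [μY, setIntegral_eq_integral_of_forall_compl_eq_zero]
          · rfl
          · intro z hz; rw [gradExt_eq_zero hz, zero_mul]
        · exact (bump n m).contDiff_normed.comp (contDiff_const.sub contDiff_id)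
        · exact (bump n m).hasCompactSupport_normed.comp_homeomorph (Homeomorph.subLeft _)
  simp only [key]
  have h1 := tendsto_mul_moll hv2 hr hr1 hr2 (tendsto_const_nhds (x := (1 : ℝ)))
  have h2 := tendsto_finsetSum (Finset.univ : Finset (Fin n)) fun i _ =>
    tendsto_mul_moll (hwk i).1 hr hr1 hr2 hr
  simpa using h1.add h2

/-- Weak derivatives become classical ones in a neighbourhood of the cell: the dilation by `1 - 4 ε`
moves it into the part of the cell where the mollifier of radius `ε` only sees interior points. -/
lemma partialD_moll_of_isWeakPartial {u g : Pt n → ℝ} {i : Fin n} (hu : MemLp u 2 (μY n))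
    (h : IsWeakPartial i u g) (m : ℕ) {x : Pt n}
    (hx : ∀ i, |x i - 1 / 2| < 1 / 2 + molRad m / 2) :
    partialD i (moll (bump n m) (1 - 4 * molRad m) (zeroExt u)) x =
      (1 - 4 * molRad m) * moll (bump n m) (1 - 4 * molRad m) (zeroExt g) x := by
  set ε := molRad m with hε
  have hε0 : 0 < ε := molRad_pos m
  have hε1 : ε ≤ 1 / 8 := molRad_le m
  refine partialD_moll (locallyIntegrable_of_memLp (memLp_zeroExt hu)) _ _ _ _ ?_
  rw [integral_zeroExt_mul, integral_zeroExt_mul]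
  refine h.2 _ ⟨(bump n m).contDiff_normed.comp (contDiff_const.sub contDiff_id),
    (bump n m).hasCompactSupport_normed.comp_homeomorph (Homeomorph.subLeft _), ?_⟩
  have hsub : tsupport (fun y => (bump n m).normed volume (dil (1 - 4 * ε) x - y)) ⊆
      Metric.closedBall (dil (1 - 4 * ε) x) ε := by
    refine closure_minimal (fun y hy => ?_) Metric.isClosed_closedBall
    have : dil (1 - 4 * ε) x - y ∈ Function.support ((bump n m).normed volume) := hy
    rw [(bump n m).support_normed_eq, mem_ball_zero_iff, ← dist_eq_norm, dist_comm] at this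
    exact this.le
  refine hsub.trans fun y hy => ?_
  rw [interior_cell]
  intro j
  rw [Metric.mem_closedBall] at hy
  have h2 := (abs_apply_sub_le y (dil (1 - 4 * ε) x) j).trans hy
  have h3 := hx j
  rw [dil_apply] at h2
  rw [abs_le] at h2
  rw [abs_lt] at h3
  constructor <;> nlinarith [h2.1, h2.2, h3.1, h3.2]

/-- Functions in `H²(Y)` are limits of smooth functions on the whole space. -/
lemma exists_smooth_approx {u : Pt n → ℝ} (hu : MemH2 u) :
    ∃ w : ℕ → Pt n → ℝ, (∀ m, ContDiff ℝ ∞ (w m)) ∧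
      Tendsto (fun m => ∫ y, (w m y - u y) ^ 2 ∂(μY n)) atTop (𝓝 0) ∧
      (∀ i, Tendsto (fun m => ∫ y, (partialD i (w m) y - weakD i u y) ^ 2 ∂(μY n)) atTop (𝓝 0)) ∧
      ∀ i j, Tendsto (fun m => ∫ y, (partialD j (partialD i (w m)) y -
        weakD j (weakD i u) y) ^ 2 ∂(μY n)) atTop (𝓝 0) := by
  set r : ℕ → ℝ := fun m => 1 - 4 * molRad m with hrdef
  have hr : Tendsto r atTop (𝓝 1) := by
    simpa using (tendsto_molRad.const_mul 4).const_sub 1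
  have hr1 : ∀ m, 1 / 2 ≤ r m := fun m => by
    have := molRad_le m; simp only [hrdef]; linarith
  have hr2 : ∀ m, r m ≤ 2 := fun m => by
    have := molRad_pos m; simp only [hrdef]; linarith
  have hnear : ∀ m, ∀ x ∈ cell n, ∀ i, |x i - 1 / 2| < 1 / 2 + molRad m / 2 := fun m x hx i => by
    have := abs_sub_half_le hx i; have := molRad_pos m; linarith
  have d1 : ∀ m i x, (∀ i, |x i - 1 / 2| < 1 / 2 + molRad m / 2) →
      partialD i (moll (bump n m) (r m) (zeroExt u)) x =
        r m * moll (bump n m) (r m) (zeroExt (weakD i u)) x := fun m i x hx =>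
    partialD_moll_of_isWeakPartial hu.1.1 (hu.1.isWeakPartial i) m hx
  have d2 : ∀ m i j, ∀ x ∈ cell n,
      partialD j (partialD i (moll (bump n m) (r m) (zeroExt u))) x =
        r m * r m * moll (bump n m) (r m) (zeroExt (weakD j (weakD i u))) x := by
    intro m i j x hx
    have hopen : IsOpen {x : Pt n | ∀ i, |x i - 1 / 2| < 1 / 2 + molRad m / 2} := by
      rw [Set.ofPred_forall]
      exact isOpen_iInter_of_finite fun i => isOpen_lt (by fun_prop) continuous_const
    have hev : partialD i (moll (bump n m) (r m) (zeroExt u)) =ᶠ[𝓝 x]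
        fun x => r m * moll (bump n m) (r m) (zeroExt (weakD i u)) x := by
      filter_upwards [hopen.mem_nhds (hnear m x hx)] with z hz
      exact d1 m i z hz
    have hd : DifferentiableAt ℝ (moll (bump n m) (r m) (zeroExt (weakD i u))) x :=
      (contDiff_moll (locallyIntegrable_of_memLp (memLp_zeroExt (hu.2 i).1)) _ _).differentiable
        (by simp) x
    have e := partialD_moll_of_isWeakPartial (hu.2 i).1 ((hu.2 i).isWeakPartial j) m (hnear m x hx)
    rw [partialD] at e
    rw [partialD, hev.fderiv_eq, fderiv_const_mul hd, _root_.smul_apply, e, smul_eq_mul, mul_assoc]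
  refine ⟨fun m => moll (bump n m) (r m) (zeroExt u), fun m => contDiff_moll
    (locallyIntegrable_of_memLp (memLp_zeroExt hu.1.1)) _ _, ?_, fun i => ?_, fun i j => ?_⟩
  · simpa using tendsto_mul_moll hu.1.1 hr hr1 hr2 (tendsto_const_nhds (x := (1 : ℝ)))
  · refine (tendsto_mul_moll (hu.2 i).1 hr hr1 hr2 hr).congr fun m => ?_
    refine setIntegral_congr_fun (measurableSet_cell n) fun y hy => ?_
    simp only [d1 m i y (hnear m y hy)]
  · refine (tendsto_mul_moll ((hu.2 i).memLp_weakD j) hr hr1 hr2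
      (by simpa using hr.mul hr)).congr fun m => ?_
    refine setIntegral_congr_fun (measurableSet_cell n) fun y hy => ?_
    simp only [d2 m i j y hy]

end Approx

/-! ### Taylor's formula in mean square -/

section Taylor

variable {n : ℕ}

/-- The pointwise square of the norm of the Hessian. -/
def hessSq (w : Pt n → ℝ) (y : Pt n) : ℝ := ∑ i, ∑ j, partialD j (partialD i w) y ^ 2

lemma hessSq_nonneg (w : Pt n → ℝ) (y : Pt n) : 0 ≤ hessSq w y :=
  Finset.sum_nonneg fun _ _ => Finset.sum_nonneg fun _ _ => sq_nonneg _

lemma continuous_hessSq {w : Pt n → ℝ} (hw : ContDiff ℝ ∞ w) : Continuous (hessSq w) :=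
  continuous_finsetSum _ fun i _ => continuous_finsetSum _ fun j _ =>
    (contDiff_partialD (contDiff_partialD hw i) j).continuous.pow 2

lemma linear_apply_eq_sum (f : Pt n →ₗ[ℝ] ℝ) (z : Pt n) :
    f z = ∑ i, z i * f (EuclideanSpace.single i 1) := by
  conv_lhs => rw [← (EuclideanSpace.basisFun (Fin n) ℝ).sum_repr z]
  simp

lemma fderiv_apply_eq_sum (w : Pt n → ℝ) (y z : Pt n) :
    fderiv ℝ w y z = ∑ i, z i * partialD i w y :=
  linear_apply_eq_sum (fderiv ℝ w y : Pt n →ₗ[ℝ] ℝ) z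

/-- The remainder of the first order Taylor expansion at `x`, evaluated at `a`. -/
def taylorRem (w : Pt n → ℝ) (a x : Pt n) : ℝ := w a - w x + fderiv ℝ w x (x - a)

/-- Integral form of the remainder. The segment is parametrised quadratically, so that the
Cauchy–Schwarz inequality in `τ` can be applied with integer powers as weights. -/
lemma taylorRem_eq {w : Pt n → ℝ} (hw : ContDiff ℝ ∞ w) (a x : Pt n) :
    taylorRem w a x = ∫ τ in (0 : ℝ)..1, 2 * τ ^ 3 *
      ∑ i, ∑ j, (x - a) i * (x - a) j * partialD j (partialD i w) (a + τ ^ 2 • (x - a)) := by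
  set z := x - a with hz
  set p : ℝ → Pt n := fun τ => a + τ ^ 2 • z with hp
  have hpd : ∀ τ, HasDerivAt p ((2 * τ) • z) τ := fun τ => by
    have := ((hasDerivAt_pow 2 τ).smul_const z).const_add a
    exact this.congr_deriv (by simp)
  have hpc : Continuous p := by fun_prop
  have hcomp : ∀ (g : Pt n → ℝ), ContDiff ℝ ∞ g → ∀ τ, HasDerivAt (fun τ => g (p τ))
      (2 * τ * ∑ j, z j * partialD j g (p τ)) τ := by
    intro g hg τ
    have := ((hg.differentiable (by simp) (p τ)).hasFDerivAt).comp_hasDerivAt τ (hpd τ)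
    rw [map_smul, smul_eq_mul, fderiv_apply_eq_sum] at this
    exact this
  have hG : ∀ τ, HasDerivAt (fun τ => τ ^ 2 * (∑ i, z i * partialD i w (p τ)) - w (p τ))
      (2 * τ ^ 3 * ∑ i, ∑ j, z i * z j * partialD j (partialD i w) (p τ)) τ := by
    intro τ
    have h1 : HasDerivAt (fun τ => ∑ i, z i * partialD i w (p τ))
        (∑ i, z i * (2 * τ * ∑ j, z j * partialD j (partialD i w) (p τ))) τ :=
      HasDerivAt.fun_sum fun i _ => (hcomp _ (contDiff_partialD hw i) τ).const_mul (z i)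
    have h2 := ((hasDerivAt_pow 2 τ).mul h1).sub (hcomp w hw τ)
    refine h2.congr_deriv ?_
    simp only [Finset.mul_sum]
    push_cast
    simp only [pow_one, ← Finset.sum_add_distrib, ← Finset.sum_sub_distrib]
    refine Finset.sum_congr rfl fun i _ => ?_
    rw [add_sub_cancel_left]
    exact Finset.sum_congr rfl fun j _ => by ring
  have hcont : Continuous fun τ : ℝ =>
      2 * τ ^ 3 * ∑ i, ∑ j, z i * z j * partialD j (partialD i w) (p τ) := by
    refine Continuous.mul (by fun_prop) (continuous_finsetSum _ fun i _ =>
      continuous_finsetSum _ fun j _ => continuous_const.mul ?_)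
    exact (contDiff_partialD (contDiff_partialD hw i) j).continuous.comp hpc
  rw [intervalIntegral.integral_eq_sub_of_hasDerivAt (fun τ _ => hG τ)
    (hcont.intervalIntegrable 0 1)]
  have e1 : p 1 = x := by simp [hp, hz]
  have e0 : p 0 = a := by simp [hp]
  simp only [e1, e0]
  rw [taylorRem, fderiv_apply_eq_sum]
  ring

lemma sq_hessian_form_le (w : Pt n → ℝ) (z y : Pt n) :
    (∑ i, ∑ j, z i * z j * partialD j (partialD i w) y) ^ 2 ≤ ‖z‖ ^ 4 * hessSq w y := by
  rw [← Fintype.sum_prod_type' (f := fun i j => z i * z j * partialD j (partialD i w) y)]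
  refine (Finset.sum_mul_sq_le_sq_mul_sq Finset.univ (fun q : Fin n × Fin n => z q.1 * z q.2)
    fun q => partialD q.2 (partialD q.1 w) y).trans (le_of_eq ?_)
  rw [hessSq,
    Fintype.sum_prod_type (f := fun q : Fin n × Fin n => partialD q.2 (partialD q.1 w) y ^ 2)]
  congr 1
  rw [Fintype.sum_prod_type (f := fun q : Fin n × Fin n => (z q.1 * z q.2) ^ 2),
    show ‖z‖ ^ 4 = (‖z‖ ^ 2) * (‖z‖ ^ 2) by ring, EuclideanSpace.norm_sq_eq, Finset.sum_mul_sum]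
  simp only [Real.norm_eq_abs, sq_abs, mul_pow]

lemma sq_integral_le_integral_sq {α : Type*} [MeasurableSpace α] {μ : Measure α}
    [IsProbabilityMeasure μ] {f : α → ℝ} (hf : MemLp f 2 μ) :
    (∫ x, f x ∂μ) ^ 2 ≤ ∫ x, f x ^ 2 ∂μ := by
  set m := ∫ x, f x ∂μ with hm
  have i1 : Integrable f μ := hf.integrable (by norm_num)
  have i2 : Integrable (fun x => f x ^ 2) μ := hf.integrable_sq
  have h0 : 0 ≤ ∫ x, (f x ^ 2 - 2 * m * f x) + m ^ 2 ∂μ := by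
    refine integral_nonneg fun x => ?_
    have : f x ^ 2 - 2 * m * f x + m ^ 2 = (f x - m) ^ 2 := by ring
    simp only [this]; exact sq_nonneg _
  have i3 : Integrable (fun x => f x ^ 2 - 2 * m * f x) μ := i2.sub (i1.const_mul _)
  rw [integral_add i3 (integrable_const _), integral_sub i2 (i1.const_mul _),
    integral_const_mul, ← hm] at h0
  simp at h0
  linarith

instance : IsProbabilityMeasure (volume.restrict (Set.Icc (0 : ℝ) 1)) := ⟨by simp⟩

lemma sq_taylorRem_le {w : Pt n → ℝ} (hw : ContDiff ℝ ∞ w) (a x : Pt n) :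
    taylorRem w a x ^ 2 ≤
      ∫ τ in Set.Icc (0 : ℝ) 1, 4 * τ ^ 6 * (‖x - a‖ ^ 4 * hessSq w (a + τ ^ 2 • (x - a))) := by
  have hpc : Continuous fun τ : ℝ => a + τ ^ 2 • (x - a) := by fun_prop
  have hcont : Continuous fun τ : ℝ => 2 * τ ^ 3 *
      ∑ i, ∑ j, (x - a) i * (x - a) j * partialD j (partialD i w) (a + τ ^ 2 • (x - a)) := by
    refine Continuous.mul (by fun_prop) (continuous_finsetSum _ fun i _ =>
      continuous_finsetSum _ fun j _ => continuous_const.mul ?_)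
    exact (contDiff_partialD (contDiff_partialD hw i) j).continuous.comp hpc
  have hcont2 : Continuous fun τ : ℝ =>
      4 * τ ^ 6 * (‖x - a‖ ^ 4 * hessSq w (a + τ ^ 2 • (x - a))) :=
    Continuous.mul (by fun_prop) (continuous_const.mul ((continuous_hessSq hw).comp hpc))
  rw [taylorRem_eq hw, intervalIntegral.integral_of_le zero_le_one, ← integral_Icc_eq_integral_Ioc]
  refine (sq_integral_le_integral_sq ?_).trans ?_
  · rw [memLp_two_iff_integrable_sq hcont.aestronglyMeasurable]
    exact ((hcont.pow 2).continuousOn).integrableOn_compact isCompact_Icc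
  · refine integral_mono (((hcont.pow 2).continuousOn).integrableOn_compact isCompact_Icc)
      (hcont2.continuousOn.integrableOn_compact isCompact_Icc) fun τ => ?_
    dsimp only
    rw [mul_pow]
    have : (2 * τ ^ 3) ^ 2 = 4 * τ ^ 6 := by ring
    rw [this]
    exact mul_le_mul_of_nonneg_left (sq_hessian_form_le w _ _) (by positivity)

lemma integral_comp_homothety (F : Pt n → ℝ) (a : Pt n) {s : ℝ} (hs : 0 ≤ s) :
    ∫ x, F (a + s • (x - a)) = (s ^ n)⁻¹ * ∫ x, F x := by
  rw [integral_sub_right_eq_self (fun x => F (a + s • x)) a,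
    Measure.integral_comp_smul_of_nonneg volume (fun x => F (a + x)) s (hR := hs),
    integral_add_left_eq_self F]
  simp

/-- Mean square bound for the Taylor remainder. The contraction towards `a` by `τ²` costs a factor
`τ^(-2n)`, which the weight `τ⁶` absorbs for `n ≤ 3`. -/
lemma integral_sq_taylorRem_le (hn : n ≤ 3) {w : Pt n → ℝ} (hw : ContDiff ℝ ∞ w)
    {K : Set (Pt n)} (hK : IsCompact K) (hconv : Convex ℝ K) {a : Pt n} (ha : a ∈ K) {d : ℝ}
    (hd : ∀ x ∈ K, ‖x - a‖ ≤ d) :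
    ∫ x in K, taylorRem w a x ^ 2 ≤ 4 * d ^ 4 * ∫ x in K, hessSq w x := by
  have hd0 : 0 ≤ d := (norm_nonneg _).trans (hd a ha)
  have hKm : MeasurableSet K := hK.measurableSet
  have hH := continuous_hessSq hw
  set Φ : Pt n → ℝ → ℝ := fun x τ => 4 * τ ^ 6 * (d ^ 4 * hessSq w (a + τ ^ 2 • (x - a))) with hΦ
  have hΦc : Continuous (Function.uncurry Φ) := by
    refine Continuous.mul (by fun_prop) (continuous_const.mul (hH.comp (by fun_prop)))
  have hint : Integrable (Function.uncurry Φ)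
      ((volume.restrict K).prod (volume.restrict (Set.Icc (0 : ℝ) 1))) := by
    rw [Measure.prod_restrict]
    exact hΦc.continuousOn.integrableOn_compact (hK.prod isCompact_Icc)
  have hrc : Continuous fun x => taylorRem w a x := by
    unfold taylorRem
    refine (continuous_const.sub hw.continuous).add ?_
    exact (hw.continuous_fderiv (by simp)).clm_apply (by fun_prop)
  have hHi : IntegrableOn (hessSq w) K := hH.continuousOn.integrableOn_compact hK
  calc ∫ x in K, taylorRem w a x ^ 2 ≤ ∫ x in K, ∫ τ in Set.Icc (0 : ℝ) 1, Φ x τ := by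
        refine setIntegral_mono_on ((hrc.pow 2).continuousOn.integrableOn_compact hK)
          hint.integral_prod_left hKm fun x hx => ?_
        refine (sq_taylorRem_le hw a x).trans ?_
        have hpc : Continuous fun τ : ℝ => a + τ ^ 2 • (x - a) := by fun_prop
        refine integral_mono
          (ContinuousOn.integrableOn_compact isCompact_Icc (Continuous.continuousOn ?_))
          (ContinuousOn.integrableOn_compact isCompact_Icc (Continuous.continuousOn ?_)) fun τ => ?_
        · exact Continuous.mul (by fun_prop) (continuous_const.mul (hH.comp hpc))
        · exact Continuous.mul (by fun_prop) (continuous_const.mul (hH.comp hpc))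
        · have h1 : ‖x - a‖ ^ 4 ≤ d ^ 4 := pow_le_pow_left₀ (norm_nonneg _) (hd x hx) 4
          have h2 := hessSq_nonneg w (a + τ ^ 2 • (x - a))
          have h3 : 0 ≤ τ ^ 6 := by positivity
          simp only [hΦ]
          gcongr
    _ = ∫ τ in Set.Icc (0 : ℝ) 1, ∫ x in K, Φ x τ := integral_integral_swap hint
    _ ≤ ∫ τ in Set.Icc (0 : ℝ) 1, 4 * d ^ 4 * ∫ x in K, hessSq w x := by
        refine setIntegral_mono_on hint.integral_prod_right
          (integrable_const _) measurableSet_Icc fun τ hτ => ?_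
        have e : ∫ x in K, Φ x τ =
            4 * d ^ 4 * (τ ^ 6 * ∫ x in K, hessSq w (a + τ ^ 2 • (x - a))) := by
          rw [← integral_const_mul, ← integral_const_mul]
          refine integral_congr_ae (Eventually.of_forall fun x => ?_)
          simp only [hΦ]; ring
        rw [e]
        refine mul_le_mul_of_nonneg_left ?_ (by positivity)
        rcases eq_or_lt_of_le hτ.1 with h0 | h0
        · rw [← h0]
          simpa using setIntegral_nonneg hKm fun x _ => hessSq_nonneg w x
        · have hind : Integrable (K.indicator (hessSq w)) := (integrable_indicator_iff hKm).2 hHi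
          have hs0 : (τ ^ 2) ≠ 0 := by positivity
          have hcomp : Integrable fun x => K.indicator (hessSq w) (a + τ ^ 2 • (x - a)) :=
            ((hind.comp_add_left a).comp_smul hs0).comp_sub_right a
          have h1 : ∫ x in K, hessSq w (a + τ ^ 2 • (x - a)) ≤
              ((τ ^ 2) ^ n)⁻¹ * ∫ x in K, hessSq w x := by
            rw [← integral_indicator hKm, ← integral_indicator hKm,
              ← integral_comp_homothety (K.indicator (hessSq w)) a (sq_nonneg τ)]
            refine integral_mono ?_ hcomp fun x => ?_
            · refine (integrable_indicator_iff hKm).2 (ContinuousOn.integrableOn_compact hK ?_)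
              exact (hH.comp (by fun_prop)).continuousOn
            · dsimp only
              by_cases hx : x ∈ K
              · have hin : a + τ ^ 2 • (x - a) ∈ K :=
                  hconv.add_smul_sub_mem ha hx ⟨sq_nonneg τ, by nlinarith [hτ.1, hτ.2]⟩
                rw [Set.indicator_of_mem hx, Set.indicator_of_mem hin]
              · rw [Set.indicator_of_notMem hx]
                exact Set.indicator_nonneg (fun y _ => hessSq_nonneg w y) _
          have h2 : τ ^ 6 ≤ (τ ^ 2) ^ n := by
            rw [← pow_mul]
            exact pow_le_pow_of_le_one hτ.1 hτ.2 (by omega)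
          have h3 : 0 ≤ ∫ x in K, hessSq w x := setIntegral_nonneg hKm fun x _ => hessSq_nonneg w x
          calc τ ^ 6 * ∫ x in K, hessSq w (a + τ ^ 2 • (x - a))
              ≤ (τ ^ 2) ^ n * (((τ ^ 2) ^ n)⁻¹ * ∫ x in K, hessSq w x) := by
                refine mul_le_mul h2 h1 (setIntegral_nonneg hKm fun x _ => hessSq_nonneg w _)
                  (by positivity)
            _ = ∫ x in K, hessSq w x := by
                rw [← mul_assoc, mul_inv_cancel₀ (by positivity), one_mul]
    _ = 4 * d ^ 4 * ∫ x in K, hessSq w x := by simp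

/-- Sobolev embedding for smooth functions, by averaging Taylor's formula over the cell. -/
lemma sq_apply_le (hn : n ≤ 3) {w : Pt n → ℝ} (hw : ContDiff ℝ ∞ w) {a : Pt n} (ha : a ∈ cell n) :
    w a ^ 2 ≤ 3 * (∫ x, w x ^ 2 ∂(μY n)) + 3 * n ^ 2 * (∑ i, ∫ x, partialD i w x ^ 2 ∂(μY n))
      + 12 * n ^ 4 * ∫ x, hessSq w x ∂(μY n) := by
  have hR := integral_sq_taylorRem_le hn hw (isCompact_cell n) (convex_cell n) ha
    (d := n) fun x hx => norm_sub_le_of_mem_cell hx ha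
  have ii : ∀ {f : Pt n → ℝ}, Continuous f → Integrable f (μY n) := fun hf =>
    hf.continuousOn.integrableOn_compact (isCompact_cell n)
  have hrc : Continuous fun x => taylorRem w a x := by
    unfold taylorRem
    refine (continuous_const.sub hw.continuous).add ?_
    exact (hw.continuous_fderiv (by simp)).clm_apply (by fun_prop)
  have hgc : ∀ i, Continuous fun x => partialD i w x ^ 2 := fun i =>
    (contDiff_partialD hw i).continuous.pow 2
  have hgs : Continuous fun x => ∑ i, partialD i w x ^ 2 := continuous_finsetSum _ fun i _ => hgc i
  have hwc : Continuous fun x => w x ^ 2 := hw.continuous.pow 2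
  have h1 : ∫ _x, w a ^ 2 ∂(μY n) ≤ ∫ x, (3 * w x ^ 2 + 3 * n ^ 2 * ∑ i, partialD i w x ^ 2) +
      3 * taylorRem w a x ^ 2 ∂(μY n) := by
    refine setIntegral_mono_on (integrable_const (μ := μY n) _) (ii (by fun_prop))
      (measurableSet_cell n) fun x hx => ?_
    have e : w a = w x - fderiv ℝ w x (x - a) + taylorRem w a x := by rw [taylorRem]; ring
    have h2 : (fderiv ℝ w x (x - a)) ^ 2 ≤ n ^ 2 * ∑ i, partialD i w x ^ 2 := by
      rw [fderiv_apply_eq_sum]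
      refine (Finset.sum_mul_sq_le_sq_mul_sq _ _ _).trans ?_
      refine mul_le_mul_of_nonneg_right ?_ (Finset.sum_nonneg fun _ _ => sq_nonneg _)
      have := EuclideanSpace.norm_sq_eq (x - a)
      simp only [Real.norm_eq_abs, sq_abs] at this
      rw [← this]
      exact pow_le_pow_left₀ (norm_nonneg _) (norm_sub_le_of_mem_cell hx ha) 2
    rw [e]
    set q := fderiv ℝ w x (x - a)
    nlinarith [sq_nonneg (w x + q), sq_nonneg (w x - taylorRem w a x),
      sq_nonneg (q + taylorRem w a x)]
  have e2 : ∫ _x, w a ^ 2 ∂(μY n) = w a ^ 2 := by simp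
  rw [e2, integral_add (ii (by fun_prop)) (ii (by fun_prop)), integral_add (ii (by fun_prop))
    (ii (by fun_prop)), integral_const_mul, integral_const_mul, integral_const_mul,
    integral_finsetSum _ fun i _ => ii (hgc i)] at h1
  have hR' : ∫ x, taylorRem w a x ^ 2 ∂(μY n) ≤ 4 * n ^ 4 * ∫ x, hessSq w x ∂(μY n) := hR
  linarith

end Taylor

/-! ### Nodal values of functions in `H² ∩ H¹₀` -/

section Nodal

variable {n : ℕ}

lemma partialD_sub {f g : Pt n → ℝ} (hf : ContDiff ℝ ∞ f) (hg : ContDiff ℝ ∞ g) (i : Fin n) :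
    partialD i (fun y => f y - g y) = fun y => partialD i f y - partialD i g y := by
  ext y
  have h1 := hf.differentiable (by simp) y
  have h2 := hg.differentiable (by simp) y
  rw [partialD, fderiv_fun_sub h1 h2]
  rfl

lemma integral_sq_sub_le {α : Type*} [MeasurableSpace α] {μ : Measure α} {f g u : α → ℝ}
    (hf : MemLp f 2 μ) (hg : MemLp g 2 μ) (hu : MemLp u 2 μ) :
    ∫ y, (f y - g y) ^ 2 ∂μ ≤ 2 * (∫ y, (f y - u y) ^ 2 ∂μ) + 2 * ∫ y, (g y - u y) ^ 2 ∂μ := by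
  have i1 : Integrable (fun y => (f y - u y) ^ 2) μ := (hf.sub hu).integrable_sq
  have i2 : Integrable (fun y => (g y - u y) ^ 2) μ := (hg.sub hu).integrable_sq
  have i3 : Integrable (fun y => (f y - g y) ^ 2) μ := (hf.sub hg).integrable_sq
  rw [← integral_const_mul, ← integral_const_mul, ← integral_add (i1.const_mul 2) (i2.const_mul 2)]
  refine integral_mono i3 ((i1.const_mul 2).add (i2.const_mul 2)) fun y => ?_
  dsimp only [Pi.add_apply]
  nlinarith [sq_nonneg ((f y - u y) + (g y - u y))]

lemma integral_hessSq {w : Pt n → ℝ} (hw : ContDiff ℝ ∞ w) :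
    ∫ y, hessSq w y ∂(μY n) = ∑ i, ∑ j, ∫ y, partialD j (partialD i w) y ^ 2 ∂(μY n) := by
  have hi : ∀ i j, Integrable (fun y => partialD j (partialD i w) y ^ 2) (μY n) := fun i j =>
    (memLp_of_continuous (contDiff_partialD (contDiff_partialD hw i) j).continuous).integrable_sq
  simp only [hessSq]
  rw [integral_finsetSum _ fun i _ => integrable_finsetSum _ fun j _ => hi i j]
  exact Finset.sum_congr rfl fun i _ => integral_finsetSum _ fun j _ => hi i j

/-- Smooth functions that converge in `H²(Y)` are uniformly Cauchy on the cell. -/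
lemma exists_sup_cauchy (hn : n ≤ 3) {u : Pt n → ℝ} (hu : MemH2 u) {w : ℕ → Pt n → ℝ}
    (hw : ∀ m, ContDiff ℝ ∞ (w m))
    (h0 : Tendsto (fun m => ∫ y, (w m y - u y) ^ 2 ∂(μY n)) atTop (𝓝 0))
    (h1 : ∀ i, Tendsto (fun m => ∫ y, (partialD i (w m) y - weakD i u y) ^ 2 ∂(μY n)) atTop (𝓝 0))
    (h2 : ∀ i j, Tendsto (fun m => ∫ y, (partialD j (partialD i (w m)) y -
        weakD j (weakD i u) y) ^ 2 ∂(μY n)) atTop (𝓝 0)) :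
    ∃ e : ℕ → ℝ, Tendsto e atTop (𝓝 0) ∧
      ∀ m l, ∀ y ∈ cell n, (w m y - w l y) ^ 2 ≤ e m + e l := by
  have hmem : ∀ m, MemLp (w m) 2 (μY n) := fun m => memLp_of_continuous (hw m).continuous
  have hmem1 : ∀ m i, MemLp (partialD i (w m)) 2 (μY n) := fun m i =>
    memLp_of_continuous (contDiff_partialD (hw m) i).continuous
  have hmem2 : ∀ m i j, MemLp (partialD j (partialD i (w m))) 2 (μY n) := fun m i j =>
    memLp_of_continuous (contDiff_partialD (contDiff_partialD (hw m) i) j).continuous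
  refine ⟨fun m => 6 * (∫ y, (w m y - u y) ^ 2 ∂(μY n)) +
    6 * n ^ 2 * (∑ i, ∫ y, (partialD i (w m) y - weakD i u y) ^ 2 ∂(μY n)) +
    24 * n ^ 4 * ∑ i, ∑ j, ∫ y, (partialD j (partialD i (w m)) y -
        weakD j (weakD i u) y) ^ 2 ∂(μY n), ?_, fun m l y hy => ?_⟩
  · have t1 := tendsto_finsetSum (Finset.univ : Finset (Fin n)) fun i _ => h1 i
    have t2 := tendsto_finsetSum (Finset.univ : Finset (Fin n)) fun i _ =>
      tendsto_finsetSum (Finset.univ : Finset (Fin n)) fun j _ => h2 i j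
    have := ((h0.const_mul 6).add (t1.const_mul (6 * (n : ℝ) ^ 2))).add
      (t2.const_mul (24 * (n : ℝ) ^ 4))
    simpa using this
  · have hd : ContDiff ℝ ∞ (fun y => w m y - w l y) := (hw m).sub (hw l)
    have key := sq_apply_le hn hd hy
    have e2 : ∀ i j, partialD j (fun y => partialD i (w m) y - partialD i (w l) y) =
        fun y => partialD j (partialD i (w m)) y - partialD j (partialD i (w l)) y := fun i j =>
      partialD_sub (contDiff_partialD (hw m) i) (contDiff_partialD (hw l) i) j
    rw [integral_hessSq hd] at key
    simp only [partialD_sub (hw m) (hw l), e2] at key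
    have b0 := integral_sq_sub_le (hmem m) (hmem l) hu.1.1
    have b1 := Finset.sum_le_sum fun i (_ : i ∈ Finset.univ) =>
      integral_sq_sub_le (hmem1 m i) (hmem1 l i) (hu.2 i).1
    have b2 := Finset.sum_le_sum fun i (_ : i ∈ Finset.univ) =>
      Finset.sum_le_sum fun j (_ : j ∈ Finset.univ) =>
      integral_sq_sub_le (hmem2 m i j) (hmem2 l i j) ((hu.2 i).memLp_weakD j)
    simp only [Finset.sum_add_distrib, ← Finset.mul_sum] at b1 b2
    have c1 := mul_le_mul_of_nonneg_left b1 (by positivity : (0 : ℝ) ≤ 3 * n ^ 2)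
    have c2 := mul_le_mul_of_nonneg_left b2 (by positivity : (0 : ℝ) ≤ 12 * n ^ 4)
    linarith

/-- Poincaré inequality on the strip of points that leave the open cell under translation by
`t eᵢ`. -/
lemma integral_strip_le_of_isTest {φ : Pt n → ℝ} (hφ : IsTest φ) (i : Fin n) (t : ℝ) :
    ∫ y in {y ∈ cell n | y + t • EuclideanSpace.single i 1 ∉ interior (cell n)}, φ y ^ 2 ≤
      t ^ 2 * ∫ y, partialD i φ y ^ 2 ∂(μY n) := by
  set z : Pt n := EuclideanSpace.single i 1 with hz
  set E : Set (Pt n) := {y ∈ cell n | y + t • z ∉ interior (cell n)} with hE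
  have hEm : MeasurableSet E := (measurableSet_cell n).inter
    ((isOpen_interior.preimage
      (by fun_prop : Continuous fun y : Pt n => y + t • z)).measurableSet.compl)
  have hdc : Continuous (partialD i φ) := (contDiff_partialD hφ.1 i).continuous
  have hd2 : Integrable fun y => partialD i φ y ^ 2 :=
    (hdc.pow 2).integrable_of_hasCompactSupport (by
      have := (hφ.partialD i).2.1
      simpa [pow_two] using! this.mul_left (f := partialD i φ))
  set Φ : Pt n → ℝ → ℝ := fun y τ => t ^ 2 * partialD i φ (y + (τ * t) • z) ^ 2 with hΦ
  have hΦc : Continuous (Function.uncurry Φ) :=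
    continuous_const.mul ((hdc.comp (by fun_prop)).pow 2)
  have hint : Integrable (Function.uncurry Φ)
      ((μY n).prod (volume.restrict (Set.Icc (0 : ℝ) 1))) := by
    rw [μY, Measure.prod_restrict]
    exact hΦc.continuousOn.integrableOn_compact ((isCompact_cell n).prod isCompact_Icc)
  have hsq : Continuous fun y => φ y ^ 2 := hφ.1.continuous.pow 2
  have hEi : IntegrableOn (fun y => φ y ^ 2) E :=
    (hsq.continuousOn.integrableOn_compact (isCompact_cell n)).mono_set (fun y hy => hy.1)
  have hpt : ∀ y ∈ E, φ y ^ 2 ≤ ∫ τ in Set.Icc (0 : ℝ) 1, Φ y τ := by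
    intro y hy
    have hder : ∀ τ : ℝ, HasDerivAt (fun τ : ℝ => φ (y + (τ * t) • z))
        (t * partialD i φ (y + (τ * t) • z)) τ := by
      intro τ
      have h1 : HasDerivAt (fun τ : ℝ => y + (τ * t) • z) (t • z) τ := by
        have := ((((hasDerivAt_id τ).mul_const t)).smul_const z).const_add y
        exact this.congr_deriv (by simp)
      have := ((hφ.1.differentiable (by simp) (y + (τ * t) • z)).hasFDerivAt).comp_hasDerivAt τ h1
      rw [map_smul, smul_eq_mul] at this
      exact this
    have hc : Continuous fun τ : ℝ => t * partialD i φ (y + (τ * t) • z) :=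
      continuous_const.mul (hdc.comp (by fun_prop))
    have hftc := intervalIntegral.integral_eq_sub_of_hasDerivAt (fun τ _ => hder τ)
      (hc.intervalIntegrable 0 1)
    have hend : φ (y + (1 * t) • z) = 0 := by rw [one_mul]; exact hφ.eq_zero hy.2
    rw [hend, zero_mul, zero_smul, add_zero, intervalIntegral.integral_of_le zero_le_one,
      ← integral_Icc_eq_integral_Ioc] at hftc
    have : φ y ^ 2 = (∫ τ in Set.Icc (0 : ℝ) 1, t * partialD i φ (y + (τ * t) • z)) ^ 2 := by
      rw [hftc]; ring
    rw [this]
    refine (sq_integral_le_integral_sq ?_).trans (le_of_eq ?_)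
    · rw [memLp_two_iff_integrable_sq hc.aestronglyMeasurable]
      exact ((hc.pow 2).continuousOn).integrableOn_compact isCompact_Icc
    · refine integral_congr_ae (Eventually.of_forall fun τ => ?_)
      simp only [hΦ]; ring
  have hil : IntegrableOn (fun y => ∫ τ in Set.Icc (0 : ℝ) 1, Φ y τ) (cell n) volume :=
    hint.integral_prod_left
  have hEc : E ⊆ cell n := fun y hy => hy.1
  calc ∫ y in E, φ y ^ 2 ≤ ∫ y in E, ∫ τ in Set.Icc (0 : ℝ) 1, Φ y τ :=
        setIntegral_mono_on hEi (hil.mono_set hEc) hEm hpt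
    _ ≤ ∫ y, (∫ τ in Set.Icc (0 : ℝ) 1, Φ y τ) ∂(μY n) := by
        refine setIntegral_mono_set hil
          (Eventually.of_forall fun y => integral_nonneg fun τ => ?_) (Eventually.of_forall hEc)
        simp only [hΦ, Pi.zero_apply]; positivity
    _ = ∫ τ in Set.Icc (0 : ℝ) 1, (∫ y, Φ y τ ∂(μY n)) := integral_integral_swap hint
    _ ≤ ∫ τ in Set.Icc (0 : ℝ) 1, t ^ 2 * ∫ y, partialD i φ y ^ 2 := by
        refine integral_mono hint.integral_prod_right (integrable_const _) fun τ => ?_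
        simp only [hΦ]
        rw [integral_const_mul]
        refine mul_le_mul_of_nonneg_left ?_ (sq_nonneg t)
        rw [← integral_add_right_eq_self (fun y => partialD i φ y ^ 2) ((τ * t) • z)]
        exact setIntegral_le_integral (hd2.comp_add_right _)
          (Eventually.of_forall fun y => sq_nonneg _)
    _ = t ^ 2 * ∫ y, partialD i φ y ^ 2 ∂(μY n) := by
        have : ∫ y, partialD i φ y ^ 2 ∂(μY n) = ∫ y, partialD i φ y ^ 2 :=
          setIntegral_eq_integral_of_forall_compl_eq_zero fun y hy => by
            rw [(hφ.partialD i).eq_zero fun h => hy (interior_subset h)]; simp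
        rw [this]; simp

/-- The Poincaré inequality on boundary strips passes to `H¹₀(Y)`. -/
lemma integral_strip_le {u : Pt n → ℝ} (hu : u ∈ H10 n) (i : Fin n) (t : ℝ) :
    ∫ y in {y ∈ cell n | y + t • EuclideanSpace.single i 1 ∉ interior (cell n)}, u y ^ 2 ≤
      4 * t ^ 2 * ∫ y, weakD i u y ^ 2 ∂(μY n) := by
  obtain ⟨hu1, φ, hφ, hlim⟩ := hu
  set E : Set (Pt n) := {y ∈ cell n | y + t • EuclideanSpace.single i 1 ∉ interior (cell n)} with hE
  have hEm : E ⊆ cell n := fun y hy => hy.1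
  have hle : ∀ m, ∫ y in E, u y ^ 2 ≤ (2 + 4 * t ^ 2) * H1sq (fun y => u y - φ m y) +
      4 * t ^ 2 * ∫ y, weakD i u y ^ 2 ∂(μY n) := by
    intro m
    have hφm := (hφ m).memLp
    have hD := hu1.memLp_weakD i
    have hdφ := ((hφ m).partialD i).memLp
    have s1 := integral_sq_sub_le (μ := volume.restrict E) (f := u) (g := fun _ => 0) (u := φ m)
      (hu1.1.mono_measure (Measure.restrict_mono_set _ hEm)) (by simp)
      (hφm.mono_measure (Measure.restrict_mono_set _ hEm))
    have s2 := integral_sq_sub_le (μ := μY n) (f := partialD i (φ m)) (g := fun _ => 0)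
      (u := weakD i u) hdφ (by simp) hD
    have s3 := integral_strip_le_of_isTest (hφ m) i t
    have e := H1sq_sub_eq hu1.1 hu1.isWeakPartial (hφ m).1
    have s4 : ∫ y in E, (u y - φ m y) ^ 2 ≤ ∫ y, (u y - φ m y) ^ 2 ∂(μY n) :=
      setIntegral_mono_set (hu1.1.sub hφm).integrable_sq
        (Eventually.of_forall fun _ => sq_nonneg _) (Eventually.of_forall hEm)
    have s5 : ∫ y, (partialD i (φ m) y - weakD i u y) ^ 2 ∂(μY n) ≤
        ∑ i, ∫ y, (weakD i u y - partialD i (φ m) y) ^ 2 ∂(μY n) := by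
      have : ∫ y, (partialD i (φ m) y - weakD i u y) ^ 2 ∂(μY n) =
        ∫ y, (weakD i u y - partialD i (φ m) y) ^ 2 ∂(μY n) := by congr 1; ext y; ring
      rw [this]
      exact Finset.single_le_sum (f := fun i => ∫ y, (weakD i u y - partialD i (φ m) y) ^ 2 ∂(μY n))
        (fun _ _ => integral_nonneg fun _ => sq_nonneg _) (Finset.mem_univ i)
    have s6 : 0 ≤ ∑ i, ∫ y, (weakD i u y - partialD i (φ m) y) ^ 2 ∂(μY n) :=
      Finset.sum_nonneg fun _ _ => integral_nonneg fun _ => sq_nonneg _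
    have s7 : 0 ≤ ∫ y, (u y - φ m y) ^ 2 ∂(μY n) := integral_nonneg fun _ => sq_nonneg _
    simp only [sub_zero, zero_sub, neg_sq] at s1 s2
    rw [e]
    nlinarith [sq_nonneg t, mul_le_mul_of_nonneg_left s2 (sq_nonneg t),
      mul_le_mul_of_nonneg_left s5 (sq_nonneg t), mul_nonneg (sq_nonneg t) s7]
  have := (hlim.const_mul (2 + 4 * t ^ 2)).add_const (4 * t ^ 2 * ∫ y, weakD i u y ^ 2 ∂(μY n))
  rw [mul_zero, zero_add] at this
  exact ge_of_tendsto' this hle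

/-- Near each boundary point the cell contains boxes that are thin in one coordinate direction and
lie in the corresponding boundary strip. -/
lemma exists_thin_box {a : Pt n} (ha : a ∈ cell n) {i : Fin n} (hi : a i = 0 ∨ a i = 1) {ρ : ℝ}
    (hρ : 0 < ρ) : ∃ c η₀ : ℝ, 0 < c ∧ 0 < η₀ ∧ ∃ s : ℝ, s ^ 2 = 1 ∧ ∀ η, 0 < η → η ≤ η₀ →
      ∃ B : Set (Pt n), MeasurableSet B ∧ volume B = ENNReal.ofReal (c * η) ∧
        B ⊆ {y ∈ cell n | y + (s * η) • EuclideanSpace.single i 1 ∉ interior (cell n)} ∧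
        B ⊆ Metric.ball a ρ := by
  set r : ℝ := min (1 / 2) (ρ / (n + 1)) with hr
  have hr0 : 0 < r := lt_min (by norm_num) (by positivity)
  have hr1 : r ≤ 1 / 2 := min_le_left _ _
  have hr2 : r * (n + 1) ≤ ρ := by
    rw [← le_div_iff₀ (by positivity)]; exact min_le_right _ _
  refine ⟨r ^ n / r, r, by positivity, hr0, if a i = 0 then -1 else 1, by split_ifs <;> norm_num,
    fun η hη hηr => ?_⟩
  set ℓ : Fin n → ℝ := fun j => if j = i then η else r with hℓ
  have hℓ0 : ∀ j, 0 < ℓ j := fun j => by simp only [hℓ]; split_ifs <;> assumption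
  have hℓr : ∀ j, ℓ j ≤ r := fun j => by simp only [hℓ]; split_ifs; exacts [hηr, le_rfl]
  set α : Fin n → ℝ := fun j => if a j ≤ 1 / 2 then a j else a j - ℓ j with hα
  set B : Set (Pt n) := {y | ∀ j, y j ∈ Set.Icc (α j) (α j + ℓ j)} with hB
  have hBc : B ⊆ cell n := by
    intro y hy j
    have h1 := hy j
    have h2 := ha j
    have h3 := hℓr j
    have h4 := hℓ0 j
    simp only [hα, Set.mem_Icc] at h1 h2 ⊢
    split_ifs at h1 <;> constructor <;> linarith [h1.1, h1.2, h2.1, h2.2]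
  refine ⟨B, ?_, ?_, ?_, ?_⟩
  · have : IsClosed B := by
      rw [hB, Set.ofPred_forall]
      exact isClosed_iInter fun j => isClosed_Icc.preimage (by fun_prop)
    exact this.measurableSet
  · rw [hB, volume_box]
    simp only [add_sub_cancel_left]
    rw [← ENNReal.ofReal_prod_of_nonneg fun j _ => (hℓ0 j).le]
    congr 1
    have : ∀ j, ℓ j = r * (if j = i then η / r else 1) := fun j => by
      simp only [hℓ]; split_ifs
      · field_simp
      · ring
    simp only [this, Finset.prod_mul_distrib, Finset.prod_const, Finset.card_univ, Fintype.card_fin,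
      Finset.prod_ite_eq', Finset.mem_univ, if_true]
    ring
  · intro y hy
    refine ⟨hBc hy, fun h => ?_⟩
    rw [interior_cell] at h
    have h1 := h i
    have h2 := hy i
    have e : ℓ i = η := by simp [hℓ]
    simp only [hα, e] at h2
    rcases hi with hi | hi
    · simp [hi] at h1 h2
      linarith [h1.1, h1.2, h2.1, h2.2]
    · norm_num [hi] at h1 h2
      linarith [h1.1, h1.2, h2.1, h2.2]
  · intro y hy
    rw [Metric.mem_ball, dist_eq_norm]
    have h1 : ‖y - a‖ ^ 2 ≤ n * r ^ 2 := by
      rw [EuclideanSpace.norm_sq_eq]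
      calc ∑ j, ‖(y - a) j‖ ^ 2 ≤ ∑ _j : Fin n, r ^ 2 := by
            refine Finset.sum_le_sum fun j _ => ?_
            rw [Real.norm_eq_abs, sq_abs, PiLp.sub_apply]
            have h1 := hy j
            have h3 := hℓr j
            have h4 := hℓ0 j
            simp only [hα, Set.mem_Icc] at h1
            refine sq_le_sq' ?_ ?_ <;> split_ifs at h1 <;> linarith [h1.1, h1.2]
        _ = n * r ^ 2 := by simp
    have hn0 : (0 : ℝ) ≤ n := Nat.cast_nonneg n
    have h2 : ‖y - a‖ ^ 2 < (r * (n + 1)) ^ 2 := by nlinarith [sq_nonneg r, pow_pos hr0 2]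
    exact (lt_of_pow_lt_pow_left₀ 2 (by positivity) h2).trans_le hr2

/-- Smooth functions converging in `H²(Y)` to a function in `H¹₀(Y)` converge pointwise on the cell,
to zero on its boundary. -/
lemma exists_nodal_values (hn : n ≤ 3) {u : Pt n → ℝ} (hu : MemH2 u) (hu0 : u ∈ H10 n)
    {w : ℕ → Pt n → ℝ} (hw : ∀ m, ContDiff ℝ ∞ (w m))
    (h0 : Tendsto (fun m => ∫ y, (w m y - u y) ^ 2 ∂(μY n)) atTop (𝓝 0))
    (h1 : ∀ i, Tendsto (fun m => ∫ y, (partialD i (w m) y - weakD i u y) ^ 2 ∂(μY n)) atTop (𝓝 0))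
    (h2 : ∀ i j, Tendsto (fun m => ∫ y, (partialD j (partialD i (w m)) y -
        weakD j (weakD i u) y) ^ 2 ∂(μY n)) atTop (𝓝 0)) :
    ∃ U : Pt n → ℝ, (∀ a ∈ cell n, Tendsto (fun m => w m a) atTop (𝓝 (U a))) ∧
      ∀ a ∈ frontier (cell n), U a = 0 := by
  obtain ⟨e, he, hcau⟩ := exists_sup_cauchy hn hu hw h0 h1 h2
  have hunif : ∀ ε > 0, ∃ N, ∀ m ≥ N, ∀ l ≥ N, ∀ y ∈ cell n, |w m y - w l y| < ε := by
    intro ε hε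
    have hev : ∀ᶠ m in atTop, e m < ε ^ 2 / 2 := he.eventually_lt_const (by positivity)
    obtain ⟨N, hN⟩ := eventually_atTop.1 hev
    refine ⟨N, fun m hm l hl y hy => abs_lt_of_sq_lt_sq ?_ hε.le⟩
    have := hcau m l y hy
    linarith [hN m hm, hN l hl]
  have hlim : ∀ a ∈ cell n, ∃ c, Tendsto (fun m => w m a) atTop (𝓝 c) := by
    intro a ha
    refine cauchySeq_tendsto_of_complete (Metric.cauchySeq_iff.2 fun ε hε => ?_)
    obtain ⟨N, hN⟩ := hunif ε hε
    exact ⟨N, fun m hm l hl => hN m hm l hl a ha⟩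
  choose! U hU using hlim
  refine ⟨U, hU, fun a ha => ?_⟩
  obtain ⟨hac, i, hi⟩ := mem_frontier_cell.1 ha
  by_contra hne
  set δ : ℝ := |U a| / 4 with hδ
  have hδ0 : 0 < δ := by positivity
  obtain ⟨N, hN⟩ := hunif δ hδ0
  have hNa : |w N a - U a| ≤ δ := by
    have ht : Tendsto (fun m => |w N a - w m a|) atTop (𝓝 |w N a - U a|) :=
      ((hU a hac).const_sub (w N a)).abs
    exact le_of_tendsto ht (eventually_atTop.2 ⟨N, fun m hm => (hN N le_rfl m hm a hac).le⟩)
  obtain ⟨ρ, hρ, hball⟩ := Metric.continuousAt_iff.1 (hw N).continuous.continuousAt δ hδ0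
  have hlow : ∀ m ≥ N, ∀ y ∈ cell n, y ∈ Metric.ball a ρ → δ ^ 2 ≤ w m y ^ 2 := by
    intro m hm y hy hya
    have a1 := hN m hm N le_rfl y hy
    have a2 : |w N y - w N a| < δ := hball hya
    have a3 : |U a| ≤ |w m y| + (|w m y - w N y| + |w N y - w N a| + |w N a - U a|) := by
      have e : U a = w m y - ((w m y - w N y) + (w N y - w N a) + (w N a - U a)) := by ring
      have b1 := abs_sub (w m y) ((w m y - w N y) + (w N y - w N a) + (w N a - U a))
      rw [← e] at b1
      have b2 := abs_add_three (w m y - w N y) (w N y - w N a) (w N a - U a)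
      linarith
    rw [← sq_abs (w m y)]
    exact pow_le_pow_left₀ hδ0.le (by linarith) 2
  obtain ⟨c, η₀, hc, hη₀, s, hs, hbox⟩ := exists_thin_box hac hi hρ
  set G := ∫ y, weakD i u y ^ 2 ∂(μY n) with hG
  have hG0 : 0 ≤ G := integral_nonneg fun _ => sq_nonneg _
  -- Thin boxes have volume of order `η`, whereas the strip integral is of order `η²`.
  have main : ∀ η, 0 < η → η ≤ η₀ → δ ^ 2 * c ≤ 8 * G * η := by
    intro η hη hηη
    obtain ⟨B, hBm, hBv, hBE, hBb⟩ := hbox η hη hηη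
    have hBc : B ⊆ cell n := fun y hy => (hBE hy).1
    have hstrip := integral_strip_le hu0 i (s * η)
    have hle : ∀ m ≥ N, δ ^ 2 * (c * η) ≤ 2 * (∫ y, (w m y - u y) ^ 2 ∂(μY n)) + 8 * η ^ 2 * G := by
      intro m hm
      have hwm := memLp_of_continuous (hw m).continuous (n := n)
      have q1 : δ ^ 2 * (c * η) = ∫ _y in B, δ ^ 2 := by
        rw [setIntegral_const, measureReal_def, hBv, ENNReal.toReal_ofReal (by positivity)]
        simp [mul_comm]
      have q2 : ∫ _y in B, δ ^ 2 ≤ ∫ y in B, w m y ^ 2 :=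
        setIntegral_mono_on (integrableOn_const (by rw [hBv]; exact ENNReal.ofReal_ne_top))
          ((hwm.mono_measure (Measure.restrict_mono_set _ hBc)).integrable_sq) hBm
          fun y hy => hlow m hm y (hBc hy) (hBb hy)
      have q3 := integral_sq_sub_le (μ := volume.restrict B) (f := w m) (g := fun _ => 0) (u := u)
        (hwm.mono_measure (Measure.restrict_mono_set _ hBc)) (by simp)
        (hu.1.1.mono_measure (Measure.restrict_mono_set _ hBc))
      simp only [sub_zero, zero_sub, neg_sq] at q3
      have q4 : ∫ y in B, (w m y - u y) ^ 2 ≤ ∫ y, (w m y - u y) ^ 2 ∂(μY n) :=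
        setIntegral_mono_set (hwm.sub hu.1.1).integrable_sq
          (Eventually.of_forall fun _ => sq_nonneg _) (Eventually.of_forall hBc)
      have q5 : ∫ y in B, u y ^ 2 ≤ 4 * (s * η) ^ 2 * G := by
        refine le_trans ?_ hstrip
        refine setIntegral_mono_set ?_ (Eventually.of_forall fun _ => sq_nonneg _)
          (Eventually.of_forall hBE)
        exact (hu.1.1.mono_measure (Measure.restrict_mono_set _ fun y hy => hy.1)).integrable_sq
      rw [mul_pow, hs] at q5
      linarith
    have ht := (h0.const_mul 2).add_const (8 * η ^ 2 * G)
    rw [mul_zero, zero_add] at ht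
    have := ge_of_tendsto ht (eventually_atTop.2 ⟨N, hle⟩)
    have h3 : (δ ^ 2 * c) * η ≤ (8 * G * η) * η := by linarith
    exact le_of_mul_le_mul_right h3 hη
  have hX : 0 < δ ^ 2 * c := by positivity
  set η := min η₀ (δ ^ 2 * c / (16 * (G + 1))) with hη
  have hη0 : 0 < η := lt_min hη₀ (by positivity)
  have h3 := main η hη0 (min_le_left _ _)
  have h4 : η * (16 * (G + 1)) ≤ δ ^ 2 * c := by
    rw [← le_div_iff₀ (by positivity)]; exact min_le_right _ _
  nlinarith

end Nodal

/-! ### Nodal interpolation -/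

section Interp

variable {n : ℕ}

lemma affine_sub (f : Pt n →ᵃ[ℝ] ℝ) (x y : Pt n) : f x - f y = f.linear (x - y) :=
  (f.linearMap_vsub x y).symm

section Simplex

variable {ι : Type*} [Fintype ι] (b : AffineBasis ι ℝ (Pt n))

/-- The affine function with prescribed values at the vertices of a simplex. -/
def nodal (U : Pt n → ℝ) : Pt n →ᵃ[ℝ] ℝ := ∑ a, U (b a) • b.coord a

lemma nodal_apply (U : Pt n → ℝ) (y : Pt n) : nodal b U y = ∑ a, U (b a) * b.coord a y := by
  have : ∀ (s : Finset ι), (∑ a ∈ s, U (b a) • b.coord a : Pt n →ᵃ[ℝ] ℝ) y =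
      ∑ a ∈ s, U (b a) * b.coord a y := by
    classical
    intro s
    induction s using Finset.induction_on with
    | empty => simp
    | insert a s ha ih => rw [Finset.sum_insert ha, Finset.sum_insert ha, ← ih]; simp
  exact this _

lemma nodal_linear_apply (U : Pt n → ℝ) (v : Pt n) :
    (nodal b U).linear v = ∑ a, U (b a) * (b.coord a).linear v := by
  have h := affine_sub (nodal b U) v 0
  rw [sub_zero] at h
  rw [← h, nodal_apply, nodal_apply, ← Finset.sum_sub_distrib]
  refine Finset.sum_congr rfl fun a _ => ?_
  have := affine_sub (b.coord a) v 0
  rw [sub_zero] at this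
  rw [← mul_sub, this]

lemma nodal_vertex (U : Pt n → ℝ) (a : ι) : nodal b U (b a) = U (b a) := by
  classical
  rw [nodal_apply]
  simp [b.coord_apply]

lemma sum_coord_linear (v : Pt n) : ∑ a, (b.coord a).linear v = 0 := by
  have h : ∀ a, (b.coord a).linear v = b.coord a v - b.coord a 0 := fun a => by
    rw [affine_sub, sub_zero]
  simp only [h, Finset.sum_sub_distrib, b.sum_coord_apply_eq_one, sub_self]

lemma sum_coord_linear_smul (v : Pt n) : ∑ a, (b.coord a).linear v • b a = v := by
  have h : ∀ a, (b.coord a).linear v = b.coord a v - b.coord a 0 := fun a => by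
    rw [affine_sub, sub_zero]
  simp only [h, sub_smul, Finset.sum_sub_distrib, b.linear_combination_coord_eq_self, sub_zero]

/-- The gradient of a barycentric coordinate is at most the inverse of the diameter of any ball in
the simplex. -/
lemma abs_coord_linear_le {x : Pt n} {r : ℝ} (hr : 0 < r)
    (hball : Metric.closedBall x r ⊆ convexHull ℝ (Set.range b)) (a : ι) {v : Pt n} (hv : ‖v‖ = 1) :
    |(b.coord a).linear v| ≤ 1 / (2 * r) := by
  have h01 : ∀ y ∈ convexHull ℝ (Set.range b), 0 ≤ b.coord a y ∧ b.coord a y ≤ 1 := by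
    intro y hy
    rw [b.convexHull_eq_nonneg_coord] at hy
    refine ⟨hy a, ?_⟩
    rw [← b.sum_coord_apply_eq_one y]
    exact Finset.single_le_sum (f := fun i => b.coord i y) (fun i _ => hy i) (Finset.mem_univ a)
  have hp : x + r • v ∈ convexHull ℝ (Set.range b) := hball (by
    simp [norm_smul, hv, abs_of_pos hr])
  have hq : x - r • v ∈ convexHull ℝ (Set.range b) := hball (by
    simp [norm_smul, hv, abs_of_pos hr])
  have e := affine_sub (b.coord a) (x + r • v) (x - r • v)
  have e2 : (x + r • v) - (x - r • v) = (2 * r) • v := by module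
  rw [e2, map_smul, smul_eq_mul] at e
  rw [le_div_iff₀ (by positivity), ← abs_of_pos (by positivity : 0 < 2 * r), ← abs_mul, mul_comm,
    ← e, abs_le]
  have h1 := h01 _ hp
  have h2 := h01 _ hq
  constructor <;> linarith [h1.1, h1.2, h2.1, h2.2]

/-- The gradient of the interpolation error is a combination of Taylor remainders. -/
lemma partialD_sub_nodal (w U : Pt n → ℝ) (x : Pt n) (i : Fin n) :
    partialD i w x - (nodal b U).linear (EuclideanSpace.single i 1) =
      -∑ a, (taylorRem w (b a) x + (U (b a) - w (b a))) *
        (b.coord a).linear (EuclideanSpace.single i 1) := by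
  set v : Pt n := EuclideanSpace.single i 1 with hv
  have e1 : ∑ a, fderiv ℝ w x (x - b a) * (b.coord a).linear v = -partialD i w x := by
    have : ∑ a, fderiv ℝ w x (x - b a) * (b.coord a).linear v =
        fderiv ℝ w x (∑ a, (b.coord a).linear v • (x - b a)) := by
      rw [map_sum]
      exact Finset.sum_congr rfl fun a _ => by rw [map_smul, smul_eq_mul, mul_comm]
    rw [this]
    simp only [smul_sub, Finset.sum_sub_distrib, ← Finset.sum_smul, sum_coord_linear b,
      sum_coord_linear_smul b, zero_smul, zero_sub, map_neg]
    rfl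
  have e2 : ∀ a, (taylorRem w (b a) x + (U (b a) - w (b a))) * (b.coord a).linear v =
      U (b a) * (b.coord a).linear v - w x * (b.coord a).linear v +
        fderiv ℝ w x (x - b a) * (b.coord a).linear v := fun a => by rw [taylorRem]; ring
  simp only [e2, Finset.sum_add_distrib, Finset.sum_sub_distrib, ← Finset.mul_sum,
    sum_coord_linear b, e1, nodal_linear_apply]
  ring

/-- Interpolation error on one simplex, for a smooth function and perturbed nodal values. -/
lemma integral_sq_partialD_sub_nodal_le (hn : n ≤ 3) {w : Pt n → ℝ} (hw : ContDiff ℝ ∞ w)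
    (U : Pt n → ℝ) {x₀ : Pt n} {r d : ℝ} (hr : 0 < r)
    (hball : Metric.closedBall x₀ r ⊆ convexHull ℝ (Set.range b))
    (hcell : convexHull ℝ (Set.range b) ⊆ cell n)
    (hd : ∀ x ∈ convexHull ℝ (Set.range b), ∀ y ∈ convexHull ℝ (Set.range b), ‖x - y‖ ≤ d)
    (i : Fin n) :
    ∫ x in convexHull ℝ (Set.range b),
        (partialD i w x - (nodal b U).linear (EuclideanSpace.single i 1)) ^ 2 ≤
      2 * (Fintype.card ι : ℝ) ^ 2 * d ^ 4 / r ^ 2 *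
          (∫ x in convexHull ℝ (Set.range b), hessSq w x) +
        Fintype.card ι / (2 * r ^ 2) * ∑ a, (U (b a) - w (b a)) ^ 2 := by
  set K := convexHull ℝ (Set.range b) with hK
  have hKc : IsCompact K := (Set.finite_range b).isCompact_convexHull ℝ
  have hKm := hKc.measurableSet
  set v : Pt n := EuclideanSpace.single i 1 with hv
  have hv1 : ‖v‖ = 1 := by simp [hv]
  have hrc : ∀ a, Continuous fun x => taylorRem w (b a) x := fun a => by
    unfold taylorRem
    refine (continuous_const.sub hw.continuous).add ?_
    exact (hw.continuous_fderiv (by simp)).clm_apply (by fun_prop)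
  have hdc : Continuous (partialD i w) := (contDiff_partialD hw i).continuous
  have ii : ∀ {f : Pt n → ℝ}, Continuous f → IntegrableOn f K := fun hf =>
    hf.continuousOn.integrableOn_compact hKc
  set N : ℝ := (Fintype.card ι : ℝ) with hN
  have hpt : ∀ x, (partialD i w x - (nodal b U).linear v) ^ 2 ≤
      N / (2 * r ^ 2) * (∑ a, taylorRem w (b a) x ^ 2) +
        N / (2 * r ^ 2) * ∑ a, (U (b a) - w (b a)) ^ 2 := by
    intro x
    rw [partialD_sub_nodal, neg_sq, ← mul_add, ← Finset.sum_add_distrib]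
    have h1 := sq_sum_le_card_mul_sum_sq (s := (Finset.univ : Finset ι))
      (f := fun a => (taylorRem w (b a) x + (U (b a) - w (b a))) * (b.coord a).linear v)
    refine h1.trans ?_
    rw [Finset.card_univ, ← hN, div_mul_eq_mul_div, mul_div_assoc]
    refine mul_le_mul_of_nonneg_left ?_ (Nat.cast_nonneg _)
    rw [Finset.sum_div]
    refine Finset.sum_le_sum fun a _ => ?_
    have h2 := abs_coord_linear_le b hr hball a hv1
    have h3 : ((b.coord a).linear v) ^ 2 ≤ (1 / (2 * r)) ^ 2 := by
      rw [← sq_abs]; exact pow_le_pow_left₀ (abs_nonneg _) h2 2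
    rw [mul_pow]
    calc _ ≤ (2 * (taylorRem w (b a) x ^ 2 + (U (b a) - w (b a)) ^ 2)) * (1 / (2 * r)) ^ 2 := by
          refine mul_le_mul ?_ h3 (sq_nonneg _) (by positivity)
          nlinarith [sq_nonneg (taylorRem w (b a) x - (U (b a) - w (b a)))]
      _ = _ := by field_simp
  have hRint : ∀ a, ∫ x in K, taylorRem w (b a) x ^ 2 ≤ 4 * d ^ 4 * ∫ x in K, hessSq w x :=
    fun a => integral_sq_taylorRem_le hn hw hKc (convex_convexHull ℝ _)
      (subset_convexHull ℝ _ ⟨a, rfl⟩) fun x hx => hd x hx _ (subset_convexHull ℝ _ ⟨a, rfl⟩)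
  have hvol : (volume.restrict K).real Set.univ ≤ 1 := by
    rw [measureReal_restrict_apply_univ, measureReal_def]
    refine ENNReal.toReal_le_of_le_ofReal zero_le_one ?_
    rw [ENNReal.ofReal_one, ← volume_cell n]
    exact measure_mono hcell
  have : IsFiniteMeasure (volume.restrict K) := ⟨by
    rw [Measure.restrict_apply_univ]; exact hKc.measure_lt_top⟩
  have i2 : ∀ a, Integrable (fun x => taylorRem w (b a) x ^ 2) (volume.restrict K) :=
    fun a => ii ((hrc a).pow 2)
  have i1 : Integrable (fun x => ∑ a, taylorRem w (b a) x ^ 2) (volume.restrict K) :=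
    ii (continuous_finsetSum _ fun a _ => (hrc a).pow 2)
  calc ∫ x in K, (partialD i w x - (nodal b U).linear v) ^ 2
      ≤ ∫ x in K, (N / (2 * r ^ 2) * (∑ a, taylorRem w (b a) x ^ 2) +
        N / (2 * r ^ 2) * ∑ a, (U (b a) - w (b a)) ^ 2) :=
        integral_mono (ii ((hdc.sub continuous_const).pow 2))
          ((i1.const_mul _).add (integrable_const _)) hpt
    _ = N / (2 * r ^ 2) * (∑ a, ∫ x in K, taylorRem w (b a) x ^ 2) +
        (volume.restrict K).real Set.univ * (N / (2 * r ^ 2) * ∑ a, (U (b a) - w (b a)) ^ 2) := by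
        rw [integral_add (i1.const_mul _) (integrable_const _), integral_const_mul,
          integral_finsetSum _ fun a _ => i2 a, integral_const, smul_eq_mul]
    _ ≤ N / (2 * r ^ 2) * (∑ _a : ι, 4 * d ^ 4 * ∫ x in K, hessSq w x) +
        1 * (N / (2 * r ^ 2) * ∑ a, (U (b a) - w (b a)) ^ 2) := by
        refine add_le_add (mul_le_mul_of_nonneg_left (Finset.sum_le_sum fun a _ => hRint a)
          (by positivity)) (mul_le_mul_of_nonneg_right hvol ?_)
        exact mul_nonneg (by positivity) (Finset.sum_nonneg fun _ _ => sq_nonneg _)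
    _ = _ := by
        rw [Finset.sum_const, Finset.card_univ, nsmul_eq_mul, ← hN]
        field_simp
        ring

end Simplex

namespace Mesh

variable (𝒯 : Mesh n)

/-- The vertices of an element, as an affine basis. -/
def basis {K : Finset (Pt n)} (hK : K ∈ 𝒯.elements) : AffineBasis K ℝ (Pt n) :=
  ⟨fun a => a.1, 𝒯.complex.indep hK.1, by
    rw [(𝒯.complex.indep hK.1).affineSpan_eq_top_iff_card_eq_finrank_add_one]
    simp [hK.2]⟩

lemma basis_apply {K : Finset (Pt n)} (hK : K ∈ 𝒯.elements) (a : K) : 𝒯.basis hK a = a.1 := rfl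

lemma range_basis {K : Finset (Pt n)} (hK : K ∈ 𝒯.elements) :
    Set.range (𝒯.basis hK) = (K : Set (Pt n)) := by
  ext y
  simp only [Set.mem_range, basis_apply]
  exact ⟨fun ⟨a, ha⟩ => ha ▸ a.2, fun h => ⟨⟨y, h⟩, rfl⟩⟩

lemma diam_le_size {K : Finset (Pt n)} (hK : K ∈ 𝒯.elements) :
    Metric.diam (convexHull ℝ (K : Set (Pt n))) ≤ 𝒯.size :=
  le_csSup (𝒯.finite_elements.image _).bddAbove ⟨K, hK, rfl⟩

lemma aedisjoint {K K' : Finset (Pt n)} (hK : K ∈ 𝒯.elements) (hK' : K' ∈ 𝒯.elements)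
    (hne : K ≠ K') : AEDisjoint volume (convexHull ℝ (K : Set (Pt n)))
      (convexHull ℝ (K' : Set (Pt n))) := by
  obtain ⟨a, haK, haK'⟩ : ∃ a ∈ K, a ∉ K' := by
    by_contra! h
    exact hne (Finset.eq_of_subset_of_card_le h (by rw [hK.2, hK'.2]))
  have hspan : affineSpan ℝ ((K : Set (Pt n)) ∩ K') ≠ ⊤ := by
    intro htop
    have h1 := (𝒯.complex.indep hK.1).notMem_affineSpan_sdiff ⟨a, haK⟩ Set.univ
    refine h1 ?_
    have h2 : ((K : Set (Pt n)) ∩ K') ⊆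
        (fun x : K => (x : Pt n)) '' (Set.univ \ {⟨a, haK⟩}) := by
      rintro y ⟨hy, hy'⟩
      refine ⟨⟨y, hy⟩, ⟨trivial, fun h => ?_⟩, rfl⟩
      have : y = a := congrArg Subtype.val h
      exact haK' (this ▸ hy')
    exact affineSpan_mono ℝ h2 (htop ▸ AffineSubspace.mem_top ℝ _ _)
  refine measure_mono_null (𝒯.complex.inter_subset_convexHull hK.1 hK'.1) ?_
  exact measure_mono_null (convexHull_subset_affineSpan _)
    (Measure.addHaar_affineSubspace volume _ hspan)

open Classical in
/-- The continuous piecewise affine function with prescribed values at the vertices. -/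
def interp (U : Pt n → ℝ) (y : Pt n) : ℝ :=
  if h : ∃ K, ∃ _ : K ∈ 𝒯.elements, y ∈ convexHull ℝ (K : Set (Pt n)) then
    nodal (𝒯.basis h.choose_spec.choose) U y else 0

lemma nodal_eq_nodal (U : Pt n → ℝ) {K K' : Finset (Pt n)} (hK : K ∈ 𝒯.elements)
    (hK' : K' ∈ 𝒯.elements) {y : Pt n} (hy : y ∈ convexHull ℝ (K : Set (Pt n)))
    (hy' : y ∈ convexHull ℝ (K' : Set (Pt n))) :
    nodal (𝒯.basis hK) U y = nodal (𝒯.basis hK') U y := by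
  have h := 𝒯.complex.inter_subset_convexHull hK.1 hK'.1 ⟨hy, hy'⟩
  have hconv : Convex ℝ {z | nodal (𝒯.basis hK) U z = nodal (𝒯.basis hK') U z} := by
    intro p hp q hq s t _ _ hst
    simp only [Set.mem_ofPred_eq] at *
    rw [Convex.combo_affine_apply hst, Convex.combo_affine_apply hst, hp, hq]
  refine convexHull_min (fun z hz => ?_) hconv h
  have e1 := nodal_vertex (𝒯.basis hK) U ⟨z, hz.1⟩
  have e2 := nodal_vertex (𝒯.basis hK') U ⟨z, hz.2⟩
  exact e1.trans e2.symm

lemma interp_eq (U : Pt n → ℝ) {K : Finset (Pt n)} (hK : K ∈ 𝒯.elements) {y : Pt n}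
    (hy : y ∈ convexHull ℝ (K : Set (Pt n))) : 𝒯.interp U y = nodal (𝒯.basis hK) U y := by
  have h : ∃ K, ∃ _ : K ∈ 𝒯.elements, y ∈ convexHull ℝ (K : Set (Pt n)) := ⟨K, hK, hy⟩
  rw [interp, dif_pos h]
  exact 𝒯.nodal_eq_nodal U _ _ h.choose_spec.choose_spec hy

/-- On a boundary face of the cell only vertices of that face carry positive weight. -/
lemma interp_mem_P1 {U : Pt n → ℝ} (hU : ∀ a ∈ frontier (cell n), U a = 0) : 𝒯.interp U ∈ 𝒯.P1 := by
  have hfin : Finite 𝒯.elements := 𝒯.finite_elements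
  refine ⟨?_, ?_, fun K hK => ⟨nodal (𝒯.basis hK) U, fun y hy => 𝒯.interp_eq U hK hy⟩⟩
  · have hcov : cell n = ⋃ K : 𝒯.elements, convexHull ℝ (K.1 : Set (Pt n)) := by
      rw [← 𝒯.cover, Set.biUnion_eq_iUnion]; rfl
    rw [hcov]
    refine (locallyFinite_of_finite _).continuousOn_iUnion
      (fun K => (isCompact_convexHull_finset K.1).isClosed) fun K => ?_
    exact (nodal (𝒯.basis K.2) U).continuous_of_finiteDimensional.continuousOn.congr
      fun y hy => 𝒯.interp_eq U K.2 hy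
  · intro y hy
    obtain ⟨hyc, i, hi⟩ := mem_frontier_cell.1 hy
    obtain ⟨K, hK, hyK⟩ := 𝒯.exists_mem hyc
    rw [𝒯.interp_eq U hK hyK, nodal_apply]
    set b := 𝒯.basis hK with hb
    have hnn : ∀ a, 0 ≤ b.coord a y := by
      rw [← 𝒯.range_basis hK, ← hb, b.convexHull_eq_nonneg_coord] at hyK
      exact hyK
    have hsum1 := b.sum_coord_apply_eq_one y
    have hcomb : ∑ a, b.coord a y * (b a) i = y i := by
      conv_rhs => rw [← b.linear_combination_coord_eq_self y]
      simp
    have hvc : ∀ a, b a ∈ cell n := fun a =>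
      𝒯.convexHull_subset_cell hK (subset_convexHull ℝ _ a.2)
    refine Finset.sum_eq_zero fun a _ => ?_
    rcases hi with hi | hi
    · rw [hi] at hcomb
      have h0 := (Finset.sum_eq_zero_iff_of_nonneg fun a _ =>
        mul_nonneg (hnn a) (hvc a i).1).1 hcomb a (Finset.mem_univ a)
      rcases mul_eq_zero.1 h0 with h | h
      · rw [h, mul_zero]
      · rw [hU _ (mem_frontier_cell.2 ⟨hvc a, i, Or.inl h⟩), zero_mul]
    · have hcomb' : ∑ a, b.coord a y * (1 - (b a) i) = 0 := by
        simp only [mul_sub, mul_one, Finset.sum_sub_distrib, hsum1, hcomb, hi, sub_self]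
      have h0 := (Finset.sum_eq_zero_iff_of_nonneg fun a _ =>
        mul_nonneg (hnn a) (sub_nonneg.2 (hvc a i).2)).1 hcomb' a (Finset.mem_univ a)
      rcases mul_eq_zero.1 h0 with h | h
      · rw [h, mul_zero]
      · rw [hU _ (mem_frontier_cell.2 ⟨hvc a, i, Or.inr (by linarith)⟩), zero_mul]

lemma integral_cell_eq_sum [Fintype 𝒯.elements] {f : Pt n → ℝ} (hf : Integrable f (μY n)) :
    ∫ y, f y ∂(μY n) = ∑ K : 𝒯.elements, ∫ y in convexHull ℝ (K.1 : Set (Pt n)), f y := by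
  have hcov : cell n = ⋃ K : 𝒯.elements, convexHull ℝ (K.1 : Set (Pt n)) := by
    rw [← 𝒯.cover, Set.biUnion_eq_iUnion]; rfl
  have hf' : IntegrableOn f (⋃ K : 𝒯.elements, convexHull ℝ (K.1 : Set (Pt n))) volume := by
    rw [← hcov]; exact hf
  rw [μY, hcov, integral_iUnion_ae _ _ hf', tsum_fintype]
  · exact fun K => (isCompact_convexHull_finset K.1).measurableSet.nullMeasurableSet
  · exact fun K K' hne => 𝒯.aedisjoint K.2 K'.2 fun h => hne (Subtype.ext h)

end Mesh

/-- First order approximation in the finite element space: for `u ∈ H² ∩ H¹₀` the gradient error is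
of the order of the mesh size, with a constant that depends on the shape regularity only. -/
theorem exists_interpolant (hn : n ≤ 3) (𝒯 : Mesh n) {σ : ℝ} (hσ : 𝒯.ShapeRegular σ)
    {u : Pt n → ℝ} (hu : MemH2 u) (hu0 : u ∈ H10 n) :
    ∃ v ∈ 𝒯.P1, ∀ i, ∫ y, (weakD i u y - weakD i v y) ^ 2 ∂(μY n) ≤
      32 * (n + 1) ^ 2 * σ ^ 2 * 𝒯.size ^ 2 * H2sq u := by
  have hfin : Finite 𝒯.elements := 𝒯.finite_elements
  have : Fintype 𝒯.elements := Fintype.ofFinite _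
  obtain ⟨w, hw, h0, h1, h2⟩ := exists_smooth_approx hu
  obtain ⟨U, hU, hU0⟩ := exists_nodal_values hn hu hu0 hw h0 h1 h2
  have hv : 𝒯.interp U ∈ 𝒯.P1 := 𝒯.interp_mem_P1 hU0
  refine ⟨𝒯.interp U, hv, fun i => ?_⟩
  set v := 𝒯.interp U with hvdef
  have hwk := isWeakPartial_gradExt hv i
  have hg := hwk.1
  have hG := (hu.1.memLp_weakD i)
  have e0 : ∫ y, (weakD i u y - weakD i v y) ^ 2 ∂(μY n) =
      ∫ y, (weakD i u y - gradExt v i y) ^ 2 ∂(μY n) := by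
    refine integral_congr_ae ?_
    filter_upwards [hwk.weakD_ae] with y hy
    rw [hy]
  rw [e0]
  choose x₀ r hr hball hdiam using hσ
  set h := 𝒯.size with hh
  have hw2 : ∀ m, MemLp (partialD i (w m)) 2 (μY n) := fun m =>
    memLp_of_continuous (contDiff_partialD (hw m) i).continuous
  -- the error on each element
  have hel : ∀ (m : ℕ) (K : 𝒯.elements), ∫ y in convexHull ℝ (K.1 : Set (Pt n)),
      (partialD i (w m) y - gradExt v i y) ^ 2 ≤ 8 * (n + 1) ^ 2 * σ ^ 2 * h ^ 2 *
        (∫ y in convexHull ℝ (K.1 : Set (Pt n)), hessSq (w m) y) +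
      (n + 1) / (2 * r K.1 K.2 ^ 2) * ∑ a : K.1, (U a - w m a) ^ 2 := by
    intro m K
    set b := 𝒯.basis K.2 with hb
    have hrange : Set.range b = (K.1 : Set (Pt n)) := 𝒯.range_basis K.2
    set d := Metric.diam (convexHull ℝ (K.1 : Set (Pt n))) with hd
    set ρ := r K.1 K.2 with hρ
    have hρ0 : 0 < ρ := hr K.1 K.2
    have hdρ : d ≤ σ * (2 * ρ) := hdiam K.1 K.2
    have hd0 : 0 ≤ d := Metric.diam_nonneg
    have hdh : d ≤ h := 𝒯.diam_le_size K.2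
    have key := integral_sq_partialD_sub_nodal_le b hn (hw m) U (x₀ := x₀ K.1 K.2) (r := ρ) (d := d)
      hρ0 (by rw [hrange]; exact hball K.1 K.2) (by rw [hrange]; exact 𝒯.convexHull_subset_cell K.2)
      (by
        rw [hrange]
        intro p hp q hq
        rw [← dist_eq_norm]
        exact Metric.dist_le_diam_of_mem (isCompact_convexHull_finset K.1).isBounded hp hq) i
    rw [hrange] at key
    have hcard : (Fintype.card K.1 : ℝ) = n + 1 := by
      rw [Fintype.card_coe, K.2.2]; push_cast; ring
    rw [hcard] at key
    have hI0 : 0 ≤ ∫ y in convexHull ℝ (K.1 : Set (Pt n)), hessSq (w m) y :=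
      integral_nonneg fun y => hessSq_nonneg _ _
    have hcoef : 2 * ((n : ℝ) + 1) ^ 2 * d ^ 4 / ρ ^ 2 ≤ 8 * (n + 1) ^ 2 * σ ^ 2 * h ^ 2 := by
      rw [div_le_iff₀ (by positivity)]
      have a1 : d ^ 2 ≤ (σ * (2 * ρ)) ^ 2 := pow_le_pow_left₀ hd0 hdρ 2
      have a2 : d ^ 2 ≤ h ^ 2 := pow_le_pow_left₀ hd0 hdh 2
      have a3 : d ^ 2 * d ^ 2 ≤ (σ * (2 * ρ)) ^ 2 * h ^ 2 :=
        mul_le_mul a1 a2 (sq_nonneg _) (sq_nonneg _)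
      have a4 := mul_le_mul_of_nonneg_left a3 (by positivity : (0 : ℝ) ≤ 2 * (n + 1) ^ 2)
      linarith [a4]
    have eL : ∫ y in convexHull ℝ (K.1 : Set (Pt n)), (partialD i (w m) y - gradExt v i y) ^ 2 =
        ∫ y in convexHull ℝ (K.1 : Set (Pt n)),
          (partialD i (w m) y - (nodal b U).linear (EuclideanSpace.single i 1)) ^ 2 := by
      refine integral_congr_ae ?_
      have hfr : ∀ᵐ y ∂(volume : Measure (Pt n)), y ∉ frontier (convexHull ℝ (K.1 : Set (Pt n))) :=
        measure_eq_zero_iff_ae_notMem.1 ((convex_convexHull ℝ _).addHaar_frontier volume)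
      have hKcl := (isCompact_convexHull_finset K.1).isClosed
      rw [Filter.EventuallyEq, ae_restrict_iff' hKcl.measurableSet]
      filter_upwards [hfr] with y hy hyK
      have hin : y ∈ interior (convexHull ℝ (K.1 : Set (Pt n))) := by
        by_contra hc
        exact hy (hKcl.frontier_eq ▸ ⟨hyK, hc⟩)
      rw [gradExt_eq_of_eqOn (𝒯.convexHull_subset_cell K.2) (f := nodal b U)
        (fun z hz => 𝒯.interp_eq U K.2 hz) hin]
    rw [eL]
    refine key.trans (add_le_add (mul_le_mul_of_nonneg_right hcoef hI0) le_rfl)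
  set E : ℕ → ℝ := fun m => ∑ K : 𝒯.elements,
    (n + 1) / (2 * r K.1 K.2 ^ 2) * ∑ a : K.1, (U a - w m a) ^ 2 with hE
  have hEt : Tendsto E atTop (𝓝 0) := by
    have : Tendsto E atTop (𝓝 (∑ K : 𝒯.elements,
        (n + 1) / (2 * r K.1 K.2 ^ 2) * ∑ a : K.1, (U a - U a) ^ 2)) := by
      refine tendsto_finsetSum _ fun K _ => (tendsto_finsetSum _ fun a _ => ?_).const_mul _
      exact ((hU a (𝒯.convexHull_subset_cell K.2 (subset_convexHull ℝ _ a.2))).const_sub _).pow 2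
    simpa using this
  have hglob : ∀ m, ∫ y, (partialD i (w m) y - gradExt v i y) ^ 2 ∂(μY n) ≤
      8 * (n + 1) ^ 2 * σ ^ 2 * h ^ 2 * (∫ y, hessSq (w m) y ∂(μY n)) + E m := by
    intro m
    have hHi : Integrable (hessSq (w m)) (μY n) :=
      (continuous_hessSq (hw m)).continuousOn.integrableOn_compact (isCompact_cell n)
    rw [𝒯.integral_cell_eq_sum (f := fun y => (partialD i (w m) y - gradExt v i y) ^ 2)
      ((hw2 m).sub hg).integrable_sq, 𝒯.integral_cell_eq_sum hHi,
      Finset.mul_sum, hE, ← Finset.sum_add_distrib]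
    exact Finset.sum_le_sum fun K _ => hel m K
  set D2 := ∑ i, ∑ j, ∫ y, weakD j (weakD i u) y ^ 2 ∂(μY n) with hD2
  set B : ℕ → ℝ := fun m => ∑ i, ∑ j, ∫ y, (partialD j (partialD i (w m)) y -
        weakD j (weakD i u) y) ^ 2 ∂(μY n) with hB
  have hBt : Tendsto B atTop (𝓝 0) := by
    simpa using tendsto_finsetSum (Finset.univ : Finset (Fin n)) fun i _ =>
      tendsto_finsetSum (Finset.univ : Finset (Fin n)) fun j _ => h2 i j
  have hhess : ∀ m, ∫ y, hessSq (w m) y ∂(μY n) ≤ 2 * B m + 2 * D2 := by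
    intro m
    rw [integral_hessSq (hw m), hB, hD2]
    simp only [Finset.mul_sum, ← Finset.sum_add_distrib]
    refine Finset.sum_le_sum fun i _ => Finset.sum_le_sum fun j _ => ?_
    have := integral_sq_sub_le (memLp_of_continuous
      (contDiff_partialD (contDiff_partialD (hw m) i) j).continuous) (g := fun _ => 0)
      (u := weakD j (weakD i u)) (by simp) ((hu.2 i).memLp_weakD j)
    simpa using this
  set c : ℝ := 8 * (n + 1) ^ 2 * σ ^ 2 * h ^ 2 with hc
  have hc0 : 0 ≤ c := by positivity
  have hfinal : ∀ m, ∫ y, (weakD i u y - gradExt v i y) ^ 2 ∂(μY n) ≤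
      2 * (∫ y, (partialD i (w m) y - weakD i u y) ^ 2 ∂(μY n)) +
        2 * (c * (2 * B m + 2 * D2) + E m) := by
    intro m
    have s1 := integral_sq_sub_le hG hg (hw2 m)
    have s2 : ∫ y, (weakD i u y - partialD i (w m) y) ^ 2 ∂(μY n) =
        ∫ y, (partialD i (w m) y - weakD i u y) ^ 2 ∂(μY n) := by congr 1; ext y; ring
    have s3 : ∫ y, (gradExt v i y - partialD i (w m) y) ^ 2 ∂(μY n) =
        ∫ y, (partialD i (w m) y - gradExt v i y) ^ 2 ∂(μY n) := by congr 1; ext y; ring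
    rw [s2, s3] at s1
    have := mul_le_mul_of_nonneg_left (hhess m) hc0
    linarith [hglob m]
  have hlim : Tendsto (fun m => 2 * (∫ y, (partialD i (w m) y - weakD i u y) ^ 2 ∂(μY n)) +
        2 * (c * (2 * B m + 2 * D2) + E m)) atTop (𝓝 (4 * c * D2)) := by
    have := ((h1 i).const_mul 2).add
      (((((hBt.const_mul 2).add_const (2 * D2)).const_mul c).add hEt).const_mul 2)
    convert this using 2
    ring
  have hle := ge_of_tendsto' hlim hfinal
  have hD2le : D2 ≤ H2sq u := by
    rw [H2sq]; linarith [H1sq_nonneg u]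
  calc _ ≤ 4 * c * D2 := hle
    _ ≤ 4 * c * H2sq u := mul_le_mul_of_nonneg_left hD2le (by positivity)
    _ = _ := by rw [hc]; ring

end Interp

/-! ### Galerkin approximation for symmetric positive semidefinite forms -/

section Galerkin

variable {V : Type*} [AddCommGroup V] [Module ℝ V]

/-- `x` solves `B x f = F f` for all `f ∈ S`, and `xh` is its Galerkin approximation from
`Sh ⊆ S`. The sets need not be subspaces. -/
structure IsGalerkin (B : V →ₗ[ℝ] V →ₗ[ℝ] ℝ) (F : V →ₗ[ℝ] ℝ) (S Sh : Set V) (x xh : V) : Prop where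
  sub : Sh ⊆ S
  mem : x ∈ S
  memh : xh ∈ Sh
  eq : ∀ f ∈ S, B x f = F f
  eqh : ∀ f ∈ Sh, B xh f = F f

variable {B : V →ₗ[ℝ] V →ₗ[ℝ] ℝ} {F F' : V →ₗ[ℝ] ℝ} {S Sh : Set V} {x xh x' xh' : V}

lemma IsGalerkin.orth (h : IsGalerkin B F S Sh x xh) {f : V} (hf : f ∈ Sh) : B (x - xh) f = 0 := by
  rw [map_sub, LinearMap.sub_apply, h.eq f (h.sub hf), h.eqh f hf, sub_self]

/-- Céa's lemma in the energy seminorm. -/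
lemma IsGalerkin.cea (h : IsGalerkin B F S Sh x xh) (hs : ∀ u v, B u v = B v u)
    (hp : ∀ u, 0 ≤ B u u) {w : V} (hw : w ∈ Sh) : B (x - xh) (x - xh) ≤ B (x - w) (x - w) := by
  have e : x - w = (x - xh) + (xh - w) := by abel
  have h1 : B (x - xh) (xh - w) = 0 := by rw [map_sub, h.orth h.memh, h.orth hw, sub_self]
  have e' : B (x - w) (x - w) = B (x - xh) (x - xh) + B (xh - w) (xh - w) := by
    rw [e, map_add B, LinearMap.add_apply, map_add, map_add, hs (xh - w) (x - xh), h1]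
    ring
  linarith [hp (xh - w)]

/-- The error of a linear functional is the energy product of two Galerkin errors. -/
lemma IsGalerkin.functional_error (h : IsGalerkin B F S Sh x xh)
    (h' : IsGalerkin B F' S Sh x' xh') (hs : ∀ u v, B u v = B v u) :
    F x' - F xh' = B (x - xh) (x' - xh') := by
  have e1 : B xh (x' - xh') = 0 := by rw [hs]; exact h'.orth h.memh
  rw [map_sub B, LinearMap.sub_apply, e1, sub_zero, map_sub, h.eq _ h'.mem, h.eq _ (h.sub h'.memh)]

/-- Cauchy–Schwarz inequality for a semidefinite form, with the energies given by upper bounds. -/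
lemma abs_form_le (hs : ∀ u v, B u v = B v u) (hp : ∀ u, 0 ≤ B u u) {u v : V} {a b : ℝ}
    (ha : 0 ≤ a) (hb : 0 ≤ b) (hu : B u u ≤ a ^ 2) (hv : B v v ≤ b ^ 2) : |B u v| ≤ a * b := by
  have h1 := LinearMap.BilinForm.apply_sq_le_of_symm B hp ⟨hs⟩ u v
  refine abs_le_of_sq_le_sq ?_ (by positivity)
  calc B u v ^ 2 ≤ B u u * B v v := h1
    _ ≤ a ^ 2 * b ^ 2 := mul_le_mul hu hv (hp v) (sq_nonneg a)
    _ = (a * b) ^ 2 := by ring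

end Galerkin

/-! ### Energy forms on square integrable fields -/

section Energy

variable {n : ℕ} {ι : Type*}

variable (n ι) in
/-- Square integrable fields on the cell with components indexed by `ι`. -/
def L2F : Submodule ℝ (ι → Pt n → ℝ) where
  carrier := {g | ∀ p, MemLp (g p) 2 (μY n)}
  add_mem' hf hg p := (hf p).add (hg p)
  zero_mem' _ := MemLp.zero
  smul_mem' c _ hf p := (hf p).const_smul c

variable (n) in
/-- Constant fields. -/
def cst : (ι → ℝ) →ₗ[ℝ] L2F n ι where
  toFun ζ := ⟨fun p _ => ζ p, fun _ => memLp_const _⟩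
  map_add' _ _ := rfl
  map_smul' _ _ := rfl

lemma cst_apply (ζ : ι → ℝ) (p : ι) (y : Pt n) : (cst n ζ).1 p y = ζ p := rfl

variable [Fintype ι]

/-- Measurable symmetric coefficients that are bounded by `κ₁` and elliptic with constant `κ₀` on
the `τ`-symmetric parts: `τ` is the identity for conductivities and the transposition of index
pairs for elasticity. -/
structure IsEnergy (κ₀ κ₁ : ℝ) (τ : ι → ι) (A : ι → ι → Pt n → ℝ) : Prop where
  meas : ∀ p q, AEStronglyMeasurable (A p q) (μY n)
  symm : ∀ᵐ y ∂(μY n), ∀ p q, A p q y = A q p y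
  lower : ∀ᵐ y ∂(μY n), ∀ ζ : ι → ℝ,
    κ₀ * ∑ p, ((ζ p + ζ (τ p)) / 2) ^ 2 ≤ ∑ p, ∑ q, A p q y * ζ q * ζ p
  upper : ∀ᵐ y ∂(μY n), ∀ ζ : ι → ℝ, ∑ p, ∑ q, A p q y * ζ q * ζ p ≤ κ₁ * ∑ p, ζ p ^ 2

variable {κ₀ κ₁ : ℝ} {τ : ι → ι} {A : ι → ι → Pt n → ℝ}

/-- Entries of a symmetric positive semidefinite matrix are controlled by the quadratic form. -/
lemma abs_entry_le {κ : ℝ} {a : ι → ι → ℝ} (hs : ∀ p q, a p q = a q p)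
    (h0 : ∀ ζ : ι → ℝ, 0 ≤ ∑ p, ∑ q, a p q * ζ q * ζ p)
    (h1 : ∀ ζ : ι → ℝ, ∑ p, ∑ q, a p q * ζ q * ζ p ≤ κ * ∑ p, ζ p ^ 2) (p q : ι) : |a p q| ≤ κ := by
  classical
  have hdiag : ∀ p, a p p ≤ κ := fun p => by
    have := h1 (Pi.single p 1)
    simpa [Pi.single_apply] using this
  rcases eq_or_ne p q with rfl | hne
  · have := h0 (Pi.single p 1)
    have h2 : 0 ≤ a p p := by simpa [Pi.single_apply] using this
    rw [abs_of_nonneg h2]; exact hdiag p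
  · have key : ∀ s : ℝ, 0 ≤ a p p + s ^ 2 * a q q + 2 * s * a p q := by
      intro s
      have := h0 (Pi.single p 1 + s • Pi.single q 1)
      simp only [Pi.add_apply, Pi.smul_apply, smul_eq_mul, mul_add, add_mul,
        Finset.sum_add_distrib] at this
      simp [Pi.single_apply, hs q p] at this
      linarith
    have k1 := key 1
    have k2 := key (-1)
    have d1 := hdiag p
    have d2 := hdiag q
    rw [abs_le]; constructor <;> linarith

namespace IsEnergy

lemma nonneg_ae (h : IsEnergy κ₀ κ₁ τ A) (hκ₀ : 0 < κ₀) :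
    ∀ᵐ y ∂(μY n), ∀ ζ : ι → ℝ, 0 ≤ ∑ p, ∑ q, A p q y * ζ q * ζ p := by
  filter_upwards [h.lower] with y hy ζ
  exact (mul_nonneg hκ₀.le (Finset.sum_nonneg fun _ _ => sq_nonneg _)).trans (hy ζ)

lemma bound (h : IsEnergy κ₀ κ₁ τ A) (hκ₀ : 0 < κ₀) (p q : ι) :
    ∀ᵐ y ∂(μY n), ‖A p q y‖ ≤ κ₁ := by
  filter_upwards [h.symm, h.nonneg_ae hκ₀, h.upper] with y h1 h2 h3
  exact abs_entry_le h1 h2 h3 p q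

lemma integrable_entry (h : IsEnergy κ₀ κ₁ τ A) (hκ₀ : 0 < κ₀) (p q : ι) {f g : Pt n → ℝ}
    (hf : MemLp f 2 (μY n)) (hg : MemLp g 2 (μY n)) :
    Integrable (fun y => A p q y * f y * g y) (μY n) := by
  have := (integrable_mul_of_memLp hf hg).bdd_mul (h.meas p q) (h.bound hκ₀ p q)
  exact this.congr (Eventually.of_forall fun y => by ring)

lemma integrable_form (h : IsEnergy κ₀ κ₁ τ A) (hκ₀ : 0 < κ₀) (g f : L2F n ι) :
    Integrable (fun y => ∑ p, ∑ q, A p q y * g.1 q y * f.1 p y) (μY n) :=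
  integrable_finsetSum _ fun p _ => integrable_finsetSum _ fun q _ =>
    h.integrable_entry hκ₀ p q (g.2 q) (f.2 p)

/-- The energy form `∫ A_{pq} g_q f_p`. -/
def form (h : IsEnergy κ₀ κ₁ τ A) (hκ₀ : 0 < κ₀) : L2F n ι →ₗ[ℝ] L2F n ι →ₗ[ℝ] ℝ :=
  LinearMap.mk₂ ℝ (fun g f => ∫ y, ∑ p, ∑ q, A p q y * g.1 q y * f.1 p y ∂(μY n))
    (fun g g' f => by
      rw [← integral_add (h.integrable_form hκ₀ g f) (h.integrable_form hκ₀ g' f)]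
      refine integral_congr_ae (Eventually.of_forall fun y => ?_)
      simp only [← Finset.sum_add_distrib, Submodule.coe_add, Pi.add_apply]
      exact Finset.sum_congr rfl fun p _ => Finset.sum_congr rfl fun q _ => by ring)
    (fun c g f => by
      rw [smul_eq_mul, ← integral_const_mul]
      refine integral_congr_ae (Eventually.of_forall fun y => ?_)
      simp only [Finset.mul_sum, Submodule.coe_smul, Pi.smul_apply, smul_eq_mul]
      exact Finset.sum_congr rfl fun p _ => Finset.sum_congr rfl fun q _ => by ring)
    (fun g f f' => by
      rw [← integral_add (h.integrable_form hκ₀ g f) (h.integrable_form hκ₀ g f')]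
      refine integral_congr_ae (Eventually.of_forall fun y => ?_)
      simp only [← Finset.sum_add_distrib, Submodule.coe_add, Pi.add_apply]
      exact Finset.sum_congr rfl fun p _ => Finset.sum_congr rfl fun q _ => by ring)
    (fun c g f => by
      rw [smul_eq_mul, ← integral_const_mul]
      refine integral_congr_ae (Eventually.of_forall fun y => ?_)
      simp only [Finset.mul_sum, Submodule.coe_smul, Pi.smul_apply, smul_eq_mul]
      exact Finset.sum_congr rfl fun p _ => Finset.sum_congr rfl fun q _ => by ring)

variable (h : IsEnergy κ₀ κ₁ τ A) (hκ₀ : 0 < κ₀)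
include h

lemma form_apply (g f : L2F n ι) :
    h.form hκ₀ g f = ∫ y, ∑ p, ∑ q, A p q y * g.1 q y * f.1 p y ∂(μY n) := rfl

lemma form_symm (g f : L2F n ι) : h.form hκ₀ g f = h.form hκ₀ f g := by
  rw [form_apply, form_apply]
  refine integral_congr_ae ?_
  filter_upwards [h.symm] with y hy
  rw [Finset.sum_comm]
  exact Finset.sum_congr rfl fun p _ => Finset.sum_congr rfl fun q _ => by rw [hy q p]; ring

lemma form_nonneg (g : L2F n ι) : 0 ≤ h.form hκ₀ g g := by
  rw [form_apply]
  refine integral_nonneg_of_ae ?_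
  filter_upwards [h.nonneg_ae hκ₀] with y hy using hy fun p => g.1 p y

lemma form_le (g : L2F n ι) : h.form hκ₀ g g ≤ κ₁ * ∑ p, ∫ y, g.1 p y ^ 2 ∂(μY n) := by
  rw [form_apply, ← integral_finsetSum _ fun p _ => (g.2 p).integrable_sq, ← integral_const_mul]
  refine integral_mono_ae (h.integrable_form hκ₀ g g)
    ((integrable_finsetSum _ fun p _ => (g.2 p).integrable_sq).const_mul _) ?_
  filter_upwards [h.upper] with y hy using hy fun p => g.1 p y

lemma le_form (g : L2F n ι) :
    κ₀ * ∑ p, ∫ y, ((g.1 p y + g.1 (τ p) y) / 2) ^ 2 ∂(μY n) ≤ h.form hκ₀ g g := by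
  have hi : ∀ p, MemLp (fun y => (g.1 p y + g.1 (τ p) y) / 2) 2 (μY n) := fun p => by
    have := ((g.2 p).add (g.2 (τ p))).mul_const (2⁻¹ : ℝ)
    simpa [div_eq_mul_inv] using this
  rw [form_apply, ← integral_finsetSum _ fun p _ => (hi p).integrable_sq, ← integral_const_mul]
  refine integral_mono_ae ((integrable_finsetSum _ fun p _ => (hi p).integrable_sq).const_mul _)
    (h.integrable_form hκ₀ g g) ?_
  filter_upwards [h.lower] with y hy using hy fun p => g.1 p y

end IsEnergy

lemma cst_eq_sum [DecidableEq ι] (ζ : ι → ℝ) : cst n ζ = ∑ p, ζ p • cst n (Pi.single p 1) := by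
  conv_lhs => rw [pi_eq_sum_univ' ζ]
  simp only [map_sum, map_smul]

namespace IsEnergy

variable (h : IsEnergy κ₀ κ₁ τ A) (hκ₀ : 0 < κ₀)
include h

lemma form_cst_le (ζ : ι → ℝ) : h.form hκ₀ (cst n ζ) (cst n ζ) ≤ κ₁ * ∑ p, ζ p ^ 2 := by
  refine (h.form_le hκ₀ _).trans (le_of_eq ?_)
  simp [cst_apply]

lemma form_single_right [DecidableEq ι] (g : L2F n ι) (p : ι) :
    h.form hκ₀ g (cst n (Pi.single p 1)) = ∫ y, ∑ q, A p q y * g.1 q y ∂(μY n) := by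
  rw [form_apply]
  congr 1
  ext y
  rw [Finset.sum_eq_single p]
  · simp [cst_apply]
  · intro q _ hq; simp [cst_apply, hq]
  · simp

lemma form_single_left [DecidableEq ι] (f : L2F n ι) (q : ι) :
    h.form hκ₀ (cst n (Pi.single q 1)) f = ∫ y, ∑ p, A p q y * f.1 p y ∂(μY n) := by
  rw [form_apply]
  congr 1
  ext y
  refine Finset.sum_congr rfl fun p _ => ?_
  rw [Finset.sum_eq_single q]
  · simp [cst_apply]
  · intro q' _ hq; simp [cst_apply, hq]
  · simp

/-- Coercivity on constant fields perturbed by fields of mean zero. -/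
lemma le_form_cst_add (ζ : ι → ℝ) (hζ : ∀ p, ζ (τ p) = ζ p) (g : L2F n ι)
    (hg : ∀ p, ∫ y, g.1 p y ∂(μY n) = 0) :
    κ₀ * ∑ p, ζ p ^ 2 ≤ h.form hκ₀ (cst n ζ + g) (cst n ζ + g) := by
  refine le_trans ?_ (h.le_form hκ₀ _)
  refine mul_le_mul_of_nonneg_left (Finset.sum_le_sum fun p _ => ?_) hκ₀.le
  have ig : ∀ p, Integrable (g.1 p) (μY n) := fun p => (g.2 p).integrable (by norm_num)
  have e : ∀ p, ∫ y, (cst n ζ + g).1 p y ∂(μY n) = ζ p := by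
    intro p
    have : ∫ y, (cst n ζ + g).1 p y ∂(μY n) = ∫ y, (ζ p + g.1 p y) ∂(μY n) := rfl
    rw [this, integral_add (integrable_const _) (ig p), hg p]
    simp
  have hm : MemLp (fun y => ((cst n ζ + g).1 p y + (cst n ζ + g).1 (τ p) y) / 2) 2 (μY n) := by
    have := (((cst n ζ + g).2 p).add ((cst n ζ + g).2 (τ p))).mul_const (2⁻¹ : ℝ)
    simpa [div_eq_mul_inv] using this
  have := sq_integral_le_integral_sq hm
  rw [integral_div, integral_add (((cst n ζ + g).2 p).integrable (by norm_num))
    (((cst n ζ + g).2 (τ p)).integrable (by norm_num)), e, e, hζ p] at this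
  calc ζ p ^ 2 = ((ζ p + ζ p) / 2) ^ 2 := by ring
    _ ≤ _ := this

end IsEnergy

/-! ### Homogenized coefficients of an energy form -/

/-- The homogenized coefficients `∫ A_{pr} (e_q + m_q)_r` attached to the fields `m_q`. -/
def IsEnergy.hom [DecidableEq ι] (h : IsEnergy κ₀ κ₁ τ A) (hκ₀ : 0 < κ₀) (m : ι → L2F n ι)
    (p q : ι) : ℝ :=
  h.form hκ₀ (cst n (Pi.single q 1) + m q) (cst n (Pi.single p 1))

/-- The load `f ↦ -∫ A_{pq} f_p` of the cell problem with index `q`. -/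
def IsEnergy.load [DecidableEq ι] (h : IsEnergy κ₀ κ₁ τ A) (hκ₀ : 0 < κ₀) (q : ι) :
    L2F n ι →ₗ[ℝ] ℝ := -(h.form hκ₀ (cst n (Pi.single q 1)))

namespace IsEnergy

variable [DecidableEq ι] (h : IsEnergy κ₀ κ₁ τ A) (hκ₀ : 0 < κ₀) {S Sh : Set (L2F n ι)}
  {m mh : ι → L2F n ι} (hG : ∀ p, IsGalerkin (h.form hκ₀) (h.load hκ₀ p) S Sh (m p) (mh p))
include hG

/-- The error of the homogenized coefficients is the energy product of the cell errors. -/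
lemma hom_sub_hom (p q : ι) :
    h.hom hκ₀ mh p q - h.hom hκ₀ m p q = h.form hκ₀ (m p - mh p) (m q - mh q) := by
  rw [← (hG p).functional_error (hG q) (h.form_symm hκ₀), hom, hom, map_add, map_add,
    LinearMap.add_apply, LinearMap.add_apply, load, LinearMap.neg_apply, LinearMap.neg_apply,
    h.form_symm hκ₀ (mh q), h.form_symm hκ₀ (m q)]
  ring

/-- The quadratic form of the approximate coefficients, and the energy identity for the corrector
`∑ ζ_q mₕ_q` of the constant field `ζ`. -/
lemma sum_hom (ζ : ι → ℝ) :
    ∑ p, ∑ q, h.hom hκ₀ mh p q * ζ p * ζ q =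
        h.form hκ₀ (cst n ζ + ∑ q, ζ q • mh q) (cst n ζ) ∧
      h.form hκ₀ (cst n ζ) (∑ q, ζ q • mh q) =
        -h.form hκ₀ (∑ q, ζ q • mh q) (∑ q, ζ q • mh q) := by
  constructor
  · have e : cst n ζ + ∑ q, ζ q • mh q = ∑ q, ζ q • (cst n (Pi.single q 1) + mh q) := by
      simp only [smul_add, Finset.sum_add_distrib, ← cst_eq_sum]
    rw [e]
    conv_rhs => rw [cst_eq_sum ζ]
    simp only [map_sum, LinearMap.sum_apply, map_smul, LinearMap.smul_apply, smul_eq_mul,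
      Finset.mul_sum]
    refine Finset.sum_congr rfl fun p _ => Finset.sum_congr rfl fun q _ => ?_
    rw [hom]; ring
  · have e : ∀ f ∈ Sh, h.form hκ₀ (cst n ζ) f = -h.form hκ₀ (∑ q, ζ q • mh q) f := by
      intro f hf
      rw [cst_eq_sum ζ]
      simp only [map_sum, LinearMap.sum_apply, map_smul, LinearMap.smul_apply, smul_eq_mul,
        ← Finset.sum_neg_distrib]
      refine Finset.sum_congr rfl fun p _ => ?_
      rw [(hG p).eqh f hf, load, LinearMap.neg_apply]; ring
    rw [map_sum, map_sum, ← Finset.sum_neg_distrib]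
    refine Finset.sum_congr rfl fun p _ => ?_
    rw [map_smul, map_smul, e _ (hG p).memh]
    simp

/-- The corrector lowers the energy of the constant field `ζ`. -/
lemma sum_hom_le (ζ : ι → ℝ) :
    ∑ p, ∑ q, h.hom hκ₀ mh p q * ζ p * ζ q ≤ κ₁ * ∑ p, ζ p ^ 2 := by
  obtain ⟨e1, e2⟩ := h.sum_hom hκ₀ hG ζ
  rw [e1, map_add, LinearMap.add_apply, h.form_symm hκ₀ (∑ q, ζ q • mh q), e2]
  linarith [h.form_cst_le hκ₀ ζ, h.form_nonneg hκ₀ (∑ q, ζ q • mh q)]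

/-- The quadratic form equals the energy of `ζ` plus its corrector, which has mean zero. -/
lemma le_sum_hom (hmean : ∀ p r, ∫ y, (mh p).1 r y ∂(μY n) = 0) (ζ : ι → ℝ)
    (hζ : ∀ p, ζ (τ p) = ζ p) :
    κ₀ * ∑ p, ζ p ^ 2 ≤ ∑ p, ∑ q, h.hom hκ₀ mh p q * ζ p * ζ q := by
  obtain ⟨e1, e2⟩ := h.sum_hom hκ₀ hG ζ
  have hm : ∀ p, ∫ y, (∑ q, ζ q • mh q : L2F n ι).1 p y ∂(μY n) = 0 := by
    intro p
    have e3 : ∀ y, (∑ q, ζ q • mh q : L2F n ι).1 p y = ∑ q, ζ q * (mh q).1 p y := by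
      intro y
      rw [Submodule.coe_sum, Finset.sum_apply, Finset.sum_apply]
      rfl
    simp only [e3]
    rw [integral_finsetSum _ fun q _ => (((mh q).2 p).integrable (by norm_num)).const_mul _]
    simp [integral_const_mul, hmean]
  have h1 := h.le_form_cst_add hκ₀ ζ hζ _ hm
  rw [map_add, map_add, LinearMap.add_apply (h.form hκ₀ (cst n ζ)),
    h.form_symm hκ₀ (∑ q, ζ q • mh q) (cst n ζ)] at h1
  rw [e1, map_add, LinearMap.add_apply, h.form_symm hκ₀ (∑ q, ζ q • mh q), e2]
  simp only [LinearMap.add_apply, e2] at h1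
  linarith

end IsEnergy

end Energy

section CellProblems

/-! ### Gradient fields -/

variable {n : ℕ}

lemma MemH2.memH1 {u : Pt n → ℝ} (h : MemH2 u) : MemH1 u := h.1

lemma memH1_of_H10 {u : Pt n → ℝ} (h : u ∈ H10 n) : MemH1 u := h.1

/-- The gradient of an `H¹` function as an element of `L²(Y)ⁿ`. -/
def grad (v : Pt n → ℝ) (hv : MemH1 v) : L2F n (Fin n) :=
  ⟨fun i => weakD i v, fun i => hv.memLp_weakD i⟩

/-- The gradient `(∂_l v_k)_{(k,l)}` of an `H¹` vector field. -/
def gradVec (v : Fin n → Pt n → ℝ) (hv : ∀ k, MemH1 (v k)) : L2F n (Fin n × Fin n) :=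
  ⟨fun p => weakD p.2 (v p.1), fun p => (hv p.1).memLp_weakD p.2⟩

/-- The gradients of the functions in `W`. -/
def grads (W : Set (Pt n → ℝ)) : Set (L2F n (Fin n)) :=
  {f | ∃ v ∈ W, ∃ hv : MemH1 v, f = grad v hv}

/-- The gradients of the vector fields with components in `W`. -/
def gradsVec (W : Set (Pt n → ℝ)) : Set (L2F n (Fin n × Fin n)) :=
  {f | ∃ v : Fin n → Pt n → ℝ, (∀ k, v k ∈ W) ∧ ∃ hv : ∀ k, MemH1 (v k), f = gradVec v hv}

lemma grads_mono {W W' : Set (Pt n → ℝ)} (h : W ⊆ W') : grads W ⊆ grads W' := by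
  rintro f ⟨v, hv, hv', rfl⟩
  exact ⟨v, h hv, hv', rfl⟩

lemma gradsVec_mono {W W' : Set (Pt n → ℝ)} (h : W ⊆ W') : gradsVec W ⊆ gradsVec W' := by
  rintro f ⟨v, hv, hv', rfl⟩
  exact ⟨v, fun k => h (hv k), hv', rfl⟩

/-- Derivatives of `H¹₀` functions have mean zero. -/
lemma integral_weakD_eq_zero {u : Pt n → ℝ} (hu : u ∈ H10 n) (i : Fin n) :
    ∫ y, weakD i u y ∂(μY n) = 0 := by
  obtain ⟨hu1, φ, hφ, hlim⟩ := hu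
  have hφ0 : ∀ m, ∫ y, partialD i (φ m) y ∂(μY n) = 0 := by
    intro m
    have h1 := (hφ m).partialD i
    have e : ∫ y, partialD i (φ m) y ∂(μY n) = ∫ y, partialD i (φ m) y := by
      have := setIntegral_cell_eq (f := partialD i (φ m)) (g := fun _ => 1)
        fun y hy => h1.eq_zero hy
      simpa using this
    rw [e]
    have := integral_mul_partialD (u := fun _ => (1 : ℝ)) (φ := φ m) contDiff_const
      ((hφ m).1.of_le (by simp)) (hφ m).2.1 i
    simpa [partialD] using this
  have key : ∀ m, (∫ y, weakD i u y ∂(μY n)) ^ 2 ≤ H1sq (fun y => u y - φ m y) := by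
    intro m
    have hi := hu1.memLp_weakD i
    have hp := ((hφ m).partialD i).memLp
    have h1 := sq_integral_le_integral_sq (μ := μY n) (hi.sub hp)
    have h2 : ∫ y, (weakD i u - partialD i (φ m)) y ∂(μY n) = ∫ y, weakD i u y ∂(μY n) := by
      have := integral_sub (hi.integrable (by norm_num)) (hp.integrable (by norm_num))
      simp only [Pi.sub_apply]
      rw [this, hφ0, sub_zero]
    rw [h2] at h1
    refine h1.trans ?_
    rw [H1sq_sub_eq hu1.1 hu1.isWeakPartial (hφ m).1]
    have h3 := Finset.single_le_sum
      (f := fun j => ∫ y, (weakD j u y - partialD j (φ m) y) ^ 2 ∂(μY n))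
      (fun j _ => integral_nonneg fun y => sq_nonneg _) (Finset.mem_univ i)
    have h4 : 0 ≤ ∫ y, (u y - φ m y) ^ 2 ∂(μY n) := integral_nonneg fun y => sq_nonneg _
    simp only [Pi.sub_apply]
    linarith
  have h0 : (∫ y, weakD i u y ∂(μY n)) ^ 2 ≤ 0 := ge_of_tendsto' hlim key
  exact pow_eq_zero_iff (two_ne_zero) |>.1 (le_antisymm h0 (sq_nonneg _))

lemma Mesh.size_nonneg (𝒯 : Mesh n) : 0 ≤ 𝒯.size := by
  refine Real.sSup_nonneg ?_
  rintro _ ⟨K, -, rfl⟩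
  exact Metric.diam_nonneg

/-- The constant of the interpolation estimate for gradients. -/
def interpConst (n : ℕ) (σ : ℝ) : ℝ := n * (32 * (n + 1) ^ 2 * σ ^ 2)

lemma exists_grad_approx (hn : n ≤ 3) {𝒯 : Mesh n} {σ : ℝ} (hσ : 𝒯.ShapeRegular σ)
    {u : Pt n → ℝ} (hu : MemH2 u) (hu0 : u ∈ H10 n) :
    ∃ v ∈ 𝒯.P1, ∑ i, ∫ y, (weakD i u y - weakD i v y) ^ 2 ∂(μY n) ≤
      interpConst n σ * 𝒯.size ^ 2 * H2sq u := by
  obtain ⟨v, hv, h⟩ := exists_interpolant hn 𝒯 hσ hu hu0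
  refine ⟨v, hv, (Finset.sum_le_sum fun i _ => h i).trans (le_of_eq ?_)⟩
  simp [interpConst]
  ring

section Errors

variable {κ₀ κ₁ σ : ℝ} {𝒯 : Mesh n}

/-- The energy error is of first order in the mesh size. -/
lemma energy_error_le (hn : n ≤ 3) (hσ : 𝒯.ShapeRegular σ) {A : Fin n → Fin n → Pt n → ℝ}
    (h : IsEnergy κ₀ κ₁ id A) (hκ₀ : 0 < κ₀) (hκ₁ : 0 < κ₁) {F : L2F n (Fin n) →ₗ[ℝ] ℝ}
    {u : Pt n → ℝ} (hu : MemH2 u) (hu0 : u ∈ H10 n) {xh : L2F n (Fin n)}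
    (hG : IsGalerkin (h.form hκ₀) F (grads (H10 n)) (grads 𝒯.P1) (grad u hu.memH1) xh) :
    h.form hκ₀ (grad u hu.1 - xh) (grad u hu.1 - xh) ≤
      (√(κ₁ * interpConst n σ) * 𝒯.size * H2norm u) ^ 2 := by
  obtain ⟨v, hv, hle⟩ := exists_grad_approx hn hσ hu hu0
  have hv1 := memH1_of_P1 hv
  refine (hG.cea (h.form_symm hκ₀) (h.form_nonneg hκ₀) ⟨v, hv, hv1, rfl⟩).trans ?_
  refine (h.form_le hκ₀ _).trans ?_
  rw [mul_pow, mul_pow, Real.sq_sqrt (by unfold interpConst; positivity), H2norm,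
    Real.sq_sqrt (H2sq_nonneg u)]
  calc _ ≤ κ₁ * (interpConst n σ * 𝒯.size ^ 2 * H2sq u) := mul_le_mul_of_nonneg_left hle hκ₁.le
    _ = _ := by ring

lemma energy_error_vec_le (hn : n ≤ 3) (hσ : 𝒯.ShapeRegular σ) {τ : Fin n × Fin n → Fin n × Fin n}
    {A : Fin n × Fin n → Fin n × Fin n → Pt n → ℝ}
    (h : IsEnergy κ₀ κ₁ τ A) (hκ₀ : 0 < κ₀) (hκ₁ : 0 < κ₁) {F : L2F n (Fin n × Fin n) →ₗ[ℝ] ℝ}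
    {u : Fin n → Pt n → ℝ} (hu : ∀ k, MemH2 (u k)) (hu0 : ∀ k, u k ∈ H10 n)
    {xh : L2F n (Fin n × Fin n)}
    (hG : IsGalerkin (h.form hκ₀) F (gradsVec (H10 n)) (gradsVec 𝒯.P1)
      (gradVec u fun k => (hu k).memH1) xh) :
    h.form hκ₀ (gradVec u (fun k => (hu k).memH1) - xh) (gradVec u (fun k => (hu k).memH1) - xh) ≤
      (√(κ₁ * interpConst n σ) * 𝒯.size * H2normVec u) ^ 2 := by
  choose v hv hle using fun k => exists_grad_approx hn hσ (hu k) (hu0 k)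
  have hv1 := fun k => memH1_of_P1 (hv k)
  refine (hG.cea (h.form_symm hκ₀) (h.form_nonneg hκ₀) ⟨v, hv, hv1, rfl⟩).trans ?_
  refine (h.form_le hκ₀ _).trans ?_
  rw [mul_pow, mul_pow, Real.sq_sqrt (by unfold interpConst; positivity), H2normVec,
    Real.sq_sqrt (Finset.sum_nonneg fun k _ => H2sq_nonneg (u k)), Fintype.sum_prod_type]
  calc _ ≤ κ₁ * ∑ k, interpConst n σ * 𝒯.size ^ 2 * H2sq (u k) :=
        mul_le_mul_of_nonneg_left (Finset.sum_le_sum fun k _ => hle k) hκ₁.le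
    _ = _ := by rw [← Finset.mul_sum]; ring

end Errors

/-! ### Conductivity: scalar cell problems -/

section Scalar

variable {κ₀ κ₁ σ : ℝ} {𝒯 : Mesh n}

lemma isEnergy_of_ellipticMatrix {A : Fin n → Fin n → Pt n → ℝ}
    (hm : ∀ i j, AEStronglyMeasurable (A i j) (μY n))
    (h : ∀ᵐ y ∂(μY n), EllipticMatrix κ₀ κ₁ fun i j => A i j y) : IsEnergy κ₀ κ₁ id A where
  meas := hm
  symm := h.mono fun y hy => hy.1
  lower := h.mono fun y hy ζ => by
    have := hy.2.1 ζ
    simp only [id, add_self_div_two]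
    refine this.trans (le_of_eq ?_)
    exact Finset.sum_congr rfl fun i _ => Finset.sum_congr rfl fun j _ => by ring
  upper := h.mono fun y hy ζ => by
    refine le_trans (le_of_eq ?_) (hy.2.2 ζ)
    exact Finset.sum_congr rfl fun i _ => Finset.sum_congr rfl fun j _ => by ring

lemma average_cell (f : Pt n → ℝ) : ⨍ y in cell n, f y = ∫ y, f y ∂(μY n) := by
  rw [setAverage_eq, measureReal_def, volume_cell]
  simp [μY]

lemma isGalerkin_scalar {A : Fin n → Fin n → Pt n → ℝ} (h : IsEnergy κ₀ κ₁ id A) (hκ₀ : 0 < κ₀)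
    {α : Fin n} {x xh : Pt n → ℝ} (hx : x ∈ H10 n) (hxh : xh ∈ 𝒯.P1)
    (eq : ∀ v ∈ H10 n, ∫ y, ∑ i, ∑ j, A i j y * weakD j x y * weakD i v y ∂(μY n) =
      -∫ y, ∑ i, A i α y * weakD i v y ∂(μY n))
    (eqh : ∀ v ∈ 𝒯.P1, ∫ y, ∑ i, ∑ j, A i j y * weakD j xh y * weakD i v y ∂(μY n) =
      -∫ y, ∑ i, A i α y * weakD i v y ∂(μY n)) :
    IsGalerkin (h.form hκ₀) (h.load hκ₀ α) (grads (H10 n)) (grads 𝒯.P1) (grad x (memH1_of_H10 hx))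
      (grad xh (memH1_of_P1 hxh)) where
  sub := grads_mono (P1_subset_H10 𝒯)
  mem := ⟨x, hx, memH1_of_H10 hx, rfl⟩
  memh := ⟨xh, hxh, memH1_of_P1 hxh, rfl⟩
  eq := by
    rintro _ ⟨v, hv, hv1, rfl⟩
    rw [IsEnergy.load, LinearMap.neg_apply, h.form_single_left]
    exact eq v hv
  eqh := by
    rintro _ ⟨v, hv, hv1, rfl⟩
    rw [IsEnergy.load, LinearMap.neg_apply, h.form_single_left]
    exact eqh v hv

lemma hom_scalar {A : Fin n → Fin n → Pt n → ℝ} (h : IsEnergy κ₀ κ₁ id A) (hκ₀ : 0 < κ₀)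
    {x : Fin n → Pt n → ℝ} (hx : ∀ α, MemH1 (x α)) (i j : Fin n) :
    ⨍ y in cell n, (A i j y + ∑ a, A i a y * weakD a (x j) y) =
      h.hom hκ₀ (fun α => grad (x α) (hx α)) i j := by
  rw [average_cell, IsEnergy.hom, h.form_single_right]
  congr 1
  ext y
  have : ∀ q, (cst n (Pi.single j 1) + grad (x j) (hx j)).1 q y =
      (Pi.single j 1 : Fin n → ℝ) q + weakD q (x j) y := fun q => rfl
  simp only [this, mul_add, Finset.sum_add_distrib]
  simp [Pi.single_apply]

/-- Error estimate and ellipticity of the homogenized coefficients of a scalar cell problem. -/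
theorem scalar_estimates (hn : n ≤ 3) (hσ : 𝒯.ShapeRegular σ) {A : Fin n → Fin n → Pt n → ℝ}
    (h : IsEnergy κ₀ κ₁ id A) (hκ₀ : 0 < κ₀) (hκ₁ : 0 < κ₁) {x xh : Fin n → Pt n → ℝ}
    (hx : ∀ α, x α ∈ H10 n) (hx2 : ∀ α, MemH2 (x α)) (hxh : ∀ α, xh α ∈ 𝒯.P1)
    (eq : ∀ α, ∀ v ∈ H10 n, ∫ y, ∑ i, ∑ j, A i j y * weakD j (x α) y * weakD i v y ∂(μY n) =
      -∫ y, ∑ i, A i α y * weakD i v y ∂(μY n))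
    (eqh : ∀ α, ∀ v ∈ 𝒯.P1, ∫ y, ∑ i, ∑ j, A i j y * weakD j (xh α) y * weakD i v y ∂(μY n) =
      -∫ y, ∑ i, A i α y * weakD i v y ∂(μY n)) :
    (∀ i j, |(⨍ y in cell n, (A i j y + ∑ a, A i a y * weakD a (xh j) y)) -
        ⨍ y in cell n, (A i j y + ∑ a, A i a y * weakD a (x j) y)| ≤
      κ₁ * interpConst n σ * 𝒯.size ^ 2 * H2norm (x i) * H2norm (x j)) ∧
    LowerBound κ₀ (fun i j => ⨍ y in cell n, (A i j y + ∑ a, A i a y * weakD a (xh j) y)) ∧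
    UpperBound κ₁ (fun i j => ⨍ y in cell n, (A i j y + ∑ a, A i a y * weakD a (xh j) y)) := by
  have hG := fun α => isGalerkin_scalar h hκ₀ (hx α) (hxh α) (eq α) (eqh α)
  have hE := fun α => energy_error_le hn hσ h hκ₀ hκ₁ (hx2 α) (hx α) (hG α)
  have hmean : ∀ p r, ∫ y, (grad (xh p) (memH1_of_P1 (hxh p))).1 r y ∂(μY n) = 0 := fun p r =>
    integral_weakD_eq_zero (P1_subset_H10 𝒯 (hxh p)) r
  have hs := 𝒯.size_nonneg
  have hN : ∀ u : Pt n → ℝ, 0 ≤ H2norm u := fun u => Real.sqrt_nonneg _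
  have e := hom_scalar h hκ₀ fun α => (hx2 α).memH1
  have eh := hom_scalar h hκ₀ fun α => memH1_of_P1 (hxh α)
  simp only [e, eh]
  refine ⟨fun i j => ?_, fun ξ => ?_, fun ξ => ?_⟩
  · rw [h.hom_sub_hom hκ₀ hG]
    refine (abs_form_le (h.form_symm hκ₀) (h.form_nonneg hκ₀) (by have := hN (x i); positivity)
      (by have := hN (x j); positivity) (hE i) (hE j)).trans (le_of_eq ?_)
    have hsq : √(κ₁ * interpConst n σ) ^ 2 = κ₁ * interpConst n σ :=
      Real.sq_sqrt (by unfold interpConst; positivity)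
    linear_combination 𝒯.size ^ 2 * H2norm (x i) * H2norm (x j) * hsq
  · exact h.le_sum_hom hκ₀ hG hmean ξ fun _ => rfl
  · exact h.sum_hom_le hκ₀ hG ξ

end Scalar

/-! ### Elasticity: vector cell problems -/

section Vector

variable {κ₀ κ₁ σ : ℝ} {𝒯 : Mesh n}

lemma sum_mul_symmPart {t : Fin n → Fin n → ℝ} (ht : ∀ i j, t i j = t j i)
    (z : Fin n × Fin n → ℝ) :
    ∑ p : Fin n × Fin n, t p.1 p.2 * z p =
      ∑ p : Fin n × Fin n, t p.1 p.2 * ((z p + z p.swap) / 2) := by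
  have h : ∑ p : Fin n × Fin n, t p.1 p.2 * z p.swap = ∑ p : Fin n × Fin n, t p.1 p.2 * z p := by
    rw [← Equiv.sum_comp (Equiv.prodComm (Fin n) (Fin n))]
    exact Finset.sum_congr rfl fun p _ => by simp [ht p.2 p.1]
  have e : ∀ p : Fin n × Fin n, t p.1 p.2 * ((z p + z p.swap) / 2) =
      (t p.1 p.2 * z p + t p.1 p.2 * z p.swap) / 2 := fun p => by ring
  simp only [e]
  rw [← Finset.sum_div, Finset.sum_add_distrib, h, add_self_div_two]

/-- The elasticity tensor as a matrix indexed by pairs of indices. -/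
def pairs (c : Fin n → Fin n → Fin n → Fin n → Pt n → ℝ) (p q : Fin n × Fin n) : Pt n → ℝ :=
  c p.1 p.2 q.1 q.2

/-- By its minor symmetries an elasticity tensor only sees the symmetric part of its arguments. -/
lemma EllipticTensor.form_eq {a : Fin n → Fin n → Fin n → Fin n → ℝ} (h : EllipticTensor κ₀ κ₁ a)
    (ζ : Fin n × Fin n → ℝ) :
    ∑ p : Fin n × Fin n, ∑ q : Fin n × Fin n, a p.1 p.2 q.1 q.2 * ζ q * ζ p =
      ∑ i, ∑ j, ∑ k, ∑ l, a i j k l * ((ζ (i, j) + ζ (j, i)) / 2) *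
        ((ζ (k, l) + ζ (l, k)) / 2) := by
  have hr : ∀ i j k l, a i j k l = a i j l k := fun i j k l => by
    rw [h.2.1, h.1, h.2.1]
  have e1 : ∀ p : Fin n × Fin n, ∑ q : Fin n × Fin n, a p.1 p.2 q.1 q.2 * ζ q * ζ p =
      (∑ q : Fin n × Fin n, a p.1 p.2 q.1 q.2 * ((ζ q + ζ q.swap) / 2)) * ζ p := fun p => by
    rw [← Finset.sum_mul, ← sum_mul_symmPart (hr p.1 p.2)]
  simp only [e1]
  rw [sum_mul_symmPart (t := fun i j => ∑ q : Fin n × Fin n, a i j q.1 q.2 *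
    ((ζ q + ζ q.swap) / 2)) fun i j => Finset.sum_congr rfl fun q _ => by rw [h.1]]
  simp only [Fintype.sum_prod_type, Prod.swap_prod_mk, Finset.sum_mul]
  refine Finset.sum_congr rfl fun i _ => Finset.sum_congr rfl fun j _ =>
    Finset.sum_congr rfl fun k _ => Finset.sum_congr rfl fun l _ => by ring

lemma isEnergy_of_ellipticTensor {c : Fin n → Fin n → Fin n → Fin n → Pt n → ℝ} (hκ₁ : 0 < κ₁)
    (hm : ∀ i j k l, AEStronglyMeasurable (c i j k l) (μY n))
    (h : ∀ᵐ y ∂(μY n), EllipticTensor κ₀ κ₁ fun i j k l => c i j k l y) :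
    IsEnergy κ₀ κ₁ Prod.swap (pairs c) where
  meas p q := hm p.1 p.2 q.1 q.2
  symm := h.mono fun y hy p q => hy.2.1 _ _ _ _
  lower := h.mono fun y hy ζ => by
    have h1 := (hy.2.2 (fun i j => (ζ (i, j) + ζ (j, i)) / 2) fun i j => by rw [add_comm]).1
    rw [← hy.form_eq ζ] at h1
    rw [Fintype.sum_prod_type]
    exact h1
  upper := h.mono fun y hy ζ => by
    have h1 := (hy.2.2 (fun i j => (ζ (i, j) + ζ (j, i)) / 2) fun i j => by rw [add_comm]).2
    rw [← hy.form_eq ζ] at h1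
    refine h1.trans (mul_le_mul_of_nonneg_left ?_ hκ₁.le)
    have e : ∑ p : Fin n × Fin n, ζ p ^ 2 =
        ∑ i, ∑ j, (ζ (i, j) ^ 2 + ζ (j, i) ^ 2) / 2 := by
      simp only [← Finset.sum_div, Finset.sum_add_distrib]
      rw [Finset.sum_comm (f := fun i j => ζ (j, i) ^ 2), Fintype.sum_prod_type, add_self_div_two]
    rw [e]
    refine Finset.sum_le_sum fun i _ => Finset.sum_le_sum fun j _ => ?_
    nlinarith [sq_nonneg (ζ (i, j) - ζ (j, i))]

lemma isGalerkin_vec {c : Fin n → Fin n → Fin n → Fin n → Pt n → ℝ}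
    (h : IsEnergy κ₀ κ₁ Prod.swap (pairs c)) (hκ₀ : 0 < κ₀) {F : L2F n (Fin n × Fin n) →ₗ[ℝ] ℝ}
    {x xh : Fin n → Pt n → ℝ} (hx : ∀ k, x k ∈ H10 n) (hxh : ∀ k, xh k ∈ 𝒯.P1)
    (eq : ∀ (v : Fin n → Pt n → ℝ) (hv1 : ∀ k, MemH1 (v k)), (∀ k, v k ∈ H10 n) →
      ∫ y, ∑ i, ∑ j, ∑ k, ∑ l, c i j k l y * weakD l (x k) y * weakD j (v i) y ∂(μY n) =
        F (gradVec v hv1))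
    (eqh : ∀ (v : Fin n → Pt n → ℝ) (hv1 : ∀ k, MemH1 (v k)), (∀ k, v k ∈ 𝒯.P1) →
      ∫ y, ∑ i, ∑ j, ∑ k, ∑ l, c i j k l y * weakD l (xh k) y * weakD j (v i) y ∂(μY n) =
        F (gradVec v hv1)) :
    IsGalerkin (h.form hκ₀) F (gradsVec (H10 n)) (gradsVec 𝒯.P1)
      (gradVec x fun k => memH1_of_H10 (hx k)) (gradVec xh fun k => memH1_of_P1 (hxh k)) where
  sub := gradsVec_mono (P1_subset_H10 𝒯)
  mem := ⟨x, hx, _, rfl⟩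
  memh := ⟨xh, hxh, _, rfl⟩
  eq := by
    rintro _ ⟨v, hv, hv1, rfl⟩
    rw [← eq v hv1 hv, h.form_apply]
    simp only [Fintype.sum_prod_type]
    rfl
  eqh := by
    rintro _ ⟨v, hv, hv1, rfl⟩
    rw [← eqh v hv1 hv, h.form_apply]
    simp only [Fintype.sum_prod_type]
    rfl

lemma load_gradVec {c : Fin n → Fin n → Fin n → Fin n → Pt n → ℝ}
    (h : IsEnergy κ₀ κ₁ Prod.swap (pairs c)) (hκ₀ : 0 < κ₀) (m α : Fin n)
    (v : Fin n → Pt n → ℝ) (hv1 : ∀ k, MemH1 (v k)) :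
    h.load hκ₀ (m, α) (gradVec v hv1) =
      -∫ y, ∑ i, ∑ j, c i j m α y * weakD j (v i) y ∂(μY n) := by
  rw [IsEnergy.load, LinearMap.neg_apply, h.form_single_left]
  simp only [Fintype.sum_prod_type]
  rfl

lemma hom_vec {c : Fin n → Fin n → Fin n → Fin n → Pt n → ℝ}
    (h : IsEnergy κ₀ κ₁ Prod.swap (pairs c)) (hκ₀ : 0 < κ₀)
    {x : Fin n → Fin n → Fin n → Pt n → ℝ} (hx : ∀ m α k, MemH1 (x m α k)) (i j k l : Fin n) :
    ⨍ y in cell n, (c i j k l y + ∑ a, ∑ b, c i j a b y * weakD b (x k l a) y) =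
      h.hom hκ₀ (fun p => gradVec (x p.1 p.2) (hx p.1 p.2)) (i, j) (k, l) := by
  rw [average_cell, IsEnergy.hom, h.form_single_right]
  congr 1
  ext y
  have : ∀ q, (cst n (Pi.single (k, l) 1) + gradVec (x k l) (hx k l)).1 q y =
      (Pi.single (k, l) 1 : Fin n × Fin n → ℝ) q + weakD q.2 (x k l q.1) y := fun q => rfl
  simp only [this, mul_add, Finset.sum_add_distrib]
  simp [Pi.single_apply, Fintype.sum_prod_type, pairs, Prod.ext_iff, ite_and]

lemma form_grad_single {c : Fin n → Fin n → Fin n → Fin n → Pt n → ℝ}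
    (h : IsEnergy κ₀ κ₁ Prod.swap (pairs c)) (hκ₀ : 0 < κ₀)
    {x : Fin n → Pt n → ℝ} (hx : ∀ k, MemH1 (x k)) (i j : Fin n) :
    h.form hκ₀ (gradVec x hx) (cst n (Pi.single (i, j) 1)) =
      ∫ y, ∑ k, ∑ l, c i j k l y * weakD l (x k) y ∂(μY n) := by
  rw [h.form_single_right]
  simp only [Fintype.sum_prod_type]
  rfl

end Vector

/-! ### The thermal modulus as a load -/

section Load

variable {ι : Type*} [Fintype ι]

/-- The functional `f ↦ ∫ b_p f_p` of a square integrable field. -/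
def pairing (b : L2F n ι) : L2F n ι →ₗ[ℝ] ℝ where
  toFun f := ∫ y, ∑ p, b.1 p y * f.1 p y ∂(μY n)
  map_add' f g := by
    rw [← integral_add
      (integrable_finsetSum _ fun p _ => integrable_mul_of_memLp (b.2 p) (f.2 p))
      (integrable_finsetSum _ fun p _ => integrable_mul_of_memLp (b.2 p) (g.2 p))]
    refine integral_congr_ae (Eventually.of_forall fun y => ?_)
    simp only [← Finset.sum_add_distrib, Submodule.coe_add, Pi.add_apply]
    exact Finset.sum_congr rfl fun p _ => by ring
  map_smul' c f := by
    rw [RingHom.id_apply, smul_eq_mul, ← integral_const_mul]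
    refine integral_congr_ae (Eventually.of_forall fun y => ?_)
    simp only [Finset.mul_sum, Submodule.coe_smul, Pi.smul_apply, smul_eq_mul]
    exact Finset.sum_congr rfl fun p _ => by ring

lemma pairing_apply (b f : L2F n ι) :
    pairing b f = ∫ y, ∑ p, b.1 p y * f.1 p y ∂(μY n) := rfl

lemma pairing_single [DecidableEq ι] (b : L2F n ι) (p : ι) :
    pairing b (cst n (Pi.single p 1)) = ∫ y, b.1 p y ∂(μY n) := by
  rw [pairing_apply]
  congr 1
  ext y
  simp [cst_apply, Pi.single_apply]

/-- A bound for the energy of solutions: Young's inequality absorbs half of the energy. -/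
lemma IsEnergy.form_le_of_eq_pairing {κ₀ κ₁ M : ℝ}
    {A : Fin n × Fin n → Fin n × Fin n → Pt n → ℝ}
    (h : IsEnergy κ₀ κ₁ Prod.swap A) (hκ₀ : 0 < κ₀) {b f : L2F n (Fin n × Fin n)}
    (hb : ∀ᵐ y ∂(μY n), (∀ i j, b.1 (i, j) y = b.1 (j, i) y) ∧ ∀ p, |b.1 p y| ≤ M)
    (hf : h.form hκ₀ f f = pairing b f) : h.form hκ₀ f f ≤ n ^ 2 * M ^ 2 / κ₀ := by
  have hs : ∀ p, MemLp (fun y => (f.1 p y + f.1 p.swap y) / 2) 2 (μY n) := fun p => by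
    have := ((f.2 p).add (f.2 p.swap)).mul_const (2⁻¹ : ℝ)
    simpa [div_eq_mul_inv] using this
  have h1 : pairing b f ≤ n ^ 2 * M ^ 2 / (2 * κ₀) +
      κ₀ / 2 * ∑ p, ∫ y, ((f.1 p y + f.1 p.swap y) / 2) ^ 2 ∂(μY n) := by
    have hi := integrable_finsetSum Finset.univ fun p _ => (hs p).integrable_sq
    have e : n ^ 2 * M ^ 2 / (2 * κ₀) +
        κ₀ / 2 * ∑ p, ∫ y, ((f.1 p y + f.1 p.swap y) / 2) ^ 2 ∂(μY n) =
        ∫ y, (n ^ 2 * M ^ 2 / (2 * κ₀) +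
          κ₀ / 2 * ∑ p, ((f.1 p y + f.1 p.swap y) / 2) ^ 2) ∂(μY n) := by
      rw [integral_add (integrable_const _) (hi.const_mul _), integral_const_mul,
        integral_finsetSum _ fun p _ => (hs p).integrable_sq]
      simp
    rw [e, pairing_apply]
    refine integral_mono_ae
      (integrable_finsetSum _ fun p _ => integrable_mul_of_memLp (b.2 p) (f.2 p))
      ((integrable_const _).add (hi.const_mul _)) ?_
    filter_upwards [hb] with y hy
    have e2 := sum_mul_symmPart (t := fun i j => b.1 (i, j) y) hy.1 fun p => f.1 p y
    rw [show ∑ p, b.1 p y * f.1 p y = _ from e2]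
    have e3 : (n ^ 2 * M ^ 2 / (2 * κ₀) : ℝ) = ∑ _p : Fin n × Fin n, M ^ 2 / (2 * κ₀) := by
      simp; ring
    rw [e3, Finset.mul_sum, ← Finset.sum_add_distrib]
    refine Finset.sum_le_sum fun p _ => ?_
    set s := (f.1 p y + f.1 p.swap y) / 2
    have hM : b.1 p y ^ 2 ≤ M ^ 2 := sq_le_sq' (abs_le.1 (hy.2 p)).1 (abs_le.1 (hy.2 p)).2
    have h4 : b.1 p y * s ≤ b.1 p y ^ 2 / (2 * κ₀) + κ₀ / 2 * s ^ 2 := by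
      have : b.1 p y ^ 2 / (2 * κ₀) + κ₀ / 2 * s ^ 2 - b.1 p y * s =
          (b.1 p y - κ₀ * s) ^ 2 / (2 * κ₀) := by field_simp; ring
      have : 0 ≤ (b.1 p y - κ₀ * s) ^ 2 / (2 * κ₀) := by positivity
      linarith
    have h5 : b.1 p y ^ 2 / (2 * κ₀) ≤ M ^ 2 / (2 * κ₀) := by gcongr
    exact h4.trans (by linarith)
  have h2 := h.le_form hκ₀ f
  rw [← hf] at h1
  have e4 : n ^ 2 * M ^ 2 / (2 * κ₀) = n ^ 2 * M ^ 2 / κ₀ / 2 := by field_simp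
  rw [e4] at h1
  linarith

end Load

end CellProblems

/-! ### Thermal modulus and heat capacity -/

section Thermal

variable {n : ℕ} {κ₀ κ₁ ρ₀ ρ₁ c₀ c₁ Tmin Tmax T : ℝ} {D : Material n}

namespace Material.Admissible

variable (hD : D.Admissible κ₀ κ₁ ρ₀ ρ₁ c₀ c₁ Tmin Tmax) (hT : T ∈ Set.Icc Tmin Tmax)
include hD hT

lemma isEnergy_beta : IsEnergy κ₀ κ₁ id fun i j => D.beta i j T :=
  isEnergy_of_ellipticMatrix (hD.meas_beta T hT) (hD.beta_elliptic T hT)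

lemma isEnergy_c (hκ₁ : 0 < κ₁) :
    IsEnergy κ₀ κ₁ Prod.swap (pairs fun i j k l => D.c i j k l T) :=
  isEnergy_of_ellipticTensor hκ₁ (hD.meas_c T hT) (hD.c_elliptic T hT)

lemma beta_bounds (hκ₀ : 0 < κ₀) : ∀ᵐ y ∂(μY n), (∀ i j, D.beta i j T y = D.beta j i T y) ∧
    ∀ p : Fin n × Fin n, |D.beta p.1 p.2 T y| ≤ κ₁ := by
  have hb := hD.isEnergy_beta hT
  filter_upwards [hb.symm, hb.nonneg_ae hκ₀, hb.upper] with y h1 h2 h3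
  exact ⟨h1, fun p => abs_entry_le h1 h2 h3 p.1 p.2⟩

/-- The thermal modulus as a square integrable field. -/
def betaField (hκ₀ : 0 < κ₀) : L2F n (Fin n × Fin n) :=
  ⟨fun p => D.beta p.1 p.2 T, fun p => MemLp.of_bound (hD.meas_beta T hT p.1 p.2) κ₁
    ((hD.beta_bounds hT hκ₀).mono fun _ hy => hy.2 p)⟩

variable (hκ₀ : 0 < κ₀)

lemma pairing_gradVec {v : Fin n → Pt n → ℝ} (hv : ∀ k, MemH1 (v k)) :
    pairing (hD.betaField hT hκ₀) (gradVec v hv) =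
      ∫ y, ∑ i, ∑ j, D.beta i j T y * weakD j (v i) y ∂(μY n) := by
  rw [pairing_apply]
  simp only [Fintype.sum_prod_type]
  rfl

lemma integrable_rho_mul_heat (hρ₀ : 0 < ρ₀) (hc₀ : 0 < c₀) :
    Integrable (fun y => D.rho T y * D.heat T y) (μY n) := by
  refine Integrable.of_bound ((hD.meas_rho T hT).mul (hD.meas_heat T hT)) (ρ₁ * c₁) ?_
  filter_upwards [hD.rho_bounds T hT, hD.heat_bounds T hT] with y h1 h2
  have h3 : 0 ≤ D.rho T y := by linarith
  have h4 : 0 ≤ D.heat T y := by linarith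
  rw [Real.norm_of_nonneg (mul_nonneg h3 h4)]
  exact mul_le_mul h1.2 h2.2 h4 (h3.trans h1.2)

lemma integral_rho_mul_heat (hρ₀ : 0 < ρ₀) (hc₀ : 0 < c₀) :
    ρ₀ * c₀ ≤ ∫ y, D.rho T y * D.heat T y ∂(μY n) ∧
      ∫ y, D.rho T y * D.heat T y ∂(μY n) ≤ ρ₁ * c₁ := by
  have hi := hD.integrable_rho_mul_heat hT hρ₀ hc₀
  constructor
  · have : ∫ _ : Pt n, ρ₀ * c₀ ∂(μY n) ≤ ∫ y, D.rho T y * D.heat T y ∂(μY n) := by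
      refine integral_mono_ae (integrable_const _) hi ?_
      filter_upwards [hD.rho_bounds T hT, hD.heat_bounds T hT] with y h1 h2
      exact mul_le_mul h1.1 h2.1 hc₀.le (hρ₀.le.trans h1.1)
    simpa using this
  · have : ∫ y, D.rho T y * D.heat T y ∂(μY n) ≤ ∫ _ : Pt n, ρ₁ * c₁ ∂(μY n) := by
      refine integral_mono_ae hi (integrable_const _) ?_
      filter_upwards [hD.rho_bounds T hT, hD.heat_bounds T hT] with y h1 h2
      exact mul_le_mul h1.2 h2.2 (hc₀.le.trans h2.1) ((hρ₀.le.trans h1.1).trans h1.2)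
    simpa using this

lemma homS_eq (hρ₀ : 0 < ρ₀) (hc₀ : 0 < c₀) (X : CellFunctions n) (hX : ∀ k, MemH1 (X.P k)) :
    homS D T X = ∫ y, D.rho T y * D.heat T y ∂(μY n) +
      T * pairing (hD.betaField hT hκ₀) (gradVec X.P hX) := by
  have hi : Integrable (fun y => ∑ i, ∑ j, D.beta i j T y * weakD j (X.P i) y) (μY n) :=
    integrable_finsetSum _ fun i _ => integrable_finsetSum _ fun j _ =>
      integrable_mul_of_memLp ((hD.betaField hT hκ₀).2 (i, j)) ((hX i).memLp_weakD j)
  rw [homS, average_cell, integral_add (hD.integrable_rho_mul_heat hT hρ₀ hc₀) (hi.const_mul _),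
    integral_const_mul, hD.pairing_gradVec hT]

/-- In terms of the energy form, `β̂_{ij}` is the load of the thermal modulus on the constant field
`e_{ij}` minus its energy product with the gradient of `𝒫`. -/
lemma homBeta_eq (hκ₁ : 0 < κ₁) (X : CellFunctions n) (hX : ∀ k, MemH1 (X.P k)) (i j : Fin n) :
    homBeta D T X i j = pairing (hD.betaField hT hκ₀) (cst n (Pi.single (i, j) 1)) -
      (hD.isEnergy_c hT hκ₁).form hκ₀ (gradVec X.P hX) (cst n (Pi.single (i, j) 1)) := by
  have hi : Integrable (fun y => ∑ k, ∑ l, D.c i j k l T y * weakD l (X.P k) y) (μY n) :=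
    integrable_finsetSum _ fun k _ => integrable_finsetSum _ fun l _ => by
      have := (hD.isEnergy_c hT hκ₁).integrable_entry hκ₀ (i, j) (k, l)
        ((hX k).memLp_weakD l) (memLp_const 1)
      simpa [pairs] using this
  rw [form_grad_single, pairing_single, homBeta, average_cell]
  exact integral_sub (((hD.betaField hT hκ₀).2 (i, j)).integrable (by norm_num)) hi

/-- The quadratic form of the homogenized thermal modulus. -/
lemma sum_homBeta (hκ₁ : 0 < κ₁) (X : CellFunctions n) (hX : ∀ k, MemH1 (X.P k)) (ξ : Fin n → ℝ) :
    ∑ i, ∑ j, homBeta D T X i j * ξ i * ξ j =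
      pairing (hD.betaField hT hκ₀) (cst n fun p => ξ p.1 * ξ p.2) -
        (hD.isEnergy_c hT hκ₁).form hκ₀ (gradVec X.P hX) (cst n fun p => ξ p.1 * ξ p.2) := by
  rw [cst_eq_sum]
  simp only [map_sum, map_smul, smul_eq_mul, ← Finset.sum_sub_distrib, Fintype.sum_prod_type]
  refine Finset.sum_congr rfl fun i _ => Finset.sum_congr rfl fun j _ => ?_
  rw [hD.homBeta_eq hT hκ₀ hκ₁ X hX]
  ring

/-- Boundedness of the homogenized thermal modulus of fields of bounded energy. -/
lemma upperBound_homBeta (hκ₁ : 0 < κ₁) (X : CellFunctions n) (hX : ∀ k, MemH1 (X.P k)) {Q : ℝ}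
    (hQ : 0 ≤ Q) (hE : (hD.isEnergy_c hT hκ₁).form hκ₀ (gradVec X.P hX) (gradVec X.P hX) ≤ Q) :
    UpperBound (κ₁ + √Q * √κ₁) (homBeta D T X) := by
  intro ξ
  have hc := hD.isEnergy_c hT hκ₁
  have hs : 0 ≤ ∑ i, ξ i ^ 2 := Finset.sum_nonneg fun _ _ => sq_nonneg _
  have e : ∑ p : Fin n × Fin n, (ξ p.1 * ξ p.2) ^ 2 = (∑ i, ξ i ^ 2) ^ 2 := by
    rw [sq (∑ i, ξ i ^ 2), Finset.sum_mul_sum, Fintype.sum_prod_type]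
    simp only [mul_pow]
  have h1 : pairing (hD.betaField hT hκ₀) (cst n fun p => ξ p.1 * ξ p.2) ≤
      κ₁ * ∑ i, ξ i ^ 2 := by
    have := (hD.isEnergy_beta hT).form_cst_le hκ₀ ξ
    refine le_trans (le_of_eq ?_) this
    rw [pairing_apply, IsEnergy.form_apply]
    congr 1
    ext y
    rw [Fintype.sum_prod_type]
    refine Finset.sum_congr rfl fun i _ => Finset.sum_congr rfl fun j _ => ?_
    simp only [cst_apply, betaField]
    ring
  have h2 := abs_form_le (hc.form_symm hκ₀) (hc.form_nonneg hκ₀)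
    (u := gradVec X.P hX) (v := cst n fun p => ξ p.1 * ξ p.2) (a := √Q)
    (b := √κ₁ * ∑ i, ξ i ^ 2) (Real.sqrt_nonneg _) (by positivity)
    (by rwa [Real.sq_sqrt hQ]) (by
      rw [mul_pow, Real.sq_sqrt hκ₁.le, ← e]
      exact hc.form_cst_le hκ₀ _)
  rw [hD.sum_homBeta hT hκ₀ hκ₁ X hX]
  have h3 := (abs_le.1 h2).1
  linarith

end Material.Admissible

/-- Ellipticity is stable under small perturbations of the entries. -/
lemma LowerBound.of_abs_sub_le {n : ℕ} {κ ε : ℝ} {a b : Fin n → Fin n → ℝ} (h : LowerBound κ a)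
    (hab : ∀ i j, |b i j - a i j| ≤ ε) (hε : n * ε ≤ κ / 2) : LowerBound (κ / 2) b := by
  intro ξ
  rcases n.eq_zero_or_pos with rfl | hn
  · simp
  have hε0 : 0 ≤ ε := (abs_nonneg _).trans (hab ⟨0, hn⟩ ⟨0, hn⟩)
  have hs : 0 ≤ ∑ i, ξ i ^ 2 := Finset.sum_nonneg fun _ _ => sq_nonneg _
  have h1 : ∑ i, ∑ j, (a i j - b i j) * ξ i * ξ j ≤ ∑ i, ∑ j, ε * (|ξ i| * |ξ j|) := by
    refine Finset.sum_le_sum fun i _ => Finset.sum_le_sum fun j _ => ?_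
    refine (le_abs_self _).trans ?_
    rw [abs_mul, abs_mul, abs_sub_comm, mul_assoc]
    exact mul_le_mul_of_nonneg_right (hab i j) (by positivity)
  have h2 : ∑ i, ∑ j, ε * (|ξ i| * |ξ j|) = ε * (∑ i, |ξ i|) ^ 2 := by
    rw [sq, Finset.sum_mul_sum, Finset.mul_sum]
    simp only [Finset.mul_sum]
  have h3 : (∑ i, |ξ i|) ^ 2 ≤ n * ∑ i, ξ i ^ 2 := by
    have := sq_sum_le_card_mul_sum_sq (s := Finset.univ) (f := fun i => |ξ i|)
    simpa using this
  have h4 : ∑ i, ∑ j, (a i j - b i j) * ξ i * ξ j =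
      ∑ i, ∑ j, a i j * ξ i * ξ j - ∑ i, ∑ j, b i j * ξ i * ξ j := by
    simp only [← Finset.sum_sub_distrib, sub_mul]
  have h5 := h ξ
  have h6 : ε * (∑ i, |ξ i|) ^ 2 ≤ κ / 2 * ∑ i, ξ i ^ 2 :=
    calc ε * (∑ i, |ξ i|) ^ 2 ≤ ε * (n * ∑ i, ξ i ^ 2) := mul_le_mul_of_nonneg_left h3 hε0
      _ = n * ε * ∑ i, ξ i ^ 2 := by ring
      _ ≤ _ := mul_le_mul_of_nonneg_right hε hs
  linarith

end Thermal

/-! ### Estimates for all coefficients -/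

section Estimates

variable {n : ℕ} {κ₀ κ₁ ρ₀ ρ₁ c₀ c₁ Tmin Tmax T σ : ℝ} {D : Material n} {𝒯 : Mesh n}
  {X Xh : CellFunctions n}

/-- Error estimates and bounds for the coefficients that derive from the elasticity problems. -/
theorem elastic_estimates (hn : n ≤ 3) (hσ : 𝒯.ShapeRegular σ)
    (hD : D.Admissible κ₀ κ₁ ρ₀ ρ₁ c₀ c₁ Tmin Tmax) (hT : T ∈ Set.Icc Tmin Tmax)
    (hκ₀ : 0 < κ₀) (hκ₁ : 0 < κ₁) (hρ₀ : 0 < ρ₀) (hc₀ : 0 < c₀) (hT0 : 0 ≤ T)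
    (hX : SolvesCellProblems D T (H10 n) X) (hX2 : X.InH2)
    (hXh : SolvesCellProblems D T 𝒯.P1 Xh) :
    (|homS D T Xh - homS D T X| ≤ T * (κ₁ * interpConst n σ * 𝒯.size ^ 2 * H2normVec X.P ^ 2) ∧
      ρ₀ * c₀ ≤ homS D T Xh ∧ homS D T Xh ≤ ρ₁ * c₁ + T * (n ^ 2 * κ₁ ^ 2 / κ₀)) ∧
    ((∀ i j k l, |homC D T Xh i j k l - homC D T X i j k l| ≤
        κ₁ * interpConst n σ * 𝒯.size ^ 2 * H2normVec (X.N i j) * H2normVec (X.N k l)) ∧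
      TensorBounds κ₀ κ₁ (homC D T Xh)) ∧
    ((∀ i j, |homBeta D T Xh i j - homBeta D T X i j| ≤
        κ₁ * interpConst n σ * 𝒯.size ^ 2 * H2normVec (X.N i j) * H2normVec X.P) ∧
      UpperBound (κ₁ + √(n ^ 2 * κ₁ ^ 2 / κ₀) * √κ₁) (homBeta D T Xh)) := by
  have hc := hD.isEnergy_c hT hκ₁
  have hsymm := hc.form_symm hκ₀
  have hpos := hc.form_nonneg hκ₀
  have GN := fun p : Fin n × Fin n => isGalerkin_vec hc hκ₀ (F := hc.load hκ₀ p)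
    (hX.memN p.1 p.2) (hXh.memN p.1 p.2)
    (fun v hv1 hv => (hX.eqN p.1 p.2 v hv).trans (load_gradVec hc hκ₀ p.1 p.2 v hv1).symm)
    (fun v hv1 hv => (hXh.eqN p.1 p.2 v hv).trans (load_gradVec hc hκ₀ p.1 p.2 v hv1).symm)
  have GP := isGalerkin_vec hc hκ₀ (F := pairing (hD.betaField hT hκ₀)) hX.memP hXh.memP
    (fun v hv1 hv => (hX.eqP v hv).trans (hD.pairing_gradVec hT hκ₀ hv1).symm)
    (fun v hv1 hv => (hXh.eqP v hv).trans (hD.pairing_gradVec hT hκ₀ hv1).symm)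
  have EN := fun p : Fin n × Fin n =>
    energy_error_vec_le hn hσ hc hκ₀ hκ₁ (hX2.N p.1 p.2) (hX.memN p.1 p.2) (GN p)
  have EP := energy_error_vec_le hn hσ hc hκ₀ hκ₁ hX2.P hX.memP GP
  have hs := 𝒯.size_nonneg
  have hN : ∀ u : Fin n → Pt n → ℝ, 0 ≤ H2normVec u := fun u => Real.sqrt_nonneg _
  have hsq : √(κ₁ * interpConst n σ) ^ 2 = κ₁ * interpConst n σ :=
    Real.sq_sqrt (by unfold interpConst; positivity)
  have ha : ∀ u : Fin n → Pt n → ℝ, 0 ≤ √(κ₁ * interpConst n σ) * 𝒯.size * H2normVec u :=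
    fun u => by have := hN u; positivity
  have hmean : ∀ p r : Fin n × Fin n, ∫ y,
      (gradVec (Xh.N p.1 p.2) fun k => memH1_of_P1 (hXh.memN p.1 p.2 k)).1 r y ∂(μY n) = 0 :=
    fun p r => integral_weakD_eq_zero (P1_subset_H10 𝒯 (hXh.memN p.1 p.2 r.1)) r.2
  have hPP := GP.eq _ GP.mem
  have hPPh := GP.eqh _ GP.memh
  have hQ := hc.form_le_of_eq_pairing hκ₀ (hD.beta_bounds hT hκ₀) hPPh
  have eX := hD.homS_eq hT hκ₀ hρ₀ hc₀ X fun k => memH1_of_H10 (hX.memP k)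
  have eXh := hD.homS_eq hT hκ₀ hρ₀ hc₀ Xh fun k => memH1_of_P1 (hXh.memP k)
  obtain ⟨hρ, hρ'⟩ := hD.integral_rho_mul_heat hT hρ₀ hc₀
  refine ⟨⟨?_, ?_, ?_⟩, ⟨fun i j k l => ?_, fun ζ hζ => ?_⟩, fun i j => ?_, ?_⟩
  · have h1 := GP.functional_error GP hsymm
    rw [eX, eXh, add_sub_add_left_eq_sub, ← mul_sub, abs_mul, abs_of_nonneg hT0, abs_sub_comm, h1,
      abs_of_nonneg (hpos _)]
    refine mul_le_mul_of_nonneg_left (EP.trans (le_of_eq ?_)) hT0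
    linear_combination 𝒯.size ^ 2 * H2normVec X.P ^ 2 * hsq
  · rw [eXh, ← hPPh]
    have := mul_nonneg hT0 (hpos (gradVec Xh.P fun k => memH1_of_P1 (hXh.memP k)))
    linarith
  · rw [eXh, ← hPPh]
    have := mul_le_mul_of_nonneg_left hQ hT0
    linarith
  · have e := hom_vec hc hκ₀ (fun m α k => memH1_of_H10 (hX.memN m α k)) i j k l
    have eh := hom_vec hc hκ₀ (fun m α k => memH1_of_P1 (hXh.memN m α k)) i j k l
    rw [homC, homC, e, eh, hc.hom_sub_hom hκ₀ GN]
    refine (abs_form_le hsymm hpos (ha _) (ha _) (EN (i, j)) (EN (k, l))).trans (le_of_eq ?_)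
    linear_combination 𝒯.size ^ 2 * H2normVec (X.N i j) * H2normVec (X.N k l) * hsq
  · have eh := hom_vec hc hκ₀ fun m α k => memH1_of_P1 (hXh.memN m α k)
    have e : ∑ i, ∑ j, ∑ k, ∑ l, homC D T Xh i j k l * ζ i j * ζ k l =
        ∑ p : Fin n × Fin n, ∑ q : Fin n × Fin n, hc.hom hκ₀ (fun p => gradVec (Xh.N p.1 p.2)
          fun k => memH1_of_P1 (hXh.memN p.1 p.2 k)) p q * ζ p.1 p.2 * ζ q.1 q.2 := by
      simp only [Fintype.sum_prod_type, homC, eh]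
    have e2 : ∑ i, ∑ j, ζ i j ^ 2 = ∑ p : Fin n × Fin n, ζ p.1 p.2 ^ 2 := by
      rw [Fintype.sum_prod_type]
    rw [e, e2]
    exact ⟨hc.le_sum_hom hκ₀ GN hmean (fun p => ζ p.1 p.2) fun p => hζ _ _,
      hc.sum_hom_le hκ₀ GN fun p => ζ p.1 p.2⟩
  · have h1 := (GN (i, j)).functional_error GP hsymm
    rw [IsEnergy.load, LinearMap.neg_apply, LinearMap.neg_apply, hsymm, hsymm (cst n _)] at h1
    rw [hD.homBeta_eq hT hκ₀ hκ₁ Xh fun k => memH1_of_P1 (hXh.memP k),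
      hD.homBeta_eq hT hκ₀ hκ₁ X fun k => memH1_of_H10 (hX.memP k), sub_sub_sub_cancel_left]
    have h2 := abs_form_le hsymm hpos (ha _) (ha _) (EN (i, j)) EP
    rw [← h1, ← abs_neg] at h2
    refine le_trans (le_of_eq ?_) (h2.trans (le_of_eq ?_))
    · congr 1
      ring
    · linear_combination 𝒯.size ^ 2 * H2normVec (X.N i j) * H2normVec X.P * hsq
  · exact hD.upperBound_homBeta hT hκ₀ hκ₁ Xh (fun k => memH1_of_P1 (hXh.memP k))
      (by positivity) hQ

lemma UpperBound.mono {κ κ' : ℝ} {a : Fin n → Fin n → ℝ} (h : UpperBound κ a) (hκ : κ ≤ κ') :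
    UpperBound κ' a := fun ξ =>
  (h ξ).trans (mul_le_mul_of_nonneg_right hκ (Finset.sum_nonneg fun _ _ => sq_nonneg _))

lemma LowerBound.mono {κ κ' : ℝ} {a : Fin n → Fin n → ℝ} (h : LowerBound κ a) (hκ : κ' ≤ κ) :
    LowerBound κ' a := fun ξ =>
  (mul_le_mul_of_nonneg_right hκ (Finset.sum_nonneg fun _ _ => sq_nonneg _)).trans (h ξ)

lemma TensorBounds.mono {κ μ κ' μ' : ℝ} {a : Fin n → Fin n → Fin n → Fin n → ℝ}
    (h : TensorBounds κ μ a) (hκ : κ' ≤ κ) (hμ : μ ≤ μ') : TensorBounds κ' μ' a := fun ζ hζ =>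
  have hs : 0 ≤ ∑ i, ∑ j, ζ i j ^ 2 :=
    Finset.sum_nonneg fun _ _ => Finset.sum_nonneg fun _ _ => sq_nonneg _
  ⟨(mul_le_mul_of_nonneg_right hκ hs).trans (h ζ hζ).1,
    (h ζ hζ).2.trans (mul_le_mul_of_nonneg_right hμ hs)⟩

end Estimates

end CellFE

end

/-- Finite element approximation of the homogenized coefficients. `κβ` is the ellipticity constant
of the exact homogenized thermal modulus; it is used only in the last clause. -/
theorem lemma5p2 (n : ℕ) (hn : n = 2 ∨ n = 3)
    (κ₀ κ₁ ρ₀ ρ₁ c₀ c₁ Tmin Tmax σ κβ : ℝ)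
    (hκ₀ : 0 < κ₀) (hκ₁ : 0 < κ₁) (hρ₀ : 0 < ρ₀) (hρ₁ : 0 < ρ₁) (hc₀ : 0 < c₀) (hc₁ : 0 < c₁)
    (hT : 0 ≤ Tmin) (hσ : 0 < σ) (hκβ : 0 < κβ) :
    ∃ C S₀ S₁ κ₀' κ₁' : ℝ, 0 < C ∧ 0 < S₀ ∧ 0 < S₁ ∧ 0 < κ₀' ∧ 0 < κ₁' ∧
      ∀ R : ℝ, 0 < R → ∃ hstar : ℝ, 0 < hstar ∧
      ∀ D : CellFE.Material n, D.Admissible κ₀ κ₁ ρ₀ ρ₁ c₀ c₁ Tmin Tmax →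
      ∀ T ∈ Set.Icc Tmin Tmax,
      ∀ X : CellFE.CellFunctions n, CellFE.SolvesCellProblems D T (CellFE.H10 n) X → X.InH2 →
      ∀ 𝒯 : CellFE.Mesh n, 𝒯.ShapeRegular σ →
      ∀ Xh : CellFE.CellFunctions n, CellFE.SolvesCellProblems D T 𝒯.P1 Xh →
        (|CellFE.homS D T Xh - CellFE.homS D T X| ≤
            C * 𝒯.size ^ 2 * CellFE.H2normVec X.P ^ 2 ∧
          S₀ ≤ CellFE.homS D T Xh ∧ CellFE.homS D T Xh ≤ S₁) ∧
        ((∀ i j, |CellFE.homK D T Xh i j - CellFE.homK D T X i j| ≤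
            C * 𝒯.size ^ 2 * CellFE.H2norm (X.M i) * CellFE.H2norm (X.M j)) ∧
          CellFE.LowerBound κ₀' (CellFE.homK D T Xh) ∧
          CellFE.UpperBound κ₁' (CellFE.homK D T Xh)) ∧
        ((∀ i j, |CellFE.homLam D T Xh i j - CellFE.homLam D T X i j| ≤
            C * 𝒯.size ^ 2 * CellFE.H2norm (X.H i) * CellFE.H2norm (X.H j)) ∧
          CellFE.LowerBound κ₀' (CellFE.homLam D T Xh) ∧
          CellFE.UpperBound κ₁' (CellFE.homLam D T Xh)) ∧
        ((∀ i j k l, |CellFE.homC D T Xh i j k l - CellFE.homC D T X i j k l| ≤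
            C * 𝒯.size ^ 2 * CellFE.H2normVec (X.N i j) * CellFE.H2normVec (X.N k l)) ∧
          CellFE.TensorBounds κ₀' κ₁' (CellFE.homC D T Xh)) ∧
        ((∀ i j, |CellFE.homBeta D T Xh i j - CellFE.homBeta D T X i j| ≤
            C * 𝒯.size ^ 2 * CellFE.H2normVec (X.N i j) * CellFE.H2normVec X.P) ∧
          CellFE.UpperBound κ₁' (CellFE.homBeta D T Xh) ∧
          (CellFE.LowerBound κβ (CellFE.homBeta D T X) →
            𝒯.size ≤ hstar → (∀ i j, CellFE.H2normVec (X.N i j) ≤ R) → CellFE.H2normVec X.P ≤ R →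
            CellFE.LowerBound κ₀' (CellFE.homBeta D T Xh))) := by
  have hn3 : n ≤ 3 := by omega
  have hn0 : 0 < n := by omega
  have hn0' : (0 : ℝ) < n := by exact_mod_cast hn0
  set K := κ₁ * CellFE.interpConst n σ with hK
  have hK0 : 0 < K := by unfold K CellFE.interpConst; positivity
  set C := (1 + |Tmax|) * K with hC
  have hC0 : 0 < C := by positivity
  have hKC : K ≤ C := by
    rw [hC, one_add_mul]
    linarith [mul_nonneg (abs_nonneg Tmax) hK0.le]
  set Q := (n : ℝ) ^ 2 * κ₁ ^ 2 / κ₀ with hQ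
  have hQ0 : 0 < Q := by positivity
  set κ₁' := κ₁ + √Q * √κ₁ with hκ₁'
  have hle1 : κ₁ ≤ κ₁' := by
    have : 0 ≤ √Q * √κ₁ := by positivity
    linarith
  refine ⟨C, ρ₀ * c₀, ρ₁ * c₁ + |Tmax| * Q, min κ₀ (κβ / 2), κ₁', hC0, by positivity,
    by positivity, by positivity, by linarith, fun R hR => ?_⟩
  -- With this choice `n * (C * h ^ 2 * R ^ 2) ≤ κβ / 2` for all `h ≤ hstar`.
  refine ⟨√(κβ / (2 * (n * C * R ^ 2))), by positivity, ?_⟩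
  intro D hD T hTm X hX hX2 𝒯 h𝒯 Xh hXh
  have hT0 : 0 ≤ T := hT.trans hTm.1
  have hTle : T ≤ |Tmax| := hTm.2.trans (le_abs_self _)
  have hs := 𝒯.size_nonneg
  have hmono : ∀ a b : ℝ, 0 ≤ a → 0 ≤ b →
      K * 𝒯.size ^ 2 * a * b ≤ C * 𝒯.size ^ 2 * a * b := fun a b ha hb => by gcongr
  have hN : ∀ u : CellFE.Pt n → ℝ, 0 ≤ CellFE.H2norm u := fun u => Real.sqrt_nonneg _
  have hNv : ∀ u : Fin n → CellFE.Pt n → ℝ, 0 ≤ CellFE.H2normVec u := fun u => Real.sqrt_nonneg _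
  obtain ⟨⟨s1, s2, s3⟩, ⟨t1, t2⟩, b1, b2⟩ :=
    CellFE.elastic_estimates hn3 h𝒯 hD hTm hκ₀ hκ₁ hρ₀ hc₀ hT0 hX hX2 hXh
  obtain ⟨k1, k2, k3⟩ := CellFE.scalar_estimates hn3 h𝒯
    (CellFE.isEnergy_of_ellipticMatrix (hD.meas_k T hTm) (hD.k_elliptic T hTm)) hκ₀ hκ₁
    hX.memM hX2.M hXh.memM hX.eqM hXh.eqM
  obtain ⟨l1, l2, l3⟩ := CellFE.scalar_estimates hn3 h𝒯
    (CellFE.isEnergy_of_ellipticMatrix (hD.meas_lam T hTm) (hD.lam_elliptic T hTm)) hκ₀ hκ₁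
    hX.memH hX2.H hXh.memH hX.eqH hXh.eqH
  have hle0 : min κ₀ (κβ / 2) ≤ κ₀ := min_le_left _ _
  have b1' := fun i j => (b1 i j).trans (hmono _ _ (hNv _) (hNv _))
  refine ⟨⟨s1.trans ?_, s2, s3.trans ?_⟩,
    ⟨fun i j => (k1 i j).trans (hmono _ _ (hN _) (hN _)), k2.mono hle0, k3.mono hle1⟩,
    ⟨fun i j => (l1 i j).trans (hmono _ _ (hN _) (hN _)), l2.mono hle0, l3.mono hle1⟩,
    ⟨fun i j k l => (t1 i j k l).trans (hmono _ _ (hNv _) (hNv _)), t2.mono hle0 hle1⟩,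
    b1', b2, fun hlow hsize hNR hPR => ?_⟩
  · have h1 : T * K ≤ C := by
      rw [hC]; exact mul_le_mul_of_nonneg_right (by linarith) hK0.le
    calc T * (K * 𝒯.size ^ 2 * CellFE.H2normVec X.P ^ 2)
        = T * K * 𝒯.size ^ 2 * CellFE.H2normVec X.P ^ 2 := by ring
      _ ≤ _ := by gcongr
  · have := mul_le_mul_of_nonneg_right hTle hQ0.le
    linarith
  · have hsq : 𝒯.size ^ 2 ≤ κβ / (2 * (n * C * R ^ 2)) := by
      have := pow_le_pow_left₀ hs hsize 2
      rwa [Real.sq_sqrt (by positivity)] at this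
    refine (hlow.of_abs_sub_le (ε := C * 𝒯.size ^ 2 * R * R) (fun i j => (b1' i j).trans ?_)
      ?_).mono (min_le_right _ _)
    · have := hNv X.P
      gcongr
      exact hNR i j
    · calc n * (C * 𝒯.size ^ 2 * R * R) = n * C * R ^ 2 * 𝒯.size ^ 2 := by ring
        _ ≤ n * C * R ^ 2 * (κβ / (2 * (n * C * R ^ 2))) := by gcongr
        _ = κβ / 2 := by field_simp
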